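/- Let $G=\mathrm{PSL}_2(\mathbb R)$ act by fractional linear transformations on the hyperbolic plane $\mathbb H^2$ (upper half plane), equipped with its $G$-invariant Riemannian metric of constant curvature $-\kappa$, $\kappa>0$, and the associated distance $d$. Fix a point $p_0\in\mathbb H^2$. For $r>0$ let $\beta_r$ be the probability measure on $G$ obtained by restricting Haar measure to $\{g\in G:\ d(gp_0,p_0)\le r\}$ and normalizing, and for $r,\epsilon>0$ let $\sigma_{r,\epsilon}$ be the probability measure obtained by restricting Haar measure to $\{g\in G:\ d(gp_0,p_0)\in[r,r+\epsilon]\}$ and normalizing. **Theorem.** The family $\{\beta_r\}_{r>0}$ and, for every fixed $\epsilon>0$, the family $\{\sigma_{r,\epsilon}\}_{r>0}$ are good averaging families, in the following sense. A family $\{\nu_r\}_{r>0}$ of compactly supported Borel probability measures on $G$, such that $r\mapsto\int F\,d\nu_r$ is continuous on $(0,\infty)$ for every continuous $F:G\to\mathbb R$, is a *good averaging family* if for every measurable measure-preserving action of $G$ on a standard Borel probability space $(X,\mu)$ the following holds, where $\nu_r(f)(x)=\int_G f(g^{-1}x)\,d\nu_r(g)$, $\mathcal M_\nu[f]=\sup_{r>0}\nu_r(|f|)$,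 $\mathbb E[f|G]$ is the conditional expectation of $f$ on the $\sigma$-algebra of $G$-invariant measurable sets, $\|f\|_{L\log L}=\int|f|\log(\max(|f|,1))\,d\mu$, and $L\log L(X,\mu)=\{f\in L^1(X,\mu):\|f\|_{L\log L}<\infty\}$ (functions are complex-valued): 1. for every $1<p<\infty$ and every $f\in L^p(X,\mu)$: $\mathcal M_\nu[f]$ is $\mu$-measurable and $\|\mathcal M_\nu[f]\|_p\le C_p\|f\|_p$; and, as $r\to\infty$, $\nu_r(f)\to\mathbb E[f|G]$ in $L^p$-norm and pointwise almost everywhere; 2. for every $f\in L\log L(X,\mu)$: $\mathcal M_\nu[f]$ is $\mu$-measurable and $\|\mathcal M_\nu[f]\|_1\le C_{L\log L}\,(1+\|f\|_{L\log L})$; and, as $r\to\infty$, $\nu_r(f)\to\mathbb E[f|G]$ in $L^1$-norm and pointwise almost everywhere. Here the constants $C_p$ (depending only on $p$ and the family) and $C_{L\log L}$ (depending only on the family) do not depend on the action or on $f$. -/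

import Mathlib

open MeasureTheory Filter Topology Set
open scoped ENNReal NNReal MatrixGroups

universe u

noncomputable section

namespace ErgodicAverages

/-! ### Averaging operators, maximal functions and good averaging families -/

section Averages

variable {G : Type*} [Group G] [MeasurableSpace G]
variable {X : Type*} [MeasurableSpace X] [MulAction G X]

/-- The averaging operator `ν(f)(x) = ∫ f(g⁻¹ x) dν(g)`. -/
def average (ν : Measure G) (f : X → ℂ) (x : X) : ℂ :=
  ∫ g, f (g⁻¹ • x) ∂ν

/-- The maximal function `sup_{r > 0} ν_r(|f|)(x)`, with values in `[0, ∞]`. -/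
def maximalFunction (ν : ℝ → Measure G) (f : X → ℂ) (x : X) : ℝ≥0∞ :=
  ⨆ (r : ℝ) (_ : 0 < r), ∫⁻ g, ‖f (g⁻¹ • x)‖ₑ ∂(ν r)

variable (G X) in
/-- The σ-algebra of `G`-invariant measurable subsets of `X`. -/
@[reducible]
def invariantSigmaAlgebra : MeasurableSpace X :=
  ⨅ g : G, MeasurableSpace.invariants (fun x : X => g • x)

/-- `∫ |f| log(max(|f|, 1)) dμ`, as an extended nonnegative number. -/
def lLogL (f : X → ℂ) (μ : Measure X) : ℝ≥0∞ :=
  ∫⁻ x, ENNReal.ofReal (‖f x‖ * Real.log (max ‖f x‖ 1)) ∂μ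

/-- Membership in the space `L log L (X, μ)`. -/
def MemLLogL (f : X → ℂ) (μ : Measure X) : Prop :=
  Integrable f μ ∧ lLogL f μ < ∞

/-- The strong type `(p, p)` maximal inequality with constant `C` on `(X, μ)`; measurability of
the maximal function is part of the claim. -/
def StrongTypeWith (ν : ℝ → Measure G) (p : ℝ≥0∞) (C : ℝ≥0) (μ : Measure X) : Prop :=
  ∀ f : X → ℂ, MemLp f p μ →
    AEMeasurable (maximalFunction ν f) μ ∧
      eLpNorm (maximalFunction ν f) p μ ≤ C * eLpNorm f p μ

/-- The `L log L` maximal inequality with constant `C` on `(X, μ)`. The summand `1` is needed since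
`∫ |f| log(max(|f|, 1)) dμ` vanishes whenever `|f| ≤ 1`. -/
def LLogLTypeWith (ν : ℝ → Measure G) (C : ℝ≥0) (μ : Measure X) : Prop :=
  ∀ f : X → ℂ, MemLLogL f μ →
    AEMeasurable (maximalFunction ν f) μ ∧
      ∫⁻ x, maximalFunction ν f x ∂μ ≤ C * (1 + lLogL f μ)

/-- `ν_r(f)` is a well-defined element of `L^p` for all `r > 0`, and converges in `L^p`-norm to the
conditional expectation of `f` on the invariant σ-algebra. -/
def MeanErgodicFor (ν : ℝ → Measure G) (p : ℝ≥0∞) (μ : Measure X) (f : X → ℂ) : Prop :=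
  (∀ r : ℝ, 0 < r → MemLp (average (ν r) f) p μ) ∧
    Tendsto (fun r : ℝ => eLpNorm (average (ν r) f - μ[f | invariantSigmaAlgebra G X]) p μ)
      atTop (𝓝 0)

/-- For almost every `x`, the averages `ν_r(f)(x)` are given by convergent integrals for all
`r > 0`, and converge to the conditional expectation of `f` on the invariant σ-algebra. -/
def PointwiseErgodicFor (ν : ℝ → Measure G) (μ : Measure X) (f : X → ℂ) : Prop :=
  ∀ᵐ x ∂μ, (∀ r : ℝ, 0 < r → Integrable (fun g : G => f (g⁻¹ • x)) (ν r)) ∧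
    Tendsto (fun r : ℝ => average (ν r) f x) atTop
      (𝓝 ((μ[f | invariantSigmaAlgebra G X]) x))

end Averages

section Good

variable {G : Type*} [Group G] [TopologicalSpace G] [MeasurableSpace G]

/-- A one-parameter family of compactly supported probability measures on `G`, continuous in the
parameter `r > 0` when integrated against any continuous function. -/
def IsAveragingFamily (ν : ℝ → Measure G) : Prop :=
  (∀ r : ℝ, 0 < r → IsProbabilityMeasure (ν r)) ∧
  (∀ r : ℝ, 0 < r → ∃ S : Set G, IsCompact S ∧ ν r Sᶜ = 0) ∧
  ∀ F : C(G, ℝ), ContinuousOn (fun r : ℝ => ∫ g, F g ∂(ν r)) (Ioi 0)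

/-- Good averaging family in `L^p`. The quantification is over all measurable
probability-measure-preserving actions of `G` on standard Borel spaces; the constant in the
maximal inequality does not depend on the action. -/
def IsGoodInLp (ν : ℝ → Measure G) (p : ℝ≥0∞) : Prop :=
  ∃ C : ℝ≥0, ∀ (X : Type u) [MeasurableSpace X] [StandardBorelSpace X] [MulAction G X]
    [MeasurableSMul₂ G X] (μ : Measure X) [IsProbabilityMeasure μ] [SMulInvariantMeasure G X μ],
    StrongTypeWith ν p C μ ∧
    ∀ f : X → ℂ, MemLp f p μ → MeanErgodicFor ν p μ f ∧ PointwiseErgodicFor ν μ f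

/-- Good averaging family in `L log L`; here mean convergence is in the norm of `L^1`. -/
def IsGoodInLLogL (ν : ℝ → Measure G) : Prop :=
  ∃ C : ℝ≥0, ∀ (X : Type u) [MeasurableSpace X] [StandardBorelSpace X] [MulAction G X]
    [MeasurableSMul₂ G X] (μ : Measure X) [IsProbabilityMeasure μ] [SMulInvariantMeasure G X μ],
    LLogLTypeWith ν C μ ∧
    ∀ f : X → ℂ, MemLLogL f μ → MeanErgodicFor ν 1 μ f ∧ PointwiseErgodicFor ν μ f

/-- Good averaging family: good in every `L^p`, `1 < p < ∞`, and in `L log L`. -/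
def IsGoodAveragingFamily (ν : ℝ → Measure G) : Prop :=
  IsAveragingFamily ν ∧
  (∀ p : ℝ≥0∞, 1 < p → p < ∞ → IsGoodInLp.{u} ν p) ∧
  IsGoodInLLogL.{u} ν

end Good

/-! ### The group `PSL₂(ℝ)` and its action on the hyperbolic plane -/

/-- `PSL₂(ℝ) = SL₂(ℝ) / {±1}`, with the quotient topology. -/
abbrev PSL2R : Type := Matrix.ProjectiveSpecialLinearGroup (Fin 2) ℝ

instance : MeasurableSpace PSL2R := borel PSL2R

instance : BorelSpace PSL2R := ⟨rfl⟩

instance : LocallyCompactSpace SL(2, ℝ) := by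
  have : LocallyCompactSpace (Matrix (Fin 2) (Fin 2) ℝ) :=
    inferInstanceAs (LocallyCompactSpace (Fin 2 → Fin 2 → ℝ))
  have h : IsClosed {A : Matrix (Fin 2) (Fin 2) ℝ | A.det = 1} :=
    isClosed_eq (continuous_id.matrix_det) continuous_const
  exact h.isClosedEmbedding_subtypeVal.locallyCompactSpace

/-- The centre of `SL₂(ℝ)` acts trivially on the upper half plane. -/
theorem center_le_ker_toPermHom :
    Subgroup.center SL(2, ℝ) ≤ (MulAction.toPermHom SL(2, ℝ) UpperHalfPlane).ker := by
  intro A hA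
  obtain ⟨r, hr, h⟩ := Matrix.SpecialLinearGroup.mem_center_iff.mp hA
  have hr0 : (r : ℂ) ≠ 0 := by
    intro h0
    have : r = 0 := by exact_mod_cast h0
    simp [this] at hr
  have h00 : A 0 0 = r := by rw [← h]; simp
  have h01 : A 0 1 = 0 := by rw [← h]; simp
  have h10 : A 1 0 = 0 := by rw [← h]; simp
  have h11 : A 1 1 = r := by rw [← h]; simp
  rw [MonoidHom.mem_ker]
  ext1 z
  change A • z = z
  apply UpperHalfPlane.ext
  rw [UpperHalfPlane.coe_specialLinearGroup_apply, h00, h01, h10, h11]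
  simp [mul_div_cancel_left₀ _ hr0]

/-- The action of `PSL₂(ℝ)` on the upper half plane by fractional linear transformations. -/
instance : MulAction PSL2R UpperHalfPlane :=
  MulAction.compHom UpperHalfPlane
    (QuotientGroup.lift (Subgroup.center SL(2, ℝ)) (MulAction.toPermHom SL(2, ℝ) UpperHalfPlane)
      center_le_ker_toPermHom)

theorem mk_smul (A : SL(2, ℝ)) (z : UpperHalfPlane) :
    (QuotientGroup.mk A : PSL2R) • z = A • z := rfl

/-- The distance of the hyperbolic plane of constant curvature `-κ`, `κ > 0`. In Mathlib,
`dist` on the upper half plane is the hyperbolic distance for curvature `-1`. -/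
def hypDist (κ : ℝ) (z w : UpperHalfPlane) : ℝ := dist z w / Real.sqrt κ

/-- Normalized restriction of Haar measure on `PSL₂(ℝ)` to the set of `g` which displace `p₀` by
at most `r`. -/
def ballAverage (κ : ℝ) (p₀ : UpperHalfPlane) (r : ℝ) : Measure PSL2R :=
  ProbabilityTheory.cond Measure.haar {g : PSL2R | hypDist κ (g • p₀) p₀ ≤ r}

/-- Normalized restriction of Haar measure on `PSL₂(ℝ)` to the set of `g` which displace `p₀` by
a distance in `[r, r + ε]`. -/
def shellAverage (κ : ℝ) (p₀ : UpperHalfPlane) (ε r : ℝ) : Measure PSL2R :=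
  ProbabilityTheory.cond Measure.haar {g : PSL2R | hypDist κ (g • p₀) p₀ ∈ Icc r (r + ε)}

end ErgodicAverages

end

/-!
In the polar decomposition of `PSL₂(ℝ)` the proof uses a unipotent one-parameter subgroup `n` in
the place of the usual diagonal one. Let `K` be the stabilizer of `p₀` and measure the
displacement of `g` by `radius p₀ g = 2 sinh (dist (g • p₀) p₀ / 2)`. For a suitable conjugate `n`
of the upper unipotent group, `n s` has radius `|s|`, so each `g` is in `K * n (radius p₀ g) * K`.
The Haar measure of `{g | radius p₀ g ≤ S}` is proportional to `S ^ 2` (`exists_map_radius_haar`).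
Hence the Haar measure restricted to the radii in `[a, b]` is, after normalization, the law of
`k * n s * k'` with independent uniformly distributed `k, k' ∈ K` and with `s ∈ [a, b]` distributed
with a density proportional to `s` (`shell_eq_map`). In other words, its averaging operator is
`P W P`, where `P` is the average over `K` and `W` is a linearly weighted average along the flow of
`n`. Balls and shells are both of this form, with `b ≤ C (b - a)` for a constant `C`.

*Maximal inequalities.* `W` is at most a constant times the maximal function of the flow, which is
of weak type `(1, 1)` by the maximal ergodic theorem (`IsFlow.weak_type`). The average `P` is a
contraction in `L¹` and in `L^∞`, so the weak type inequality survives the inner `P` in the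
truncated form `WeakMaximal` (`weakMaximal_flowMax_lmean`), which gives the `L^p` and `L log L`
inequalities. The outer `P` is a contraction in every `L^p`.

*Convergence.* Invariant functions and coboundaries of `n` span a dense subspace of `L²`, on which
the averages `W` converge almost everywhere; the weak type inequality extends this to `L¹`
(`flowConverges_of_integrable`). The limit is the conditional expectation on the sets that are
invariant under all of `PSL₂(ℝ)`, because `n`-invariant functions are invariant under the whole
group (the Mautner phenomenon, `hasMautner_unip`). The limit is constant on orbits, and the
maximal function of the flow is integrable over almost every `K`-orbit when `f` is in `L log L`.
So dominated convergence carries the outer `P` along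
(`IsPolarFamily.pointwiseErgodicFor_of_measurable`), and dominated convergence with the maximal
function gives convergence in the mean.
-/

noncomputable section

namespace ErgodicAverages

/-! ### The discrete maximal ergodic inequality -/

/-- Finitary covering inequality behind the maximal ergodic theorem: the times `j < L` from which
some window of length at most `N` has average at least `c` are covered by disjoint such windows. -/
theorem card_mul_le_sum (c : ℝ≥0∞) (N : ℕ) (L : ℕ) : ∀ a : ℕ → ℝ≥0∞,
    (∑ j ∈ Finset.range L,
      {j : ℕ | ∃ n ∈ Finset.Icc 1 N, c * n < ∑ i ∈ Finset.range n, a (j + i)}.indicator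
        (fun _ => c) j) ≤ ∑ i ∈ Finset.range (L + N), a i := by
  induction L using Nat.strong_induction_on with
  | _ L ih =>
    intro a
    rcases Nat.eq_zero_or_pos L with rfl | hL
    · simp
    -- if a window starts at `0`, it pays for all times it covers; otherwise the time `0` is skipped
    by_cases h0 : ∃ n ∈ Finset.Icc 1 N, c * n < ∑ i ∈ Finset.range n, a i
    · obtain ⟨n, hn, hlt⟩ := h0
      rw [Finset.mem_Icc] at hn
      rcases le_or_gt L n with hLn | hLn
      · calc _ ≤ ∑ j ∈ Finset.range L, c :=
              Finset.sum_le_sum fun j _ => Set.indicator_le_self' (fun _ _ => zero_le) j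
          _ = c * L := by simp [mul_comm]
          _ ≤ c * n := by gcongr
          _ ≤ ∑ i ∈ Finset.range n, a i := hlt.le
          _ ≤ _ := Finset.sum_le_sum_of_subset (by
              intro i; simp only [Finset.mem_range]; omega)
      · obtain ⟨m, rfl⟩ := Nat.exists_eq_add_of_lt hLn
        have key := ih (m + 1) (by omega) (fun i => a (n + i))
        rw [show n + m + 1 = n + (m + 1) by ring, Finset.sum_range_add, add_assoc n,
          Finset.sum_range_add a]
        refine add_le_add ?_ ?_
        · calc _ ≤ ∑ j ∈ Finset.range n, c :=
                Finset.sum_le_sum fun j _ => Set.indicator_le_self' (fun _ _ => zero_le) j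
            _ = c * n := by simp [mul_comm]
            _ ≤ _ := hlt.le
        · refine le_trans (le_of_eq (Finset.sum_congr rfl fun j _ => ?_)) key
          simp only [Set.indicator_apply, mem_ofPred_eq, add_assoc]
    · obtain ⟨m, rfl⟩ := Nat.exists_eq_succ_of_ne_zero hL.ne'
      have key := ih m (by omega) (fun i => a (i + 1))
      rw [Finset.sum_range_succ', show m.succ + N = (m + N) + 1 by omega,
        Finset.sum_range_succ' a]
      refine add_le_add ?_ ?_
      · refine le_trans (le_of_eq (Finset.sum_congr rfl fun j _ => ?_)) key
        simp only [Set.indicator_apply, mem_ofPred_eq, add_assoc, add_comm, add_left_comm]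
      · rw [Set.indicator_of_notMem]
        · exact zero_le
        · simpa using h0

variable {X : Type*} [MeasurableSpace X] {μ : Measure X}

/-- The maximal ergodic theorem for windows of length at most `N`: the covering inequality is
integrated along orbits of length `L`, and the error of the windows that stick out vanishes as
`L → ∞`. -/
theorem maximal_ergodic_aux [IsFiniteMeasure μ] {T : X → X} (hT : MeasurePreserving T μ μ)
    {F : X → ℝ≥0∞} (hF : Measurable F) (c : ℝ≥0) (N : ℕ) :
    c * μ {x | ∃ n ∈ Finset.Icc 1 N, (c : ℝ≥0∞) * n < ∑ i ∈ Finset.range n, F (T^[i] x)}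
      ≤ ∫⁻ x, F x ∂μ := by
  set E := {x | ∃ n ∈ Finset.Icc 1 N, (c : ℝ≥0∞) * n < ∑ i ∈ Finset.range n, F (T^[i] x)} with hE
  have hTi (i : ℕ) : MeasurePreserving T^[i] μ μ := hT.iterate i
  have hEm : MeasurableSet E := by
    have : E = ⋃ n ∈ Finset.Icc 1 N, {x | (c : ℝ≥0∞) * n < ∑ i ∈ Finset.range n, F (T^[i] x)} := by
      ext x; simp [hE]
    rw [this]
    refine Finset.measurableSet_biUnion _ fun n _ => measurableSet_lt measurable_const ?_
    exact Finset.measurable_sum _ fun i _ => hF.comp (hTi i).measurable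
  by_cases hI : ∫⁻ x, F x ∂μ = ∞
  · simp [hI]
  have main (L : ℕ) : (L : ℝ≥0∞) * (c * μ E) ≤ (L + N : ℕ) * ∫⁻ x, F x ∂μ := by
    have h1 (j : ℕ) : ∫⁻ x, E.indicator (fun _ => (c : ℝ≥0∞)) (T^[j] x) ∂μ = c * μ E := by
      rw [(hTi j).lintegral_comp (f := E.indicator fun _ => (c : ℝ≥0∞))
        (measurable_const.indicator hEm), lintegral_indicator_const hEm]
    have h2 (j : ℕ) : ∫⁻ x, F (T^[j] x) ∂μ = ∫⁻ x, F x ∂μ := (hTi j).lintegral_comp hF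
    calc (L : ℝ≥0∞) * (c * μ E)
        = ∑ j ∈ Finset.range L, ∫⁻ x, E.indicator (fun _ => (c : ℝ≥0∞)) (T^[j] x) ∂μ := by
          simp [h1]
      _ = ∫⁻ x, ∑ j ∈ Finset.range L, E.indicator (fun _ => (c : ℝ≥0∞)) (T^[j] x) ∂μ := by
          rw [lintegral_finsetSum]
          exact fun j _ => (measurable_const.indicator hEm).comp (hTi j).measurable
      _ ≤ ∫⁻ x, ∑ i ∈ Finset.range (L + N), F (T^[i] x) ∂μ := by
          refine lintegral_mono fun x => ?_
          refine le_trans (Finset.sum_le_sum fun j _ => ?_)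
            (card_mul_le_sum (c : ℝ≥0∞) N L fun i => F (T^[i] x))
          refine le_of_eq ?_
          simp only [Set.indicator_apply, hE, mem_ofPred_eq, ← Function.iterate_add_apply,
            add_comm j]
      _ = (L + N : ℕ) * ∫⁻ x, F x ∂μ := by
          rw [lintegral_finsetSum]
          · simp [h2]
          · exact fun i _ => hF.comp (hTi i).measurable
  -- divide by `L` and let `L → ∞`
  have hlim : Tendsto (fun L : ℕ => ∫⁻ x, F x ∂μ + (N * ∫⁻ x, F x ∂μ) / (L : ℝ≥0∞)) atTop
      (𝓝 (∫⁻ x, F x ∂μ + 0)) := by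
    refine tendsto_const_nhds.add ?_
    exact ENNReal.Tendsto.const_div ENNReal.tendsto_nat_nhds_top
      (Or.inr (ENNReal.mul_ne_top (by simp) hI)) |>.trans (by simp)
  rw [add_zero] at hlim
  refine ge_of_tendsto hlim ?_
  filter_upwards [eventually_gt_atTop 0] with L hL
  have hL' : (L : ℝ≥0∞) ≠ 0 := by simpa using hL.ne'
  have := main L
  rw [mul_comm, ← ENNReal.le_div_iff_mul_le (Or.inl hL') (Or.inl (by simp))] at this
  refine this.trans (le_of_eq ?_)
  push_cast
  rw [add_mul, ENNReal.add_div, mul_comm (L : ℝ≥0∞), ENNReal.mul_div_cancel_right hL' (by simp)]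

/-- The maximal ergodic theorem: the one-sided discrete ergodic maximal function is of weak type
`(1, 1)` with constant `1`. -/
theorem maximal_ergodic [IsFiniteMeasure μ] {T : X → X} (hT : MeasurePreserving T μ μ)
    {F : X → ℝ≥0∞} (hF : Measurable F) (c : ℝ≥0) :
    c * μ {x | ∃ n : ℕ, 1 ≤ n ∧ (c : ℝ≥0∞) * n < ∑ i ∈ Finset.range n, F (T^[i] x)}
      ≤ ∫⁻ x, F x ∂μ := by
  have : {x | ∃ n : ℕ, 1 ≤ n ∧ (c : ℝ≥0∞) * n < ∑ i ∈ Finset.range n, F (T^[i] x)} =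
      ⋃ N : ℕ, {x | ∃ n ∈ Finset.Icc 1 N,
        (c : ℝ≥0∞) * n < ∑ i ∈ Finset.range n, F (T^[i] x)} := by
    ext x
    simp only [mem_ofPred_eq, mem_iUnion, Finset.mem_Icc]
    exact ⟨fun ⟨n, h1, h2⟩ => ⟨n, n, ⟨h1, le_rfl⟩, h2⟩, fun ⟨_, n, h1, h2⟩ => ⟨n, h1.1, h2⟩⟩
  rw [this, Monotone.measure_iUnion, ENNReal.mul_iSup]
  · exact iSup_le fun N => maximal_ergodic_aux hT hF c N
  · intro N M hNM x ⟨n, hn, h⟩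
    rw [Finset.mem_Icc] at hn
    exact ⟨n, Finset.mem_Icc.2 ⟨hn.1, hn.2.trans hNM⟩, h⟩

/-! ### From a weak type inequality to `L^p` and `L log L` -/

/-- `M` satisfies the weak type bound of a maximal function of `h`, with the mass of `h` taken only
where `h` exceeds the level. This is what a sublinear operator that is of weak type `(1, 1)` and a
contraction of `L^∞` satisfies. -/
def WeakMaximal (μ : Measure X) (C : ℝ≥0) (h M : X → ℝ≥0∞) : Prop :=
  ∀ t : ℝ≥0, 0 < t → t * μ {x | 2 * (t : ℝ≥0∞) < M x} ≤ C * ∫⁻ x in {x | (t : ℝ≥0∞) < h x}, h x ∂μ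

theorem WeakMaximal.ae_lt_top {C : ℝ≥0} {h M : X → ℝ≥0∞} (hw : WeakMaximal μ C h M)
    (hI : ∫⁻ x, h x ∂μ ≠ ∞) : ∀ᵐ x ∂μ, M x < ∞ := by
  have hlim : Tendsto (fun n : ℕ => (C * ∫⁻ x, h x ∂μ) / (n : ℝ≥0∞)) atTop (𝓝 0) := by
    exact ENNReal.Tendsto.const_div ENNReal.tendsto_nat_nhds_top
      (Or.inr (ENNReal.mul_ne_top (by simp) hI)) |>.trans (by simp)
  rw [ae_iff]
  refine le_antisymm (ge_of_tendsto hlim ?_) zero_le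
  filter_upwards [eventually_gt_atTop 0] with n hn
  have hn' : (n : ℝ≥0∞) ≠ 0 := by simpa using hn.ne'
  rw [ENNReal.le_div_iff_mul_le (Or.inl hn') (Or.inl (by simp)), mul_comm]
  calc (n : ℝ≥0∞) * μ {x | ¬ M x < ∞}
      ≤ (n : ℝ≥0) * μ {x | 2 * ((n : ℝ≥0) : ℝ≥0∞) < M x} := by
        push_cast
        gcongr with x
        intro hx
        simp only [not_lt, top_le_iff] at hx
        simp only [hx]
        exact ENNReal.mul_lt_top (by simp) (by simp)
    _ ≤ C * ∫⁻ x in {x | ((n : ℝ≥0) : ℝ≥0∞) < h x}, h x ∂μ := hw n (by exact_mod_cast hn)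
    _ ≤ _ := by gcongr; exact Measure.restrict_le_self

/-- The weak type inequality integrated over the levels `t ∈ S` against a weight `g`. -/
theorem WeakMaximal.lintegral_meas_le [SFinite μ] {C : ℝ≥0} {h M : X → ℝ≥0∞}
    (hw : WeakMaximal μ C h M) (hh : Measurable h) {g : ℝ → ℝ≥0∞} (hg : Measurable g) {S : Set ℝ}
    (hS : MeasurableSet S) (hS0 : S ⊆ Ioi 0) :
    ∫⁻ t in S, μ {x | 2 * ENNReal.ofReal t < M x} * g t ≤
      C * ∫⁻ x, h x * (∫⁻ t in S, {t | ENNReal.ofReal t < h x}.indicator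
        (fun t => g t * ENNReal.ofReal t⁻¹) t) ∂μ := by
  have hmeas : MeasurableSet {q : ℝ × X | ENNReal.ofReal q.1 < h q.2} :=
    measurableSet_lt (by fun_prop) (by fun_prop)
  have hslice (t : ℝ) : MeasurableSet {x | ENNReal.ofReal t < h x} :=
    measurableSet_lt measurable_const hh
  calc ∫⁻ t in S, μ {x | 2 * ENNReal.ofReal t < M x} * g t
      ≤ ∫⁻ t in S, C * ∫⁻ x, {q : ℝ × X | ENNReal.ofReal q.1 < h q.2}.indicator
          (fun q => h q.2 * (g q.1 * ENNReal.ofReal q.1⁻¹)) (t, x) ∂μ := by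
        refine setLIntegral_mono' hS fun t ht => ?_
        have ht0 : 0 < t := hS0 ht
        have h1 := hw t.toNNReal (by simpa using ht0)
        have h2 : ∫⁻ x, {q : ℝ × X | ENNReal.ofReal q.1 < h q.2}.indicator
            (fun q => h q.2 * (g q.1 * ENNReal.ofReal q.1⁻¹)) (t, x) ∂μ =
            (∫⁻ x in {x | ENNReal.ofReal t < h x}, h x ∂μ) * (g t * ENNReal.ofReal t⁻¹) := by
          rw [← lintegral_mul_const _ hh, ← lintegral_indicator (hslice t)]
          rfl
        rw [h2, ← mul_assoc]
        have h3 : μ {x | 2 * ENNReal.ofReal t < M x} ≤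
            (C * ∫⁻ x in {x | ENNReal.ofReal t < h x}, h x ∂μ) * ENNReal.ofReal t⁻¹ := by
          rw [ENNReal.ofReal_inv_of_pos ht0, ← div_eq_mul_inv,
            ENNReal.le_div_iff_mul_le (by simp [ht0]) (by simp), mul_comm]
          exact h1
        calc _ ≤ _ := mul_le_mul_left h3 _
          _ = _ := by ring
    _ = C * ∫⁻ x, (∫⁻ t in S, {q : ℝ × X | ENNReal.ofReal q.1 < h q.2}.indicator
          (fun q => h q.2 * (g q.1 * ENNReal.ofReal q.1⁻¹)) (t, x)) ∂μ := by
        have hm : Measurable ({q : ℝ × X | ENNReal.ofReal q.1 < h q.2}.indicator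
          (fun q => h q.2 * (g q.1 * ENNReal.ofReal q.1⁻¹))) :=
          Measurable.indicator (by fun_prop) hmeas
        rw [lintegral_const_mul, lintegral_lintegral_swap]
        · exact hm.aemeasurable
        · exact hm.lintegral_prod_right'
    _ = _ := by
        congr 1
        refine lintegral_congr fun x => ?_
        rw [← lintegral_const_mul]
        · refine lintegral_congr fun t => ?_
          simp only [Set.indicator_apply, mem_ofPred_eq]
          split_ifs <;> simp
        · exact Measurable.indicator (by fun_prop)
            (measurableSet_lt (by fun_prop) measurable_const)

/-- Interpolation between weak `L^1` and `L^∞`: the strong `L^p` bound, `1 < p < ∞`. -/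
theorem WeakMaximal.lintegral_rpow_le [IsFiniteMeasure μ] {C : ℝ≥0} {h M : X → ℝ≥0∞}
    (hw : WeakMaximal μ C h M) (hh : Measurable h) (hM : Measurable M)
    (hI : ∫⁻ x, h x ∂μ ≠ ∞) {p : ℝ} (hp : 1 < p) :
    ∫⁻ x, M x ^ p ∂μ ≤ 2 ^ p * (ENNReal.ofReal (p / (p - 1)) * (C * ∫⁻ x, h x ^ p ∂μ)) := by
  have hfin := hw.ae_lt_top hI
  have hfin' := MeasureTheory.ae_lt_top hh hI
  have e1 : ∫⁻ x, M x ^ p ∂μ = 2 ^ p * ∫⁻ x, ENNReal.ofReal ((M x / 2).toReal ^ p) ∂μ := by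
    rw [← lintegral_const_mul _ (by fun_prop)]
    refine lintegral_congr_ae ?_
    filter_upwards [hfin] with x hx
    rw [← ENNReal.ofReal_rpow_of_nonneg ENNReal.toReal_nonneg (by linarith), ENNReal.ofReal_toReal,
      ← ENNReal.mul_rpow_of_nonneg _ _ (by linarith), ENNReal.mul_div_cancel (by simp) (by simp)]
    exact (ENNReal.div_lt_top hx.ne (by simp)).ne
  rw [e1, lintegral_rpow_eq_lintegral_meas_lt_mul μ (ae_of_all _ fun x => ENNReal.toReal_nonneg)
    (by fun_prop) (by linarith)]
  have e2 : ∫⁻ t in Ioi (0 : ℝ), μ {a | t < (M a / 2).toReal} * ENNReal.ofReal (t ^ (p - 1)) ≤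
      ∫⁻ t in Ioi (0 : ℝ), μ {x | 2 * ENNReal.ofReal t < M x} * ENNReal.ofReal (t ^ (p - 1)) := by
    refine setLIntegral_mono' measurableSet_Ioi fun t (ht : 0 < t) => ?_
    refine mul_le_mul_left (measure_mono fun a (ha : t < _) => ?_) _
    have h1 : ENNReal.ofReal t < M a / 2 :=
      (ENNReal.ofReal_lt_ofReal_iff (ht.trans ha)).2 ha |>.trans_le ENNReal.ofReal_toReal_le
    rw [mem_ofPred_eq, mul_comm]
    exact (ENNReal.lt_div_iff_mul_lt (by simp) (by simp)).1 h1
  have e3 := hw.lintegral_meas_le hh (g := fun t => ENNReal.ofReal (t ^ (p - 1))) (by fun_prop)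
    measurableSet_Ioi subset_rfl
  have e4 : ∀ᵐ x ∂μ, h x * ∫⁻ t in Ioi (0 : ℝ), {t | ENNReal.ofReal t < h x}.indicator
        (fun t => ENNReal.ofReal (t ^ (p - 1)) * ENNReal.ofReal t⁻¹) t =
        ENNReal.ofReal (1 / (p - 1)) * h x ^ p := by
    filter_upwards [hfin'] with x hx
    obtain ⟨y, hy, -⟩ := ENNReal.lt_iff_exists_coe.1 hx
    have hy0 : (0 : ℝ) ≤ y := y.2
    have hyr : h x = ENNReal.ofReal y := by simp [hy]
    have i1 : ∫⁻ t in Ioi (0 : ℝ), {t | ENNReal.ofReal t < h x}.indicator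
        (fun t => ENNReal.ofReal (t ^ (p - 1)) * ENNReal.ofReal t⁻¹) t =
        ∫⁻ t in Ioo (0 : ℝ) y, ENNReal.ofReal (t ^ (p - 2)) := by
      rw [← lintegral_indicator measurableSet_Ioi, ← lintegral_indicator measurableSet_Ioo]
      refine lintegral_congr fun t => ?_
      simp only [Set.indicator_apply, mem_Ioi, mem_ofPred_eq, mem_Ioo, hyr]
      by_cases ht : 0 < t
      · have : (ENNReal.ofReal t < ENNReal.ofReal y) ↔ t < y := by
          rw [ENNReal.ofReal_lt_ofReal_iff_of_nonneg ht.le]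
        simp only [ht, this, true_and, if_true]
        split_ifs
        · rw [← ENNReal.ofReal_mul (by positivity), show p - 1 = (p - 2) + 1 by ring,
            Real.rpow_add_one ht.ne', mul_assoc, mul_inv_cancel₀ ht.ne', mul_one]
        · rfl
      · simp [ht]
    have i2 : ∫⁻ t in Ioo (0 : ℝ) y, ENNReal.ofReal (t ^ (p - 2)) =
        ENNReal.ofReal (y ^ (p - 1) / (p - 1)) := by
      have hint : IntervalIntegrable (fun t : ℝ => t ^ (p - 2)) volume 0 y :=
        intervalIntegral.intervalIntegrable_rpow' (by linarith)
      rw [restrict_Ioo_eq_restrict_Ioc, ← ofReal_integral_eq_lintegral_ofReal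
        ((intervalIntegrable_iff_integrableOn_Ioc_of_le hy0).1 hint),
        ← intervalIntegral.integral_of_le hy0, integral_rpow (Or.inl (by linarith))]
      · rw [show p - 2 + 1 = p - 1 by ring, Real.zero_rpow (by linarith), sub_zero]
      · filter_upwards [ae_restrict_mem measurableSet_Ioc] with t ht
        exact Real.rpow_nonneg ht.1.le _
    rw [i1, i2, hyr, ← ENNReal.ofReal_mul hy0, ENNReal.ofReal_rpow_of_nonneg hy0 (by linarith),
      ← ENNReal.ofReal_mul (by have := hp; exact one_div_nonneg.2 (by linarith))]
    congr 1
    rcases hy0.eq_or_lt with h0 | h0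
    · rw [← h0, Real.zero_rpow (by linarith : p ≠ 0)]; simp
    · rw [show p = (p - 1) + 1 by ring, Real.rpow_add_one h0.ne']; ring_nf
  calc _ ≤ 2 ^ p * (ENNReal.ofReal p * (C * ∫⁻ x, ENNReal.ofReal (1 / (p - 1)) * h x ^ p ∂μ)) := by
        gcongr
        refine (e2.trans e3).trans (le_of_eq ?_)
        rw [lintegral_congr_ae e4]
    _ = _ := by
        rw [lintegral_const_mul _ (by fun_prop), div_eq_mul_one_div p,
          ENNReal.ofReal_mul (by linarith)]
        ring

/-- Interpolation at the endpoint: the `L log L` bound. -/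
theorem WeakMaximal.lintegral_le_log [IsProbabilityMeasure μ] {C : ℝ≥0} {h M : X → ℝ≥0∞}
    (hw : WeakMaximal μ C h M) (hh : Measurable h) (hM : Measurable M)
    (hI : ∫⁻ x, h x ∂μ ≠ ∞) :
    ∫⁻ x, M x ∂μ ≤
      2 * (1 + C * ∫⁻ x, ENNReal.ofReal ((h x).toReal * Real.log (max (h x).toReal 1)) ∂μ) := by
  have hfin := hw.ae_lt_top hI
  have hfin' := MeasureTheory.ae_lt_top hh hI
  have e1 : ∫⁻ x, M x ∂μ = 2 * ∫⁻ x, ENNReal.ofReal ((M x / 2).toReal) ∂μ := by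
    rw [← lintegral_const_mul _ (by fun_prop)]
    refine lintegral_congr_ae ?_
    filter_upwards [hfin] with x hx
    rw [ENNReal.ofReal_toReal, ENNReal.mul_div_cancel (by simp) (by simp)]
    exact (ENNReal.div_lt_top hx.ne (by simp)).ne
  rw [e1, lintegral_eq_lintegral_meas_lt μ (ae_of_all _ fun x => ENNReal.toReal_nonneg)
    (by fun_prop)]
  have e2 (t : ℝ) (ht : 0 < t) : μ {a | t < (M a / 2).toReal} ≤
      μ {x | 2 * ENNReal.ofReal t < M x} := by
    refine measure_mono fun a ha => ?_
    have h1 : ENNReal.ofReal t < M a / 2 :=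
      (ENNReal.ofReal_lt_ofReal_iff (ht.trans ha)).2 ha |>.trans_le ENNReal.ofReal_toReal_le
    rw [mem_ofPred_eq, mul_comm]
    exact (ENNReal.lt_div_iff_mul_lt (by simp) (by simp)).1 h1
  have e3 := hw.lintegral_meas_le hh (g := fun _ => 1) (by fun_prop)
    (measurableSet_Ioi (a := (1 : ℝ))) (Ioi_subset_Ioi zero_le_one)
  have e4 : ∀ᵐ x ∂μ, h x * ∫⁻ t in Ioi (1 : ℝ), {t | ENNReal.ofReal t < h x}.indicator
        (fun t => 1 * ENNReal.ofReal t⁻¹) t =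
        ENNReal.ofReal ((h x).toReal * Real.log (max (h x).toReal 1)) := by
    filter_upwards [hfin'] with x hx
    obtain ⟨y, hy, -⟩ := ENNReal.lt_iff_exists_coe.1 hx
    have hy0 : (0 : ℝ) ≤ y := y.2
    have hyr : h x = ENNReal.ofReal y := by simp [hy]
    have i1 : ∫⁻ t in Ioi (1 : ℝ), {t | ENNReal.ofReal t < h x}.indicator
        (fun t => 1 * ENNReal.ofReal t⁻¹) t =
        ∫⁻ t in Ioo (1 : ℝ) (max y 1), ENNReal.ofReal t⁻¹ := by
      rw [← lintegral_indicator measurableSet_Ioi, ← lintegral_indicator measurableSet_Ioo]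
      refine lintegral_congr fun t => ?_
      simp only [Set.indicator_apply, mem_Ioi, mem_ofPred_eq, mem_Ioo, hyr, one_mul]
      by_cases ht : 1 < t
      · have : (ENNReal.ofReal t < ENNReal.ofReal y) ↔ t < max (y : ℝ) 1 := by
          rw [ENNReal.ofReal_lt_ofReal_iff_of_nonneg (by linarith), lt_max_iff]
          exact ⟨Or.inl, fun h => h.resolve_right (by linarith)⟩
        simp only [ht, this, true_and, if_true]
      · simp [ht]
    have i2 : ∫⁻ t in Ioo (1 : ℝ) (max y 1), ENNReal.ofReal t⁻¹ =
        ENNReal.ofReal (Real.log (max y 1)) := by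
      have h1 : (1 : ℝ) ≤ max (y : ℝ) 1 := le_max_right _ _
      have hn : (0 : ℝ) ∉ uIcc (1 : ℝ) (max y 1) := by
        rw [uIcc_of_le h1]; simp
      have hint : IntervalIntegrable (fun t : ℝ => t⁻¹) volume 1 (max y 1) :=
        intervalIntegrable_inv_iff.2 (Or.inr hn)
      rw [restrict_Ioo_eq_restrict_Ioc, ← ofReal_integral_eq_lintegral_ofReal
        ((intervalIntegrable_iff_integrableOn_Ioc_of_le h1).1 hint),
        ← intervalIntegral.integral_of_le h1, integral_inv hn, div_one]
      filter_upwards [ae_restrict_mem measurableSet_Ioc] with t ht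
      have : 0 < t := by linarith [ht.1]
      positivity
    rw [i1, i2, hyr, ENNReal.toReal_ofReal hy0, ENNReal.ofReal_mul hy0]
  gcongr
  -- levels below `1` contribute at most the total mass, which is `1`
  rw [← Ioc_union_Ioi_eq_Ioi (zero_le_one (α := ℝ)), lintegral_union measurableSet_Ioi
    (by rw [Set.disjoint_iff]; rintro x ⟨h1, h2⟩; exact absurd h1.2 (not_le.2 h2))]
  gcongr
  · calc _ ≤ ∫⁻ t in Ioc (0 : ℝ) 1, 1 := lintegral_mono fun t => prob_le_one
      _ = 1 := by simp
  · calc _ ≤ ∫⁻ t in Ioi (1 : ℝ), μ {x | 2 * ENNReal.ofReal t < M x} * 1 := by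
          refine setLIntegral_mono' measurableSet_Ioi fun t ht => ?_
          rw [mul_one]
          exact e2 t (zero_lt_one.trans ht)
      _ ≤ _ := e3
      _ = _ := by rw [lintegral_congr_ae e4]

/-! ### The maximal function of a measure-preserving flow -/

/-- A jointly measurable, measure-preserving action of the additive group `ℝ`. -/
structure IsFlow {X : Type*} [MeasurableSpace X] (T : ℝ → X → X) (μ : Measure X) : Prop where
  measurable : Measurable fun q : ℝ × X => T q.1 q.2
  add : ∀ s t x, T (s + t) x = T s (T t x)
  measurePreserving : ∀ t, MeasurePreserving (T t) μ μ

/-- The one-sided maximal function of a flow over windows of length `(n + 1) 2⁻ᵏ`. The dyadic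
lengths make the supremum countable, at the cost of a factor `2` in `lintegral_Ioc_le_flowMax`. -/
def flowMax {X : Type*} (T : ℝ → X → X) (h : X → ℝ≥0∞) (x : X) : ℝ≥0∞ :=
  ⨆ (k : ℕ) (n : ℕ), (∫⁻ s in Ioc (0 : ℝ) ((n + 1) * 2⁻¹ ^ k), h (T s x)) /
    ENNReal.ofReal ((n + 1) * 2⁻¹ ^ k)

theorem lintegral_Ioc_le_flowMax {X : Type*} (T : ℝ → X → X) (h : X → ℝ≥0∞) (x : X) {S : ℝ}
    (hS : 0 < S) : ∫⁻ s in Ioc 0 S, h (T s x) ≤ ENNReal.ofReal (2 * S) * flowMax T h x := by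
  obtain ⟨k, hk⟩ := exists_pow_lt_of_lt_one hS (by norm_num : (2⁻¹ : ℝ) < 1)
  set d : ℝ := 2⁻¹ ^ k with hd
  have hd0 : 0 < d := by positivity
  obtain ⟨n, hn⟩ := Nat.exists_eq_succ_of_ne_zero (Nat.ceil_pos.2 (div_pos hS hd0)).ne'
  have h1 : S ≤ (n + 1) * d := by
    have := Nat.le_ceil (S / d)
    rw [hn, div_le_iff₀ hd0] at this
    exact_mod_cast this
  have h2 : (n + 1) * d ≤ 2 * S := by
    have := Nat.ceil_lt_add_one (div_pos hS hd0).le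
    rw [hn] at this
    push_cast at this
    have h3 : (n : ℝ) * d < S := by
      rw [← lt_div_iff₀ hd0]; linarith
    linarith
  have hpos : 0 < (n + 1) * d := by positivity
  calc ∫⁻ s in Ioc 0 S, h (T s x) ≤ ∫⁻ s in Ioc (0 : ℝ) ((n + 1) * d), h (T s x) :=
        lintegral_mono_set (Ioc_subset_Ioc_right h1)
    _ = ENNReal.ofReal ((n + 1) * d) * ((∫⁻ s in Ioc (0 : ℝ) ((n + 1) * d), h (T s x)) /
        ENNReal.ofReal ((n + 1) * d)) := by
        rw [ENNReal.mul_div_cancel (by simpa using hpos) (by simp)]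
    _ ≤ _ := mul_le_mul' (ENNReal.ofReal_le_ofReal h2)
        (le_iSup₂ (f := fun (k n : ℕ) => (∫⁻ s in Ioc (0 : ℝ) ((n + 1) * 2⁻¹ ^ k), h (T s x)) /
          ENNReal.ofReal ((n + 1) * 2⁻¹ ^ k)) k n)

theorem flowMax_le_add {X : Type*} {T : ℝ → X → X} {h h' : X → ℝ≥0∞} {c : ℝ≥0∞}
    (hh : ∀ x, h x ≤ h' x + c) (x : X) :
    flowMax T h x ≤ flowMax T h' x + c := by
  refine iSup₂_le fun k n => ?_
  set d : ℝ := (n + 1) * 2⁻¹ ^ k with hd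
  have hd0 : 0 < d := by positivity
  calc (∫⁻ s in Ioc 0 d, h (T s x)) / ENNReal.ofReal d
      ≤ (∫⁻ s in Ioc 0 d, h' (T s x) + c) / ENNReal.ofReal d := by
        gcongr; exact hh _
    _ = (∫⁻ s in Ioc 0 d, h' (T s x)) / ENNReal.ofReal d + c := by
        rw [lintegral_add_right _ measurable_const, ENNReal.add_div, setLIntegral_const,
          Real.volume_Ioc, sub_zero, ENNReal.mul_div_cancel_right (by simpa using hd0) (by simp)]
    _ ≤ _ := by
        gcongr
        exact le_iSup₂ (f := fun (k n : ℕ) =>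
          (∫⁻ s in Ioc (0 : ℝ) ((n + 1) * 2⁻¹ ^ k), h' (T s x)) /
            ENNReal.ofReal ((n + 1) * 2⁻¹ ^ k)) k n

section Flow

variable {X : Type*} [MeasurableSpace X] {μ : Measure X} {T : ℝ → X → X}

namespace IsFlow

theorem measurable_comp (hT : IsFlow T μ) {E : Type*} [MeasurableSpace E] {h : X → E}
    (hh : Measurable h) : Measurable fun q : X × ℝ => h (T q.2 q.1) :=
  hh.comp (hT.measurable.comp measurable_swap)

theorem measurable_lintegral (hT : IsFlow T μ) {h : X → ℝ≥0∞} (hh : Measurable h) (S : Set ℝ) :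
    Measurable fun x => ∫⁻ s in S, h (T s x) :=
  (hT.measurable_comp hh).lintegral_prod_right'

theorem measurable_flowMax (hT : IsFlow T μ) {h : X → ℝ≥0∞} (hh : Measurable h) :
    Measurable (flowMax T h) :=
  .iSup fun _ => .iSup fun _ => (hT.measurable_lintegral hh _).div_const _

theorem iterate_eq (hT : IsFlow T μ) (d : ℝ) (i : ℕ) (s : ℝ) (x : X) :
    T s ((T d)^[i] x) = T (s + i * d) x := by
  induction i generalizing s with
  | zero => simp
  | succ i ih =>
    rw [Function.iterate_succ_apply', ← hT.add, ih]
    congr 1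
    push_cast; ring

theorem sum_iterate (hT : IsFlow T μ) {h : X → ℝ≥0∞} {d : ℝ} (hd : 0 ≤ d)
    (n : ℕ) (x : X) :
    ∑ i ∈ Finset.range n, ∫⁻ s in Ioc 0 d, h (T s ((T d)^[i] x)) =
      ∫⁻ s in Ioc 0 (n * d), h (T s x) := by
  induction n with
  | zero => simp
  | succ n ih =>
    have hnd : 0 ≤ n * d := by positivity
    have e1 : ∫⁻ s in Ioc 0 d, h (T s ((T d)^[n] x)) =
        ∫⁻ s in Ioc (n * d) ((n + 1 : ℕ) * d), h (T s x) := by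
      simp_rw [hT.iterate_eq d n]
      rw [← lintegral_indicator measurableSet_Ioc, ← lintegral_indicator measurableSet_Ioc]
      conv_rhs => rw [← lintegral_add_right_eq_self _ (n * d)]
      refine lintegral_congr fun s => ?_
      simp only [Set.indicator_apply, mem_Ioc]
      refine if_congr ?_ rfl rfl
      push_cast
      constructor
      · rintro ⟨h1, h2⟩; constructor <;> linarith
      · rintro ⟨h1, h2⟩; constructor <;> linarith
    rw [Finset.sum_range_succ, ih, e1, ← lintegral_union measurableSet_Ioc,
      Ioc_union_Ioc_eq_Ioc hnd (by push_cast; linarith)]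
    rw [Set.disjoint_iff]
    rintro s ⟨h1, h2⟩
    exact absurd h1.2 (not_le.2 h2.1)

/-- The flow maximal function is of weak type `(1, 1)`. For windows that are multiples of `2⁻ᵏ`
this is the discrete maximal ergodic theorem for the time `2⁻ᵏ` map, with a constant independent
of `k`. -/
theorem weak_type (hT : IsFlow T μ) [IsFiniteMeasure μ] {h : X → ℝ≥0∞} (hh : Measurable h)
    (c : ℝ≥0) : c * μ {x | (c : ℝ≥0∞) < flowMax T h x} ≤ ∫⁻ x, h x ∂μ := by
  set E : ℕ → Set X := fun k => {x | ∃ n : ℕ, (c : ℝ≥0∞) <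
    (∫⁻ s in Ioc (0 : ℝ) ((n + 1) * 2⁻¹ ^ k), h (T s x)) / ENNReal.ofReal ((n + 1) * 2⁻¹ ^ k)}
    with hE
  have hU : {x | (c : ℝ≥0∞) < flowMax T h x} = ⋃ k, E k := by
    ext x
    simp [hE, flowMax, lt_iSup_iff]
  have hmono : Monotone E := by
    refine monotone_nat_of_le_succ fun k x ⟨n, hn⟩ => ⟨2 * n + 1, ?_⟩
    have : ((2 * n + 1 : ℕ) + 1 : ℝ) * 2⁻¹ ^ (k + 1) = (n + 1) * 2⁻¹ ^ k := by
      push_cast; ring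
    rw [this]
    exact hn
  rw [hU, hmono.measure_iUnion, ENNReal.mul_iSup]
  refine iSup_le fun k => ?_
  set d : ℝ := 2⁻¹ ^ k with hd
  have hd0 : 0 < d := by positivity
  have hdE : ENNReal.ofReal d ≠ 0 := by simpa using hd0
  set F : X → ℝ≥0∞ := fun x => (ENNReal.ofReal d)⁻¹ * ∫⁻ s in Ioc 0 d, h (T s x) with hF
  have hFm : Measurable F := (hT.measurable_lintegral hh _).const_mul _
  have hFint : ∫⁻ x, F x ∂μ = ∫⁻ x, h x ∂μ := by
    rw [lintegral_const_mul _ (hT.measurable_lintegral hh _), lintegral_lintegral_swap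
      (hT.measurable_comp hh).aemeasurable]
    simp_rw [fun s => (hT.measurePreserving s).lintegral_comp hh]
    rw [setLIntegral_const, Real.volume_Ioc, sub_zero, mul_comm (∫⁻ x, h x ∂μ), ← mul_assoc,
      ENNReal.inv_mul_cancel hdE (by simp), one_mul]
  rw [← hFint]
  refine le_trans (mul_le_mul_right (measure_mono ?_) _)
    (maximal_ergodic (hT.measurePreserving d) hFm c)
  rintro x ⟨n, hn⟩
  refine ⟨n + 1, by omega, ?_⟩
  have e := hT.sum_iterate (h := h) hd0.le (n + 1) x
  simp only [hF]
  rw [← Finset.mul_sum, e]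
  have h1 : ENNReal.ofReal ((n + 1) * d) = (n + 1 : ℕ) * ENNReal.ofReal d := by
    rw [ENNReal.ofReal_mul (by positivity)]
    congr 1
    exact_mod_cast ENNReal.ofReal_natCast (n + 1)
  rw [h1, ENNReal.lt_div_iff_mul_lt (Or.inl (by simp [hd0])) (Or.inl (ENNReal.mul_ne_top (by simp)
    (by simp))), ← mul_assoc] at hn
  rw [mul_comm _ (∫⁻ s in _, _), ← div_eq_mul_inv,
    ENNReal.lt_div_iff_mul_lt (Or.inl hdE) (Or.inl (by simp))]
  exact_mod_cast hn

theorem ae_flowMax_lt_top (hT : IsFlow T μ) [IsFiniteMeasure μ] {h : X → ℝ≥0∞}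
    (hh : Measurable h) (hI : ∫⁻ x, h x ∂μ ≠ ∞) : ∀ᵐ x ∂μ, flowMax T h x < ∞ := by
  have hlim : Tendsto (fun n : ℕ => (∫⁻ x, h x ∂μ) / (n : ℝ≥0∞)) atTop (𝓝 0) := by
    exact ENNReal.Tendsto.const_div ENNReal.tendsto_nat_nhds_top (Or.inr hI) |>.trans (by simp)
  rw [ae_iff]
  refine le_antisymm (ge_of_tendsto hlim ?_) zero_le
  filter_upwards [eventually_gt_atTop 0] with n hn
  have hn' : (n : ℝ≥0∞) ≠ 0 := by simpa using hn.ne'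
  rw [ENNReal.le_div_iff_mul_le (Or.inl hn') (Or.inl (by simp)), mul_comm]
  refine le_trans (mul_le_mul_right (measure_mono fun x hx => ?_) _) (hT.weak_type hh (n : ℝ≥0))
  simp only [mem_ofPred_eq, not_lt, top_le_iff] at hx
  simp [hx]

end IsFlow

/-! ### Linearly weighted averages along a flow -/

/-- The probability measure on `[a, b]` with density proportional to `s`. -/
def linearWeight (a b : ℝ) : Measure ℝ :=
  (volume.restrict (Ioc a b)).withDensity fun s => ENNReal.ofReal (2 * s / (b ^ 2 - a ^ 2))

theorem linearWeight_le {a b C : ℝ} (ha : 0 ≤ a) (hab : a < b) (hC : b ≤ C * (b - a))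
    (φ : ℝ → ℝ≥0∞) (hφ : Measurable φ) :
    ∫⁻ s, φ s ∂(linearWeight a b) ≤ ENNReal.ofReal (2 * C / b) * ∫⁻ s in Ioc 0 b, φ s := by
  have hb : 0 < b := ha.trans_lt hab
  have hba : 0 < b - a := by linarith
  rw [linearWeight, lintegral_withDensity_eq_lintegral_mul _ (by fun_prop) hφ,
    ← lintegral_const_mul _ hφ]
  calc _ ≤ ∫⁻ s in Ioc a b, ENNReal.ofReal (2 * C / b) * φ s := by
        refine setLIntegral_mono' measurableSet_Ioc fun s hs => ?_
        refine mul_le_mul_left (ENNReal.ofReal_le_ofReal ?_) _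
        have h1 : 0 < b ^ 2 - a ^ 2 := by nlinarith
        rw [div_le_div_iff₀ h1 hb]
        have h2 : s * b ≤ b * b := by nlinarith [hs.2]
        have h3 : b * b ≤ C * (b - a) * b := by nlinarith
        have hC0 : 0 ≤ C * (b - a) := hb.le.trans hC
        nlinarith [mul_nonneg hC0 ha]
    _ ≤ _ := lintegral_mono_set (Ioc_subset_Ioc_left ha)

theorem linearWeight_univ {a b : ℝ} (ha : 0 ≤ a) (hab : a < b) : linearWeight a b univ = 1 := by
  have h1 : 0 < b ^ 2 - a ^ 2 := by nlinarith
  rw [linearWeight, withDensity_apply _ MeasurableSet.univ, Measure.restrict_univ,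
    ← ofReal_integral_eq_lintegral_ofReal, ← intervalIntegral.integral_of_le hab.le]
  · have : ∀ s : ℝ, 2 * s / (b ^ 2 - a ^ 2) = (2 / (b ^ 2 - a ^ 2)) * s := fun s => by ring
    simp_rw [this]
    rw [intervalIntegral.integral_const_mul, integral_id, ← ENNReal.ofReal_one]
    congr 1
    field_simp
  · exact (Continuous.integrableOn_Icc (by fun_prop)).mono_set Ioc_subset_Icc_self
  · filter_upwards [ae_restrict_mem measurableSet_Ioc] with s hs
    have : 0 ≤ s := ha.trans hs.1.le
    exact div_nonneg (by linarith) h1.le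

theorem isProbabilityMeasure_linearWeight {a b : ℝ} (ha : 0 ≤ a) (hab : a < b) :
    IsProbabilityMeasure (linearWeight a b) := ⟨linearWeight_univ ha hab⟩

theorem integral_linearWeight {E : Type*} [NormedAddCommGroup E] [NormedSpace ℝ E] {a b : ℝ}
    (ha : 0 ≤ a) (hab : a < b) (ψ : ℝ → E) :
    ∫ s, ψ s ∂(linearWeight a b) = (2 / (b ^ 2 - a ^ 2)) • ∫ s in a..b, s • ψ s := by
  have h1 : 0 < b ^ 2 - a ^ 2 := by nlinarith
  rw [linearWeight, integral_withDensity_eq_integral_toReal_smul (by fun_prop) (by simp),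
    ← intervalIntegral.integral_smul, intervalIntegral.integral_of_le hab.le]
  refine setIntegral_congr_fun measurableSet_Ioc fun s hs => ?_
  have : 0 ≤ s := ha.trans hs.1.le
  rw [ENNReal.toReal_ofReal (div_nonneg (by linarith) h1.le), smul_smul]
  congr 1
  ring

/-- Linearly weighted averages are asymptotically invariant under translation. -/
theorem norm_linearWeight_sub_le {a b C t B : ℝ} (ha : 0 ≤ a) (hab : a < b) (hC : b ≤ C * (b - a))
    {ψ : ℝ → ℂ} (hψ : Measurable ψ) (hB : ∀ s, ‖ψ s‖ ≤ B) :
    ‖∫ s, (ψ s - ψ (s + t)) ∂(linearWeight a b)‖ ≤ 4 * C * B * |t| * (b + |t|) / b ^ 2 := by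
  have hb : 0 < b := ha.trans_lt hab
  have h1 : 0 < b ^ 2 - a ^ 2 := by nlinarith
  have hB0 : 0 ≤ B := (norm_nonneg _).trans (hB 0)
  have hint (u v : ℝ) : IntervalIntegrable ψ volume u v := by
    refine (intervalIntegrable_const (c := B)).mono_fun hψ.aestronglyMeasurable ?_
    exact ae_of_all _ fun s => (hB s).trans (le_abs_self B)
  have hint' (u v : ℝ) : IntervalIntegrable (fun s : ℝ => s • ψ s) volume u v :=
    ((hint u v).continuousOn_mul (g := fun s : ℝ => (s : ℂ)) (by fun_prop)).congr
      fun s _ => by simp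
  -- summation by parts: two boundary terms, and `t` times an unweighted integral
  have e1 : ∫ s in a..b, s • (ψ s - ψ (s + t)) = (∫ s in a..(a + t), s • ψ s)
      - (∫ s in b..(b + t), s • ψ s) + t • ∫ s in (a + t)..(b + t), ψ s := by
    have e2 : ∫ s in a..b, s • ψ (s + t) = ∫ s in (a + t)..(b + t), (s • ψ s - t • ψ s) := by
      rw [← intervalIntegral.integral_comp_add_right]
      refine intervalIntegral.integral_congr fun s _ => ?_
      simp only [add_smul, add_sub_cancel_right]
    have e3 : ∫ s in a..b, s • (ψ s - ψ (s + t)) =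
        (∫ s in a..b, s • ψ s) - ∫ s in a..b, s • ψ (s + t) := by
      rw [← intervalIntegral.integral_sub (hint' _ _)]
      · simp_rw [smul_sub]
      · have := ((hint' (a + t) (b + t)).sub ((hint (a + t) (b + t)).smul t)).comp_add_right t
        simp only [add_sub_cancel_right] at this
        refine this.congr fun s _ => ?_
        simp [add_smul]
    rw [e3, e2,
      intervalIntegral.integral_sub (g := fun s => t • ψ s) (hint' _ _) ((hint _ _).smul t),
      intervalIntegral.integral_smul,
      ← intervalIntegral.integral_add_adjacent_intervals (hint' a (a + t)) (hint' (a + t) b),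
      ← intervalIntegral.integral_add_adjacent_intervals (hint' (a + t) b) (hint' b (b + t))]
    abel
  have b1 (u : ℝ) (hu : 0 ≤ u) : ‖∫ s in u..(u + t), s • ψ s‖ ≤ (u + |t|) * B * |t| := by
    have := intervalIntegral.norm_integral_le_of_norm_le_const (f := fun s : ℝ => s • ψ s)
      (a := u) (b := u + t) (C := (u + |t|) * B) ?_
    · simpa using this
    · intro s hs
      rw [norm_smul]
      have hs' : |s| ≤ u + |t| := by
        have h2 := uIoc_subset_uIcc hs
        have h3 := Set.abs_sub_left_of_mem_uIcc h2
        rw [add_sub_cancel_left] at h3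
        calc |s| = |u + (s - u)| := by ring_nf
          _ ≤ |u| + |s - u| := abs_add_le _ _
          _ ≤ u + |t| := by rw [abs_of_nonneg hu]; linarith
      exact mul_le_mul hs' (hB s) (norm_nonneg _) (by positivity)
  have b2 : ‖t • ∫ s in (a + t)..(b + t), ψ s‖ ≤ |t| * (B * (b - a)) := by
    rw [norm_smul, Real.norm_eq_abs]
    gcongr
    have := intervalIntegral.norm_integral_le_of_norm_le_const (f := ψ)
      (a := a + t) (b := b + t) (C := B) (fun s _ => hB s)
    rwa [add_sub_add_right_eq_sub, abs_of_pos (by linarith)] at this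
  rw [integral_linearWeight ha hab, e1, norm_smul,
    Real.norm_of_nonneg (div_nonneg two_pos.le h1.le)]
  have b3 : ‖(∫ s in a..(a + t), s • ψ s) - (∫ s in b..(b + t), s • ψ s)
      + t • ∫ s in (a + t)..(b + t), ψ s‖ ≤ 2 * B * |t| * (b + |t|) := by
    refine (norm_add_le _ _).trans ((add_le_add (norm_sub_le _ _) le_rfl).trans ?_)
    refine (add_le_add (add_le_add (b1 a ha) (b1 b hb.le)) b2).trans (le_of_eq ?_)
    ring
  have hC' : 2 / (b ^ 2 - a ^ 2) ≤ 2 * C / b ^ 2 := by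
    rw [div_le_div_iff₀ h1 (by positivity)]
    have hC0 : 0 ≤ C * (b - a) := hb.le.trans hC
    nlinarith [mul_nonneg hC0 ha]
  calc _ ≤ (2 * C / b ^ 2) * (2 * B * |t| * (b + |t|)) :=
        mul_le_mul hC' b3 (norm_nonneg _) ((div_nonneg two_pos.le h1.le).trans hC')
    _ = _ := by ring

end Flow

/-! ### Almost everywhere convergence along a flow from a dense class -/

section DenseClass

variable {X : Type*} {m : MeasurableSpace X} [MeasurableSpace X] {μ : Measure X} {T : ℝ → X → X}

/-- The parameters of a family of weights `linearWeight (a r) (b r)` that are supported in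
`[0, ∞)`, spread out to infinity, and occupy a fixed proportion of `[0, b r]`. -/
structure IsSpreading (a b : ℝ → ℝ) (C : ℝ) : Prop where
  nonneg : ∀ r, 0 < r → 0 ≤ a r
  lt : ∀ r, 0 < r → a r < b r
  le : ∀ r, 0 < r → b r ≤ C * (b r - a r)
  tendsto : Tendsto b atTop atTop

theorem lintegral_linearWeight_le_flowMax {X : Type*} (T : ℝ → X → X) {a b C : ℝ} (ha : 0 ≤ a)
    (hab : a < b) (hC : b ≤ C * (b - a)) (h : X → ℝ≥0∞) (x : X)
    (hm : Measurable fun s => h (T s x)) :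
    ∫⁻ s, h (T s x) ∂(linearWeight a b) ≤ ENNReal.ofReal (4 * C) * flowMax T h x := by
  have hb : 0 < b := ha.trans_lt hab
  have hC0 : 0 ≤ C := by
    by_contra hc
    push Not at hc
    nlinarith [mul_pos (neg_pos.2 hc) (sub_pos.2 hab)]
  calc _ ≤ ENNReal.ofReal (2 * C / b) * ∫⁻ s in Ioc 0 b, h (T s x) :=
        linearWeight_le ha hab hC _ hm
    _ ≤ ENNReal.ofReal (2 * C / b) * (ENNReal.ofReal (2 * b) * flowMax T h x) := by
        gcongr; exact lintegral_Ioc_le_flowMax T h x hb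
    _ = _ := by
        rw [← mul_assoc, ← ENNReal.ofReal_mul (by positivity)]
        congr 2
        field_simp
        ring

theorem IsFlow.ae_integrable_linearWeight [IsFiniteMeasure μ] (hT : IsFlow T μ) {a b : ℝ → ℝ}
    {C : ℝ} (hab : IsSpreading a b C) {h : X → ℂ} (hh : Measurable h) (hI : Integrable h μ) :
    ∀ᵐ x ∂μ, ∀ r, 0 < r → Integrable (fun s => h (T s x)) (linearWeight (a r) (b r)) := by
  filter_upwards [hT.ae_flowMax_lt_top hh.enorm hI.2.ne] with x hx r hr
  have hm : Measurable fun s => h (T s x) := (hT.measurable_comp hh).comp measurable_prodMk_left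
  refine ⟨hm.aestronglyMeasurable, lt_of_le_of_lt (lintegral_linearWeight_le_flowMax T
    (hab.nonneg r hr) (hab.lt r hr) (hab.le r hr) (fun y => ‖h y‖ₑ) x hm.enorm) ?_⟩
  exact ENNReal.mul_lt_top ENNReal.ofReal_lt_top hx

/-- Functions whose linearly weighted averages along the flow are defined and converge almost
everywhere to the conditional expectation on `m`. -/
structure FlowConverges {X : Type*} (m : MeasurableSpace X) [MeasurableSpace X]
    (T : ℝ → X → X) (μ : Measure X) (a b : ℝ → ℝ) (h : X → ℂ) : Prop where
  measurable : Measurable h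
  integrable : Integrable h μ
  tendsto : ∀ᵐ x ∂μ, Tendsto (fun r => ∫ s, h (T s x) ∂(linearWeight (a r) (b r))) atTop
    (𝓝 ((μ[h | m]) x))

theorem FlowConverges.add [IsFiniteMeasure μ] (hT : IsFlow T μ)
    {a b : ℝ → ℝ} {C : ℝ} (hab : IsSpreading a b C) {h h' : X → ℂ}
    (H : FlowConverges m T μ a b h) (H' : FlowConverges m T μ a b h') :
    FlowConverges m T μ a b (h + h') where
  measurable := H.measurable.add H'.measurable
  integrable := H.integrable.add H'.integrable
  tendsto := by
    filter_upwards [H.tendsto, H'.tendsto, condExp_add H.integrable H'.integrable m,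
      hT.ae_integrable_linearWeight hab H.measurable H.integrable,
      hT.ae_integrable_linearWeight hab H'.measurable H'.integrable] with x h1 h2 h3 h4 h5
    rw [h3]
    refine (h1.add h2).congr' ?_
    filter_upwards [eventually_gt_atTop 0] with r hr
    exact (integral_add (h4 r hr) (h5 r hr)).symm

theorem FlowConverges.smul {a b : ℝ → ℝ} {h : X → ℂ} (c : ℂ)
    (H : FlowConverges m T μ a b h) : FlowConverges m T μ a b (c • h) where
  measurable := H.measurable.const_smul c
  integrable := H.integrable.smul c
  tendsto := by
    filter_upwards [H.tendsto, condExp_smul c h m] with x h1 h2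
    rw [h2]
    refine (h1.const_smul c).congr fun r => ?_
    exact (integral_smul c _).symm

/-- The weak type inequality makes the class of functions with almost everywhere convergence
closed in `L^1`. -/
theorem FlowConverges.of_dense [IsProbabilityMeasure μ] (hT : IsFlow T μ)
    {a b : ℝ → ℝ} {C : ℝ} (hab : IsSpreading a b C) {h : X → ℂ}
    (hh : Measurable h) (hI : Integrable h μ)
    (hd : ∀ ε : ℝ≥0∞, ε ≠ 0 → ∃ g, FlowConverges m T μ a b g ∧ ∫⁻ x, ‖h x - g x‖ₑ ∂μ ≤ ε) :
    FlowConverges m T μ a b h where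
  measurable := hh
  integrable := hI
  tendsto := by
    set D : ℝ≥0 := (4 * C).toNNReal with hD
    set W : ℝ → (X → ℂ) → X → ℂ := fun r φ x => ∫ s, φ (T s x) ∂(linearWeight (a r) (b r))
    have key (j : ℕ) : ∀ᵐ x ∂μ, ∀ᶠ r in atTop,
        ‖W r h x - (μ[h | m]) x‖ₑ ≤ (D + 2 : ℝ≥0) * ((j + 1 : ℝ≥0) : ℝ≥0∞)⁻¹ := by
      set η : ℝ≥0 := (j + 1 : ℝ≥0)⁻¹ with hη
      have hη0 : 0 < η := by positivity
      have hηE : ((j + 1 : ℝ≥0) : ℝ≥0∞)⁻¹ = η := by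
        rw [hη, ENNReal.coe_inv (by positivity)]
      rw [hηE]
      rw [ae_iff]
      refine le_antisymm (ENNReal.le_of_forall_pos_le_add fun ε hε _ => ?_) zero_le
      have hηε : (η : ℝ≥0∞) * ε / 2 ≠ 0 := by
        have : (η : ℝ≥0∞) ≠ 0 := by exact_mod_cast hη0.ne'
        have : (ε : ℝ≥0∞) ≠ 0 := by exact_mod_cast hε.ne'
        simp [*]
      obtain ⟨g, hg, hδ⟩ := hd (η * ε / 2) hηε
      have hdm : Measurable fun x => ‖h x - g x‖ₑ := (hh.sub hg.measurable).enorm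
      set B1 : Set X := {x | (η : ℝ≥0∞) < flowMax T (fun x => ‖h x - g x‖ₑ) x}
      set B2 : Set X := {x | (η : ℝ≥0∞) ≤ ‖(μ[h - g | m]) x‖ₑ}
      have hfinal {t : ℝ≥0∞} (ht : (η : ℝ≥0∞) * t ≤ η * ε / 2) : t ≤ ε / 2 := by
        rw [mul_div_assoc] at ht
        exact (ENNReal.mul_le_mul_iff_right (by exact_mod_cast hη0.ne') (by simp)).1 ht
      have hB1 : μ B1 ≤ ε / 2 := hfinal ((hT.weak_type hdm η).trans hδ)
      have hB2 : μ B2 ≤ ε / 2 := by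
        refine hfinal ((mul_meas_ge_le_lintegral₀
          (f := fun x => ‖(μ[h - g | m]) x‖ₑ) (by
            exact (integrable_condExp.aestronglyMeasurable).enorm) η).trans ?_)
        have := eLpNorm_condExp_le_eLpNorm (m := m) (μ := μ) (h - g) le_rfl
        rw [eLpNorm_one_eq_lintegral_enorm, eLpNorm_one_eq_lintegral_enorm] at this
        exact this.trans hδ
      have hsub : ∀ᵐ x ∂μ, x ∉ B1 → x ∉ B2 → ∀ᶠ r in atTop,
          ‖W r h x - (μ[h | m]) x‖ₑ ≤ (D + 2 : ℝ≥0) * (η : ℝ≥0∞) := by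
        filter_upwards [hg.tendsto, hT.ae_integrable_linearWeight hab hh hI,
          hT.ae_integrable_linearWeight hab hg.measurable hg.integrable,
          condExp_sub hI hg.integrable m] with x h1 h2 h3 h4 h5 h6
        have h7 : Tendsto (fun r => ‖W r g x - (μ[g | m]) x‖ₑ) atTop (𝓝 0) := by
          have := (h1.sub_const ((μ[g | m]) x)).enorm
          simpa using this
        filter_upwards [h7.eventually_le_const (u := (η : ℝ≥0∞)) (by exact_mod_cast hη0),
          eventually_gt_atTop 0] with r h8 hr
        have hm : Measurable fun s => ‖h (T s x) - g (T s x)‖ₑ :=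
          (hT.measurable_comp hdm).comp measurable_prodMk_left
        have e1 : W r h x - (μ[h | m]) x = (∫ s, (h (T s x) - g (T s x))
            ∂(linearWeight (a r) (b r))) + (W r g x - (μ[g | m]) x) - (μ[h - g | m]) x := by
          rw [integral_sub (h2 r hr) (h3 r hr), h4, Pi.sub_apply]
          ring
        have e2 : ‖∫ s, (h (T s x) - g (T s x)) ∂(linearWeight (a r) (b r))‖ₑ ≤ D * η := by
          refine (enorm_integral_le_lintegral_enorm _).trans ?_
          refine (lintegral_linearWeight_le_flowMax T (hab.nonneg r hr) (hab.lt r hr)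
            (hab.le r hr) (fun x => ‖h x - g x‖ₑ) x hm).trans ?_
          exact mul_le_mul_right (not_lt.1 h5) _
        rw [e1]
        have h6' : ‖(μ[h - g | m]) x‖ₑ ≤ η := (not_le.1 h6).le
        calc _ ≤ (‖∫ s, (h (T s x) - g (T s x)) ∂(linearWeight (a r) (b r))‖ₑ +
              ‖W r g x - (μ[g | m]) x‖ₑ) + ‖(μ[h - g | m]) x‖ₑ :=
              enorm_sub_le.trans (add_le_add (enorm_add_le _ _) le_rfl)
          _ ≤ (D * η + η) + η := add_le_add (add_le_add e2 h8) h6'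
          _ = _ := by push_cast; ring
      calc μ {x | ¬ ∀ᶠ r in atTop, ‖W r h x - (μ[h | m]) x‖ₑ ≤ (D + 2 : ℝ≥0) * (η : ℝ≥0∞)}
          ≤ μ (B1 ∪ B2) := by
            refine measure_mono_ae ?_
            filter_upwards [hsub] with x hx (hx' : ¬ _)
            by_contra hc
            exact hx' (hx (fun h => hc (Or.inl h)) fun h => hc (Or.inr h))
        _ ≤ ε / 2 + ε / 2 := (measure_union_le _ _).trans (add_le_add hB1 hB2)
        _ = 0 + ε := by rw [ENNReal.add_halves, zero_add]
    filter_upwards [ae_all_iff.2 key] with x hx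
    rw [tendsto_iff_edist_tendsto_0]
    simp_rw [edist_eq_enorm_sub]
    have hlim : Tendsto (fun j : ℕ => ((D + 2 : ℝ≥0) : ℝ≥0∞) * ((j + 1 : ℝ≥0) : ℝ≥0∞)⁻¹) atTop
        (𝓝 0) := by
      have h1 : Tendsto (fun j : ℕ => ((j + 1 : ℕ) : ℝ≥0∞)⁻¹) atTop (𝓝 0) :=
        ENNReal.tendsto_inv_nat_nhds_zero.comp (tendsto_add_atTop_nat 1)
      have h2 := ENNReal.Tendsto.const_mul (a := ((D + 2 : ℝ≥0) : ℝ≥0∞)) h1 (Or.inr (by simp))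
      rw [mul_zero] at h2
      refine h2.congr fun j => ?_
      push_cast; rfl
    refine ENNReal.tendsto_nhds_zero.2 fun ε hε => ?_
    obtain ⟨j, hj⟩ := (hlim.eventually_le_const hε).exists
    filter_upwards [hx j] with r hr using hr.trans hj

end DenseClass

/-! ### Invariant functions -/

section Invariant

variable {G : Type*} [Group G] {X : Type*} [MeasurableSpace X] [MulAction G X]

theorem measurableSet_invariantSigmaAlgebra {s : Set X} :
    MeasurableSet[invariantSigmaAlgebra G X] s ↔
      MeasurableSet s ∧ ∀ g : G, (fun x => g • x) ⁻¹' s = s := by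
  rw [invariantSigmaAlgebra, MeasurableSpace.measurableSet_iInf]
  simp only [MeasurableSpace.measurableSet_invariants, forall_and, forall_const]

theorem invariantSigmaAlgebra_le : invariantSigmaAlgebra G X ≤ ‹MeasurableSpace X› :=
  (iInf_le _ 1).trans (MeasurableSpace.invariants_le _)

theorem apply_smul_of_measurable_invariant {F : X → ℂ}
    (hF : Measurable[invariantSigmaAlgebra G X] F) (g : G) (x : X) : F (g • x) = F x :=
  congr_fun (MeasurableSpace.comp_eq_of_measurable_invariants
    (hF.mono (iInf_le (fun g : G => MeasurableSpace.invariants (fun x : X => g • x)) g) le_rfl)) x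

variable [MeasurableSpace G] [TopologicalSpace G] [IsTopologicalGroup G] [LocallyCompactSpace G]
  [SecondCountableTopology G] [BorelSpace G] [MeasurableSMul₂ G X] {μ : Measure X}
  [IsProbabilityMeasure μ]

/-- A function that is invariant under each group element up to a null set agrees almost everywhere
with a strictly invariant function: the mean of its values along the orbit, where these are
almost everywhere constant. -/
theorem exists_invariant_ae_eq {f : X → ℂ} (hf : Measurable f)
    (hinv : ∀ g : G, ∀ᵐ x ∂μ, f (g • x) = f x) :
    ∃ F : X → ℂ, Measurable[invariantSigmaAlgebra G X] F ∧ F =ᵐ[μ] f := by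
  set η : Measure G := (Measure.haar : Measure G).toFinite with hη
  have hη1 : η ≪ Measure.haar := toFinite_absolutelyContinuous _
  have hη2 : Measure.haar ≪ η := absolutelyContinuous_toFinite _
  have hfm : Measurable fun q : X × G => f (q.2 • q.1) :=
    hf.comp (measurable_snd.smul measurable_fst)
  set f' : X → ℂ := fun x => ∫ g, f (g • x) ∂η with hf'
  have hf'm : Measurable f' := (hfm.stronglyMeasurable.integral_prod_right').measurable
  set X₀ : Set X := {x | η (Prod.mk x ⁻¹' {q : X × G | f (q.2 • q.1) ≠ f' q.1}) = 0} with hX₀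
  have hX₀m : MeasurableSet X₀ :=
    measurable_measure_prodMk_left (measurableSet_eq_fun hfm
      (hf'm.comp measurable_fst)).compl (measurableSet_singleton 0)
  have hmem (x : X) : x ∈ X₀ ↔ ∀ᵐ g ∂η, f (g • x) = f' x := Iff.rfl
  have hconst (x : X) (c : ℂ) (hc : ∀ᵐ g ∂η, f (g • x) = c) : f' x = c := by
    rw [hf']
    simp only
    rw [integral_congr_ae hc]
    simp
  have hmove (x : X) (hx : x ∈ X₀) (k : G) : ∀ᵐ g ∂η, f (g • k • x) = f' x := by
    have h1 := (quasiMeasurePreserving_mul_right (Measure.haar : Measure G) k).ae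
      (hη2.ae_le ((hmem x).1 hx))
    refine hη1.ae_le ?_
    filter_upwards [h1] with g hg
    rwa [← mul_smul]
  have hf'inv (x : X) (hx : x ∈ X₀) (k : G) : f' (k • x) = f' x := hconst _ _ (hmove x hx k)
  have hX₀inv (x : X) (hx : x ∈ X₀) (k : G) : k • x ∈ X₀ := by
    rw [hmem, hf'inv x hx k]
    exact hmove x hx k
  have hX₀iff (x : X) (k : G) : k • x ∈ X₀ ↔ x ∈ X₀ :=
    ⟨fun h => by simpa using hX₀inv _ h k⁻¹, fun h => hX₀inv x h k⟩
  refine ⟨X₀.indicator f', ?_, ?_⟩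
  · intro s hs
    rw [measurableSet_invariantSigmaAlgebra]
    refine ⟨hf'm.indicator hX₀m hs, fun g => ?_⟩
    ext x
    simp only [mem_preimage, Set.indicator_apply, hX₀iff]
    split_ifs with hx
    · rw [hf'inv x hx]
    · rfl
  · have h2 : ∀ᵐ x ∂μ, ∀ᵐ g ∂η, f (g • x) = f x := Measure.ae_ae_comm (by
      exact measurableSet_eq_fun (hf.comp (measurable_fst.smul measurable_snd))
        (hf.comp measurable_snd)) |>.1 (ae_of_all _ hinv)
    filter_upwards [h2] with x hx
    have h3 := hconst x _ hx
    have h4 : x ∈ X₀ := by rw [hmem, h3]; exact hx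
    rw [Set.indicator_of_mem h4, h3]

end Invariant

/-! ### Density of coboundaries and invariant functions -/

section Density

variable {G : Type*} [Group G] {X : Type*} [MeasurableSpace X] [MulAction G X] {μ : Measure X}

/-- The Mautner property of a one-parameter subgroup: functions that are invariant under the
subgroup are invariant under the whole group. -/
def HasMautner (n : ℝ → G) (X : Type*) [MeasurableSpace X] [MulAction G X] (μ : Measure X) : Prop :=
  ∀ v : X → ℂ, Measurable v → Integrable v μ → (∀ t, ∀ᵐ x ∂μ, v ((n t)⁻¹ • x) = v x) →
    ∀ g : G, ∀ᵐ x ∂μ, v (g • x) = v x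

theorem flowConverges_invariant [IsProbabilityMeasure μ] {n : ℝ → G} {a b : ℝ → ℝ} {C : ℝ}
    (hab : IsSpreading a b C) {F : X → ℂ} (hF : Measurable[invariantSigmaAlgebra G X] F)
    (hFI : Integrable F μ) :
    FlowConverges (invariantSigmaAlgebra G X) (fun s (x : X) => (n s)⁻¹ • x) μ a b F where
  measurable := hF.mono invariantSigmaAlgebra_le le_rfl
  integrable := hFI
  tendsto := by
    rw [condExp_of_stronglyMeasurable invariantSigmaAlgebra_le hF.stronglyMeasurable hFI]
    refine ae_of_all _ fun x => tendsto_const_nhds.congr' ?_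
    filter_upwards [eventually_gt_atTop 0] with r hr
    have := isProbabilityMeasure_linearWeight (hab.nonneg r hr) (hab.lt r hr)
    simp [apply_smul_of_measurable_invariant hF]

variable [MeasurableSpace G] [MeasurableSMul₂ G X] [SMulInvariantMeasure G X μ]

theorem isFlow_inv_smul [MeasurableInv G] (n : ℝ → G) (hn : Measurable n)
    (hadd : ∀ s t, n (s + t) = n s * n t) :
    IsFlow (fun s (x : X) => (n s)⁻¹ • x) μ where
  measurable := (hn.comp measurable_fst).inv.smul measurable_snd
  add s t x := by rw [add_comm, hadd, mul_inv_rev, mul_smul]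
  measurePreserving t := measurePreserving_smul _ _

variable [IsProbabilityMeasure μ]

theorem condExp_sub_smul_ae_eq_zero (g : G) {φ : X → ℂ}
    (hφ : Integrable φ μ) :
    μ[fun x => φ x - φ (g • x) | invariantSigmaAlgebra G X] =ᵐ[μ] 0 := by
  have hmp : MeasurePreserving (fun x : X => g • x) μ μ := measurePreserving_smul g μ
  have hφ' : Integrable (fun x => φ (g • x)) μ := hmp.integrable_comp_of_integrable hφ
  refine (ae_eq_condExp_of_forall_setIntegral_eq invariantSigmaAlgebra_le (hφ.sub hφ')
    (fun s _ _ => integrableOn_zero) (fun s hs _ => ?_) aestronglyMeasurable_zero).symm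
  rw [measurableSet_invariantSigmaAlgebra] at hs
  have h1 : ∫ x in s, φ (g • x) ∂μ = ∫ x in s, φ x ∂μ := by
    have := hmp.setIntegral_preimage_emb (measurableEmbedding_const_smul g) φ s
    rwa [hs.2 g] at this
  simp only [Pi.sub_apply]
  rw [integral_sub hφ.integrableOn hφ'.integrableOn, h1, sub_self]
  simp

theorem flowConverges_coboundary [MeasurableInv G] {n : ℝ → G} (hn : Measurable n)
    (hadd : ∀ s t, n (s + t) = n s * n t) {a b : ℝ → ℝ} {C : ℝ} (hab : IsSpreading a b C)
    (t : ℝ) {φ : X → ℂ} (hφm : Measurable φ) {B : ℝ} (hB : ∀ x, ‖φ x‖ ≤ B) :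
    FlowConverges (invariantSigmaAlgebra G X) (fun s (x : X) => (n s)⁻¹ • x) μ a b
      fun x => φ x - φ ((n t)⁻¹ • x) where
  measurable := hφm.sub (hφm.comp (measurable_const_smul _))
  integrable := by
    have hφ : Integrable φ μ := .of_bound hφm.aestronglyMeasurable B (ae_of_all _ hB)
    exact hφ.sub ((measurePreserving_smul (n t)⁻¹ μ).integrable_comp_of_integrable hφ)
  tendsto := by
    have hφ : Integrable φ μ := .of_bound hφm.aestronglyMeasurable B (ae_of_all _ hB)
    filter_upwards [condExp_sub_smul_ae_eq_zero (n t)⁻¹ hφ] with x hx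
    rw [hx, Pi.zero_apply]
    have hT := isFlow_inv_smul (X := X) (μ := μ) n hn hadd
    have hψ : Measurable fun s => φ ((n s)⁻¹ • x) :=
      (hT.measurable_comp hφm).comp measurable_prodMk_left
    have hlim : Tendsto (fun r => 4 * C * B * |t| * (b r + |t|) / b r ^ 2) atTop (𝓝 0) := by
      have h1 : Tendsto (fun r => (b r)⁻¹) atTop (𝓝 0) := tendsto_inv_atTop_zero.comp hab.tendsto
      have h2 : Tendsto (fun r => 4 * C * B * |t| * ((b r)⁻¹ + |t| * ((b r)⁻¹ * (b r)⁻¹)))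
          atTop (𝓝 (4 * C * B * |t| * (0 + |t| * (0 * 0)))) :=
        (h1.add ((h1.mul h1).const_mul _)).const_mul _
      simp only [mul_zero, add_zero] at h2
      refine h2.congr' ?_
      filter_upwards [hab.tendsto.eventually_gt_atTop 0] with r hr
      field_simp
    refine squeeze_zero_norm' ?_ hlim
    filter_upwards [eventually_gt_atTop 0] with r hr
    have h3 := norm_linearWeight_sub_le (t := t) (hab.nonneg r hr) (hab.lt r hr) (hab.le r hr)
      hψ (fun s => hB _)
    refine le_trans (le_of_eq ?_) h3
    congr 2
    ext s
    rw [← mul_smul, ← mul_inv_rev, ← hadd]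

variable (μ) in
/-- The square-integrable functions whose averages along the flow converge almost everywhere. -/
def convergenceSubmodule [MeasurableInv G] {n : ℝ → G} (hn : Measurable n)
    (hadd : ∀ s t, n (s + t) = n s * n t) {a b : ℝ → ℝ} {C : ℝ} (hab : IsSpreading a b C) :
    Submodule ℂ (Lp (α := X) ℂ 2 μ) where
  carrier := {v | ∃ g, FlowConverges (invariantSigmaAlgebra G X) (fun s (x : X) => (n s)⁻¹ • x)
    μ a b g ∧ v =ᵐ[μ] g}
  add_mem' := by
    rintro v w ⟨g, hg, hvg⟩ ⟨g', hg', hwg'⟩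
    exact ⟨g + g', hg.add (isFlow_inv_smul n hn hadd) hab hg',
      (Lp.coeFn_add v w).trans (hvg.add hwg')⟩
  zero_mem' := ⟨0, flowConverges_invariant hab measurable_const (integrable_zero _ _ _),
    Lp.coeFn_zero _ _ _⟩
  smul_mem' := by
    rintro c v ⟨g, hg, hvg⟩
    exact ⟨c • g, hg.smul c, (Lp.coeFn_smul c v).trans (hvg.const_smul c)⟩

variable [TopologicalSpace G] [IsTopologicalGroup G] [LocallyCompactSpace G]
  [SecondCountableTopology G] [BorelSpace G]

/-- A square-integrable function orthogonal to the bounded coboundaries of the flow is invariant,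
so that coboundaries and invariant functions together span a dense subspace. -/
theorem topologicalClosure_convergenceSubmodule {n : ℝ → G} (hn : Measurable n)
    (hadd : ∀ s t, n (s + t) = n s * n t) (hM : HasMautner n X μ)
    {a b : ℝ → ℝ} {C : ℝ} (hab : IsSpreading a b C) :
    (convergenceSubmodule (X := X) μ hn hadd hab).topologicalClosure = ⊤ := by
  classical
  rw [Submodule.topologicalClosure_eq_top_iff, Submodule.eq_bot_iff]
  intro v hv
  rw [Submodule.mem_orthogonal] at hv
  have hvm : Measurable v := (Lp.stronglyMeasurable v).measurable
  have hv2 : MemLp v 2 μ := Lp.memLp v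
  have hvI : Integrable v μ := hv2.integrable one_le_two
  have hinvt (t : ℝ) : ∀ᵐ x ∂μ, v ((n t)⁻¹ • x) = v x := by
    have hmp : MeasurePreserving (fun x : X => (n t)⁻¹ • x) μ μ := measurePreserving_smul _ μ
    have hvI' : Integrable (fun x => v ((n t)⁻¹ • x)) μ := hmp.integrable_comp_of_integrable hvI
    refine hvI'.ae_eq_of_forall_setIntegral_eq _ _ hvI fun s hs _ => ?_
    -- `s` is the preimage of `E`; test `v` against the coboundary of the indicator of `E`
    set E : Set X := (fun x : X => n t • x) ⁻¹' s with hE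
    have hEm : MeasurableSet E := measurable_const_smul (n t) hs
    have hEs : (fun x : X => (n t)⁻¹ • x) ⁻¹' E = s := by ext x; simp [hE]
    set φ : X → ℂ := E.indicator fun _ => 1 with hφ
    have hφm : Measurable φ := measurable_const.indicator hEm
    have hφB (x : X) : ‖φ x‖ ≤ 1 := by
      simp only [hφ, Set.indicator_apply]; split_ifs <;> simp
    have hcob := flowConverges_coboundary (μ := μ) hn hadd hab t hφm hφB
    have hmem : MemLp (fun x => φ x - φ ((n t)⁻¹ • x)) 2 μ :=
      .of_bound hcob.measurable.aestronglyMeasurable 2 (ae_of_all _ fun x =>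
        (norm_sub_le _ _).trans (by linarith [hφB x, hφB ((n t)⁻¹ • x)]))
    have h0 := hv (hmem.toLp _) ⟨_, hcob, hmem.coeFn_toLp⟩
    rw [L2.inner_def] at h0
    have h1 : ∫ x, inner ℂ (hmem.toLp _ x) (v x) ∂μ =
        ∫ x, (E.indicator (v : X → ℂ) x - s.indicator (v : X → ℂ) x) ∂μ := by
      refine integral_congr_ae ?_
      filter_upwards [hmem.coeFn_toLp] with x hx
      have hxs : x ∈ s ↔ (n t)⁻¹ • x ∈ E := by simp [hE]
      rw [hx]
      simp only [hφ, Set.indicator_apply, hxs]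
      split_ifs <;> simp
    rw [h1, integral_sub (hvI.indicator hEm) (hvI.indicator hs), integral_indicator hEm,
      integral_indicator hs, sub_eq_zero] at h0
    have h2 := hmp.setIntegral_preimage_emb (measurableEmbedding_const_smul _) v E
    rw [hEs] at h2
    rw [h2, h0]
  obtain ⟨F, hF, hFv⟩ := exists_invariant_ae_eq hvm (hM v hvm hvI hinvt)
  have hvS := hv v ⟨F, flowConverges_invariant hab hF (hvI.congr hFv.symm), hFv.symm⟩
  exact inner_self_eq_zero.1 hvS

/-- The pointwise ergodic theorem for linearly weighted averages along a one-parameter subgroup with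
the Mautner property: the limit is the conditional expectation on the sets that are invariant under
the whole group. -/
theorem flowConverges_of_integrable {n : ℝ → G} (hn : Measurable n)
    (hadd : ∀ s t, n (s + t) = n s * n t) (hM : HasMautner n X μ)
    {a b : ℝ → ℝ} {C : ℝ} (hab : IsSpreading a b C) {h : X → ℂ} (hh : Measurable h)
    (hI : Integrable h μ) :
    FlowConverges (invariantSigmaAlgebra G X) (fun s (x : X) => (n s)⁻¹ • x) μ a b h := by
  refine .of_dense (isFlow_inv_smul n hn hadd) hab hh hI fun ε hε => ?_
  have hε2 : ε / 2 ≠ 0 := by simp [hε]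
  obtain ⟨f, hf1, hf2⟩ := (memLp_one_iff_integrable.2 hI).exists_simpleFunc_eLpNorm_sub_lt
    (by simp) hε2
  have hfL : MemLp f 2 μ := f.memLp_of_isFiniteMeasure 2 μ
  have hdense : hfL.toLp f ∈ closure (convergenceSubmodule (X := X) μ hn hadd hab : Set _) := by
    rw [← Submodule.topologicalClosure_coe,
      topologicalClosure_convergenceSubmodule hn hadd hM hab]
    trivial
  obtain ⟨w, ⟨g, hg, hwg⟩, hw⟩ := EMetric.mem_closure_iff.1 hdense (ε / 2) (pos_iff_ne_zero.2 hε2)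
  refine ⟨g, hg, ?_⟩
  have e1 : ∫⁻ x, ‖f x - g x‖ₑ ∂μ ≤ ε / 2 := by
    have h1 : eLpNorm (fun x => f x - g x) 1 μ ≤ eLpNorm (fun x => f x - g x) 2 μ :=
      eLpNorm_le_eLpNorm_of_exponent_le one_le_two
        (f.measurable.sub hg.measurable).aestronglyMeasurable
    rw [eLpNorm_one_eq_lintegral_enorm] at h1
    refine h1.trans ?_
    rw [Lp.edist_def] at hw
    refine le_trans (le_of_eq (eLpNorm_congr_ae ?_)) hw.le
    filter_upwards [hfL.coeFn_toLp, hwg] with x h2 h3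
    simp [h2, h3]
  calc ∫⁻ x, ‖h x - g x‖ₑ ∂μ ≤ ∫⁻ x, (‖h x - f x‖ₑ + ‖f x - g x‖ₑ) ∂μ := by
        refine lintegral_mono fun x => ?_
        simpa using enorm_add_le (h x - f x) (f x - g x)
    _ = ∫⁻ x, ‖h x - f x‖ₑ ∂μ + ∫⁻ x, ‖f x - g x‖ₑ ∂μ :=
        lintegral_add_left (hh.sub f.measurable).enorm _
    _ ≤ ε / 2 + ε / 2 := by
        refine add_le_add ?_ e1
        rw [eLpNorm_one_eq_lintegral_enorm] at hf1
        exact hf1.le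
    _ = ε := ENNReal.add_halves ε

end Density

/-! ### The Mautner phenomenon for unipotent one-parameter subgroups -/

section Continuity

variable {G : Type*} [Group G] [MeasurableSpace G] {X : Type*} [MeasurableSpace X] [MulAction G X]
  [MeasurableSMul₂ G X] {μ : Measure X} [SMulInvariantMeasure G X μ]

theorem lintegral_enorm_smul_sub_smul (f : X → ℂ) (hf : Measurable f) (g h : G) :
    ∫⁻ x, ‖f (g • x) - f (h • x)‖ₑ ∂μ = ∫⁻ x, ‖f ((g * h⁻¹) • x) - f x‖ₑ ∂μ := by
  have hm : Measurable fun x => ‖f ((g * h⁻¹) • x) - f x‖ₑ :=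
    ((hf.comp (measurable_const_smul _)).sub hf).enorm
  rw [← (measurePreserving_smul h μ).lintegral_comp hm]
  simp [mul_smul]

variable [TopologicalSpace G] [IsTopologicalGroup G] [LocallyCompactSpace G]
  [SecondCountableTopology G] [BorelSpace G] [IsProbabilityMeasure μ]

/-- A measurable action is continuous in `L^1`. By separability of `L^1` some set of group elements
of positive Haar measure moves `f` close to one fixed function; by Steinhaus' theorem the quotients
of its elements fill a neighbourhood of the identity. -/
theorem tendsto_lintegral_enorm_smul_sub [MeasurableSpace.CountablyGenerated X] {f : X → ℂ}
    (hf : Measurable f) (hI : Integrable f μ) :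
    Tendsto (fun g : G => ∫⁻ x, ‖f (g • x) - f x‖ₑ ∂μ) (𝓝 1) (𝓝 0) := by
  refine ENNReal.tendsto_nhds_zero.2 fun ε hε => ?_
  have hε2 : 0 < ε / 2 := by simp [hε.ne']
  have hfact : Fact ((1 : ℝ≥0∞) ≠ ∞) := ⟨by simp⟩
  obtain ⟨u, hu⟩ := TopologicalSpace.exists_dense_seq (Lp ℂ 1 μ)
  set A : ℕ → Set G := fun i => {g | ∫⁻ x, ‖f (g • x) - u i x‖ₑ ∂μ < ε / 2} with hA
  have hum (i : ℕ) : Measurable (u i) := (Lp.stronglyMeasurable _).measurable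
  have hAm (i : ℕ) : MeasurableSet (A i) := by
    have : Measurable fun g : G => ∫⁻ x, ‖f (g • x) - u i x‖ₑ ∂μ := by
      refine Measurable.lintegral_prod_right' (f := fun q : G × X => ‖f (q.1 • q.2) - u i q.2‖ₑ) ?_
      exact ((hf.comp (measurable_fst.smul measurable_snd)).sub
        ((hum i).comp measurable_snd)).enorm
    exact this measurableSet_Iio
  have hAU : ⋃ i, A i = univ := by
    refine eq_univ_of_forall fun g => mem_iUnion.2 ?_
    have hg : MemLp (fun x => f (g • x)) 1 μ := memLp_one_iff_integrable.2
      ((measurePreserving_smul g μ).integrable_comp_of_integrable hI)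
    obtain ⟨_, ⟨i, rfl⟩, hi⟩ := EMetric.mem_closure_iff.1 (hu (hg.toLp _)) (ε / 2) hε2
    refine ⟨i, ?_⟩
    rw [Lp.edist_def, eLpNorm_one_eq_lintegral_enorm] at hi
    refine lt_of_le_of_lt (le_of_eq (lintegral_congr_ae ?_)) hi
    filter_upwards [hg.coeFn_toLp] with x hx
    simp [hx]
  obtain ⟨i, hi⟩ : ∃ i, (Measure.haar : Measure G) (A i) ≠ 0 := by
    by_contra! h
    have := measure_iUnion_null h
    rw [hAU] at this
    exact (isOpen_univ.measure_pos (Measure.haar : Measure G) ⟨1, trivial⟩).ne' this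
  filter_upwards [Measure.div_mem_nhds_one_of_haar_pos Measure.haar _ (hAm i)
    (pos_iff_ne_zero.2 hi)] with k hk
  obtain ⟨g, hg, h, hh, rfl⟩ := Set.mem_div.1 hk
  rw [div_eq_mul_inv, ← lintegral_enorm_smul_sub_smul f hf]
  have hgm : Measurable fun x => ‖f (g • x) - u i x‖ₑ :=
    ((hf.comp (measurable_const_smul _)).sub (hum i)).enorm
  calc ∫⁻ x, ‖f (g • x) - f (h • x)‖ₑ ∂μ
      ≤ ∫⁻ x, (‖f (g • x) - u i x‖ₑ + ‖f (h • x) - u i x‖ₑ) ∂μ := by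
        refine lintegral_mono fun x => ?_
        rw [← enorm_neg (f (h • x) - u i x)]
        simpa using enorm_add_le (f (g • x) - u i x) (-(f (h • x) - u i x))
    _ = _ := lintegral_add_left hgm _
    _ ≤ ε / 2 + ε / 2 := add_le_add (le_of_lt hg) (le_of_lt hh)
    _ = ε := ENNReal.add_halves ε

end Continuity

section SL2

/-- The unipotent matrix `(1 x; 0 1)`. -/
def upperUnip (x : ℝ) : SL(2, ℝ) := ⟨!![1, x; 0, 1], by simp [Matrix.det_fin_two]⟩

/-- The unipotent matrix `(1 0; c 1)`. -/
def lowerUnip (c : ℝ) : SL(2, ℝ) := ⟨!![1, 0; c, 1], by simp [Matrix.det_fin_two]⟩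

/-- The lower triangular matrix `(l 0; c l⁻¹)`. -/
def lowerTri (l : ℝ) (hl : l ≠ 0) (c : ℝ) : SL(2, ℝ) :=
  ⟨!![l, 0; c, l⁻¹], by simp [Matrix.det_fin_two, hl]⟩

@[simp] theorem coe_upperUnip (x : ℝ) :
    (upperUnip x : Matrix (Fin 2) (Fin 2) ℝ) = !![1, x; 0, 1] := rfl

@[simp] theorem coe_lowerUnip (c : ℝ) :
    (lowerUnip c : Matrix (Fin 2) (Fin 2) ℝ) = !![1, 0; c, 1] := rfl

@[simp] theorem coe_lowerTri (l : ℝ) (hl : l ≠ 0) (c : ℝ) :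
    (lowerTri l hl c : Matrix (Fin 2) (Fin 2) ℝ) = !![l, 0; c, l⁻¹] := rfl

theorem SL2_ext {A B : SL(2, ℝ)} (h00 : A 0 0 = B 0 0) (h01 : A 0 1 = B 0 1)
    (h10 : A 1 0 = B 1 0) (h11 : A 1 1 = B 1 1) : A = B := by
  ext i j
  fin_cases i <;> fin_cases j <;> assumption

theorem upperUnip_add (x y : ℝ) : upperUnip (x + y) = upperUnip x * upperUnip y := by
  apply SL2_ext <;> simp [Matrix.mul_apply, Fin.sum_univ_two, add_comm]

theorem upperUnip_mul_lowerUnip_mul_upperUnip (x c y : ℝ) :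
    (upperUnip x * lowerUnip c * upperUnip y : SL(2, ℝ)) =
      ⟨!![1 + x * c, (1 + x * c) * y + x; c, c * y + 1], by
        simp [Matrix.det_fin_two]; ring⟩ := by
  apply SL2_ext <;> simp [Matrix.mul_apply, Fin.sum_univ_two]

theorem continuous_lowerUnip : Continuous lowerUnip := by
  refine Continuous.subtype_mk (continuous_matrix fun i j => ?_) _
  fin_cases i <;> fin_cases j <;> simp <;> fun_prop

theorem continuous_upperUnip : Continuous upperUnip := by
  refine Continuous.subtype_mk (continuous_matrix fun i j => ?_) _
  fin_cases i <;> fin_cases j <;> simp <;> fun_prop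

/-- A subadditive function on `SL₂(ℝ)` that tends to `0` at the identity and vanishes on the upper
unipotent matrices vanishes identically. A diagonal matrix is a limit of products
`n u n'` with `n`, `n'` upper unipotent and `u` lower unipotent and close to the identity; and
lower unipotent matrices are contracted to the identity by conjugation with diagonal ones. -/
theorem eq_zero_of_upperUnip {N : SL(2, ℝ) → ℝ≥0∞} (hmul : ∀ g h, N (g * h) ≤ N g + N h)
    (hN : ∀ x, N (upperUnip x) = 0) (hcont : Tendsto N (𝓝 1) (𝓝 0)) (g : SL(2, ℝ)) : N g = 0 := by
  have hmul3 (x y : ℝ) (g : SL(2, ℝ)) : N (upperUnip x * g * upperUnip y) ≤ N g := by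
    refine (hmul _ _).trans ?_
    rw [hN, add_zero]
    refine (hmul _ _).trans ?_
    rw [hN, zero_add]
  have hlow : Tendsto (fun c => N (lowerUnip c)) (𝓝 0) (𝓝 0) := by
    refine hcont.comp ?_
    have : lowerUnip 0 = 1 := by apply SL2_ext <;> simp
    rw [← this]
    exact continuous_lowerUnip.continuousAt
  have hlow' (k : ℝ) : Tendsto (fun c => N (lowerUnip (k * c))) (𝓝 0) (𝓝 0) := by
    refine hlow.comp ?_
    have : Tendsto (fun c : ℝ => k * c) (𝓝 0) (𝓝 (k * 0)) := tendsto_id.const_mul k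
    rwa [mul_zero] at this
  have htri (l : ℝ) (hl : l ≠ 0) (c : ℝ) (hc : c ≠ 0) : N (lowerTri l hl c) ≤ N (lowerUnip c) := by
    have : lowerTri l hl c = upperUnip ((l - 1) / c) * lowerUnip c * upperUnip ((l⁻¹ - 1) / c) := by
      rw [upperUnip_mul_lowerUnip_mul_upperUnip]
      apply SL2_ext <;> simp <;> field_simp <;> ring
    rw [this]
    exact hmul3 _ _ _
  have hdiag (l : ℝ) (hl : l ≠ 0) : N (lowerTri l hl 0) = 0 := by
    have h1 : Tendsto (fun c => N (lowerUnip c) + N (lowerUnip (-l * c))) (𝓝[≠] 0) (𝓝 (0 + 0)) :=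
      (hlow.add (hlow' (-l))).mono_left nhdsWithin_le_nhds
    rw [add_zero] at h1
    refine le_antisymm (ge_of_tendsto h1 ?_) zero_le
    filter_upwards [self_mem_nhdsWithin] with c hc
    have : lowerTri l hl 0 = lowerTri l hl c * lowerUnip (-l * c) := by
      apply SL2_ext <;> simp [Matrix.mul_apply, Fin.sum_univ_two]
      field_simp; ring
    rw [this]
    exact (hmul _ _).trans (by gcongr; exact htri l hl c hc)
  have hlow0 (c : ℝ) : N (lowerUnip c) = 0 := by
    have h1 : Tendsto (fun l : ℝ => N (lowerUnip (c * (l⁻¹ * l⁻¹)))) atTop (𝓝 0) := by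
      refine (hlow' c).comp ?_
      have := tendsto_inv_atTop_zero.mul (tendsto_inv_atTop_zero (𝕜 := ℝ))
      rwa [mul_zero] at this
    refine le_antisymm (ge_of_tendsto h1 ?_) zero_le
    filter_upwards [eventually_gt_atTop 0] with l hl
    have : lowerUnip c = lowerTri l⁻¹ (inv_ne_zero hl.ne') 0 * lowerUnip (c * (l⁻¹ * l⁻¹)) *
        lowerTri l hl.ne' 0 := by
      apply SL2_ext <;> simp [Matrix.mul_apply, Fin.sum_univ_two] <;> field_simp
    rw [this]
    refine (hmul _ _).trans ?_
    rw [hdiag, add_zero]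
    refine (hmul _ _).trans ?_
    rw [hdiag, zero_add]
  have hdet : g 0 0 * g 1 1 - g 0 1 * g 1 0 = 1 := by
    have := g.det_coe
    rwa [Matrix.det_fin_two] at this
  refine le_antisymm ?_ zero_le
  by_cases hc : g 1 0 = 0
  · have ha : g 0 0 ≠ 0 := by
      rintro h; rw [hc, h] at hdet; simp at hdet
    have hg : g = lowerTri (g 0 0) ha 0 * upperUnip (g 0 1 / g 0 0) := by
      apply SL2_ext <;> simp [Matrix.mul_apply, Fin.sum_univ_two]
      · field_simp
      · exact hc
      · rw [hc, mul_zero, sub_zero] at hdet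
        field_simp; linarith
    rw [hg]
    exact (hmul _ _).trans (by rw [hdiag, hN, add_zero])
  · have hg : g = upperUnip ((g 0 0 - 1) / g 1 0) * lowerUnip (g 1 0) *
        upperUnip ((g 1 1 - 1) / g 1 0) := by
      rw [upperUnip_mul_lowerUnip_mul_upperUnip]
      apply SL2_ext <;> simp
      · field_simp; ring
      · field_simp; linarith
      · field_simp; ring
    rw [hg]
    exact (hmul3 _ _ _).trans (hlow0 _).le

end SL2

/-! ### Topology of `PSL₂(ℝ)` -/

theorem continuous_mk : Continuous (fun A : SL(2, ℝ) => (QuotientGroup.mk A : PSL2R)) :=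
  continuous_quotient_mk'

instance : SecondCountableTopology SL(2, ℝ) := by
  have : SecondCountableTopology (Matrix (Fin 2) (Fin 2) ℝ) :=
    inferInstanceAs (SecondCountableTopology (Fin 2 → Fin 2 → ℝ))
  exact Matrix.SpecialLinearGroup.isClosedEmbedding_val.isEmbedding.secondCountableTopology

instance : SecondCountableTopology PSL2R :=
  inferInstanceAs (SecondCountableTopology (SL(2, ℝ) ⧸ Subgroup.center SL(2, ℝ)))

instance : LocallyCompactSpace PSL2R :=
  inferInstanceAs (LocallyCompactSpace (SL(2, ℝ) ⧸ Subgroup.center SL(2, ℝ)))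

theorem isClosed_center : IsClosed (Subgroup.center SL(2, ℝ) : Set SL(2, ℝ)) := by
  have : (Subgroup.center SL(2, ℝ) : Set SL(2, ℝ)) = ⋂ B : SL(2, ℝ), {A | B * A = A * B} := by
    ext A
    simp [Subgroup.mem_center_iff]
  rw [this]
  exact isClosed_iInter fun B => isClosed_eq (by fun_prop) (by fun_prop)

instance : T2Space PSL2R := by
  have : IsClosed (Subgroup.center SL(2, ℝ) : Set SL(2, ℝ)) := isClosed_center
  have : T3Space (SL(2, ℝ) ⧸ Subgroup.center SL(2, ℝ)) := inferInstance
  exact inferInstanceAs (T2Space (SL(2, ℝ) ⧸ Subgroup.center SL(2, ℝ)))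

/-- The one-parameter unipotent subgroup of `PSL₂(ℝ)` conjugated by `h`. -/
def unip (h : SL(2, ℝ)) (x : ℝ) : PSL2R := QuotientGroup.mk (h * upperUnip x * h⁻¹)

theorem unip_add (h : SL(2, ℝ)) (x y : ℝ) : unip h (x + y) = unip h x * unip h y := by
  rw [unip, unip, unip, ← QuotientGroup.mk_mul, upperUnip_add]
  congr 1
  group

theorem continuous_unip (h : SL(2, ℝ)) : Continuous (unip h) :=
  continuous_mk.comp ((continuous_const.mul continuous_upperUnip).mul continuous_const)

/-- The displacement of `v` in `L^1` is a subadditive function on the group that is continuous at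
the identity, so it vanishes identically as soon as it vanishes on a unipotent subgroup. -/
theorem hasMautner_unip (h : SL(2, ℝ)) {X : Type*} [MeasurableSpace X]
    [MeasurableSpace.CountablyGenerated X] [MulAction PSL2R X] [MeasurableSMul₂ PSL2R X]
    (μ : Measure X) [IsProbabilityMeasure μ] [SMulInvariantMeasure PSL2R X μ] :
    HasMautner (unip h) X μ := by
  intro v hv hI hinv g
  set N : SL(2, ℝ) → ℝ≥0∞ := fun A =>
    ∫⁻ x, ‖v ((QuotientGroup.mk (h * A * h⁻¹) : PSL2R) • x) - v x‖ₑ ∂μ with hN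
  have hzero (k : PSL2R) : ∫⁻ x, ‖v (k • x) - v x‖ₑ ∂μ = 0 ↔ ∀ᵐ x ∂μ, v (k • x) = v x := by
    have hm : Measurable fun x => ‖v (k • x) - v x‖ₑ :=
      ((hv.comp (measurable_const_smul _)).sub hv).enorm
    rw [lintegral_eq_zero_iff hm]
    refine eventually_congr (ae_of_all _ fun x => ?_)
    simp [sub_eq_zero]
  have hmain : ∀ A, N A = 0 := by
    refine eq_zero_of_upperUnip (fun A B => ?_) (fun t => ?_) ?_
    · have e : (QuotientGroup.mk (h * (A * B) * h⁻¹) : PSL2R) =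
          QuotientGroup.mk (h * A * h⁻¹) * QuotientGroup.mk (h * B * h⁻¹) := by
        rw [← QuotientGroup.mk_mul]; congr 1; group
      set a : PSL2R := QuotientGroup.mk (h * A * h⁻¹)
      set b : PSL2R := QuotientGroup.mk (h * B * h⁻¹)
      have hm : Measurable fun x => ‖v (b • x) - v x‖ₑ :=
        ((hv.comp (measurable_const_smul _)).sub hv).enorm
      have e2 : ∫⁻ x, ‖v ((a * b) • x) - v (b • x)‖ₑ ∂μ = N A := by
        rw [lintegral_enorm_smul_sub_smul v hv, mul_inv_cancel_right]
      rw [hN]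
      simp only
      rw [e]
      calc _ ≤ ∫⁻ x, (‖v ((a * b) • x) - v (b • x)‖ₑ + ‖v (b • x) - v x‖ₑ) ∂μ := by
            refine lintegral_mono fun x => ?_
            simpa using enorm_add_le (v ((a * b) • x) - v (b • x)) (v (b • x) - v x)
        _ = N A + N B := by rw [lintegral_add_right _ hm, e2]
    · refine (hzero (unip h t)).2 ?_
      have h1 := hinv (-t)
      have h2 : (unip h (-t))⁻¹ = unip h t := by
        rw [inv_eq_iff_mul_eq_one, ← unip_add, neg_add_cancel, unip]
        have : upperUnip 0 = 1 := by apply SL2_ext <;> simp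
        rw [this]; simp
      rwa [h2] at h1
    · have h1 := tendsto_lintegral_enorm_smul_sub (G := PSL2R) hv hI
      refine h1.comp ?_
      have h2 : Continuous fun A : SL(2, ℝ) => (QuotientGroup.mk (h * A * h⁻¹) : PSL2R) :=
        continuous_mk.comp (by fun_prop)
      have h3 := h2.tendsto 1
      simpa using h3
  obtain ⟨A, rfl⟩ := QuotientGroup.mk_surjective g
  have := hmain (h⁻¹ * A * h)
  rw [hN] at this
  simp only at this
  rw [show h * (h⁻¹ * A * h) * h⁻¹ = A by group] at this
  exact (hzero _).1 this

/-! ### Complex coordinates on `SL₂(ℝ)` and the polar decomposition -/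

/-- The matrix of the real-linear map `z ↦ α z + conj (η z)` of `ℂ`. -/
def realMat (v : ℂ × ℂ) : Matrix (Fin 2) (Fin 2) ℝ :=
  !![v.1.re + v.2.re, -(v.1.im + v.2.im); v.1.im - v.2.im, v.1.re - v.2.re]

/-- The determinant of `realMat v`. -/
def quadForm (v : ℂ × ℂ) : ℝ := Complex.normSq v.1 - Complex.normSq v.2

/-- The coordinates of a matrix as a real-linear map of `ℂ`; inverse to `realMat`. -/
def toPair (A : SL(2, ℝ)) : ℂ × ℂ :=
  (⟨(A 0 0 + A 1 1) / 2, (A 1 0 - A 0 1) / 2⟩, ⟨(A 0 0 - A 1 1) / 2, -(A 1 0 + A 0 1) / 2⟩)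

theorem det_realMat (v : ℂ × ℂ) : (realMat v).det = quadForm v := by
  simp [realMat, quadForm, Matrix.det_fin_two, Complex.normSq_apply]; ring

theorem realMat_toPair (A : SL(2, ℝ)) : realMat (toPair A) = A := by
  ext i j
  fin_cases i <;> fin_cases j <;> simp [realMat, toPair] <;> ring

theorem quadForm_toPair (A : SL(2, ℝ)) : quadForm (toPair A) = 1 := by
  rw [← det_realMat, realMat_toPair, A.det_coe]

/-- Left multiplication by a matrix, in complex coordinates. It is complex linear. -/
def pairMul (A : SL(2, ℝ)) : (ℂ × ℂ) →ₗ[ℂ] (ℂ × ℂ) :=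
  Matrix.toLin (Module.Basis.finTwoProd ℂ) (Module.Basis.finTwoProd ℂ)
    !![(toPair A).1, star (toPair A).2; (toPair A).2, star (toPair A).1]

theorem pairMul_apply (A : SL(2, ℝ)) (v : ℂ × ℂ) :
    pairMul A v = ((toPair A).1 * v.1 + star (toPair A).2 * v.2,
      (toPair A).2 * v.1 + star (toPair A).1 * v.2) := by
  rw [pairMul, Matrix.toLin_finTwoProd_apply]

theorem det_pairMul (A : SL(2, ℝ)) : LinearMap.det (pairMul A) = 1 := by
  rw [pairMul, LinearMap.det_toLin, Matrix.det_fin_two]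
  have := quadForm_toPair A
  rw [quadForm] at this
  simp only [Matrix.of_apply, Matrix.cons_val', Matrix.cons_val_zero, Matrix.cons_val_one,
    Matrix.cons_val_fin_one]
  rw [Complex.star_def, Complex.mul_conj, mul_comm, Complex.mul_conj]
  exact_mod_cast this

theorem realMat_pairMul (A : SL(2, ℝ)) (v : ℂ × ℂ) :
    realMat (pairMul A v) = (A : Matrix (Fin 2) (Fin 2) ℝ) * realMat v := by
  rw [pairMul_apply]
  ext i j
  fin_cases i <;> fin_cases j <;>
    simp [realMat, toPair, Matrix.mul_apply, Fin.sum_univ_two] <;> ring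

theorem quadForm_pairMul (A : SL(2, ℝ)) (v : ℂ × ℂ) : quadForm (pairMul A v) = quadForm v := by
  rw [← det_realMat, realMat_pairMul, Matrix.det_mul, A.det_coe, one_mul, det_realMat]

theorem toPair_injective : Function.Injective toPair := fun A B h => by
  ext i j
  rw [← realMat_toPair A, ← realMat_toPair B, h]

theorem toPair_mul (A B : SL(2, ℝ)) : toPair (A * B) = pairMul A (toPair B) := by
  rw [pairMul_apply]
  apply Prod.ext <;> apply Complex.ext <;>
    simp [toPair, Matrix.mul_apply, Fin.sum_univ_two] <;> ring

/-- The rotation matrix attached to a complex number of modulus `1`. -/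
def rotMat (c : Circle) : SL(2, ℝ) :=
  ⟨!![(c : ℂ).re, -(c : ℂ).im; (c : ℂ).im, (c : ℂ).re], by
    have := Circle.normSq_coe c
    rw [Complex.normSq_apply] at this
    rw [Matrix.det_fin_two]
    simpa using this⟩

@[simp] theorem coe_rotMat (c : Circle) : (rotMat c : Matrix (Fin 2) (Fin 2) ℝ) =
    !![(c : ℂ).re, -(c : ℂ).im; (c : ℂ).im, (c : ℂ).re] := rfl

/-- The rotation group, as the image of the circle. -/
def rot : Circle →* SL(2, ℝ) where
  toFun := rotMat
  map_one' := by apply SL2_ext <;> simp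
  map_mul' c d := by
    apply SL2_ext <;> simp [Matrix.mul_apply, Fin.sum_univ_two] <;> ring

@[simp] theorem coe_rot (c : Circle) : (rot c : Matrix (Fin 2) (Fin 2) ℝ) =
    !![(c : ℂ).re, -(c : ℂ).im; (c : ℂ).im, (c : ℂ).re] := rfl

theorem toPair_rot (c : Circle) : toPair (rot c) = ((c : ℂ), 0) := by
  apply Prod.ext <;> apply Complex.ext <;> simp [toPair]

theorem continuous_rot : Continuous rot := by
  refine Continuous.subtype_mk (continuous_matrix fun i j => ?_) _
  fin_cases i <;> fin_cases j <;> simp <;> fun_prop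

theorem exists_sq_eq_circle (u : Circle) : ∃ c : Circle, c * c = u :=
  ⟨Circle.exp (Complex.arg u / 2), by rw [← Circle.exp_add, add_halves, Circle.exp_arg]⟩

theorem exists_circle_mul_eq {z w : ℂ} (h : Complex.normSq z = Complex.normSq w) :
    ∃ u : Circle, u * w = z := by
  by_cases hw : w = 0
  · refine ⟨1, ?_⟩
    rw [hw, Complex.normSq_zero] at h
    rw [Complex.normSq_eq_zero.1 h, hw, mul_zero]
  · have hz : ‖z / w‖ = 1 := by
      rw [norm_div, div_eq_one_iff_eq (norm_ne_zero_iff.2 hw)]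
      rw [Complex.normSq_eq_norm_sq, Complex.normSq_eq_norm_sq] at h
      exact (sq_eq_sq₀ (norm_nonneg _) (norm_nonneg _)).1 h
    exact ⟨⟨z / w, by simpa [Submonoid.unitSphere] using hz⟩, div_mul_cancel₀ z hw⟩

/-- Matrices whose second coordinates have the same modulus differ by rotations on both sides. -/
theorem exists_rot_mul_mul_rot {A B : SL(2, ℝ)}
    (h : Complex.normSq (toPair A).2 = Complex.normSq (toPair B).2) :
    ∃ c c' : Circle, A = rot c * B * rot c' := by
  have h1 : Complex.normSq (toPair A).1 = Complex.normSq (toPair B).1 := by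
    have hA := quadForm_toPair A
    have hB := quadForm_toPair B
    rw [quadForm] at hA hB
    linarith
  obtain ⟨u, hu⟩ := exists_circle_mul_eq h1
  obtain ⟨w, hw⟩ := exists_circle_mul_eq h
  obtain ⟨c', hc'⟩ := exists_sq_eq_circle (u * w)
  -- the two phases are `c c' = u` and `c⁻¹ c' = w`
  refine ⟨u * c'⁻¹, c', toPair_injective ?_⟩
  have e1 : (u * c'⁻¹) * c' = u := by group
  have e2 : (u * c'⁻¹)⁻¹ * c' = w := by
    rw [mul_inv_rev, inv_inv, mul_assoc, mul_comm, mul_assoc, hc', inv_mul_cancel_left]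
  rw [mul_assoc, toPair_mul, toPair_mul, toPair_rot, pairMul_apply, pairMul_apply, toPair_rot]
  have e1' : ((u * c'⁻¹ : Circle) : ℂ) * (c' : ℂ) = u := by
    rw [← Circle.coe_mul, e1]
  have e2' : star ((u * c'⁻¹ : Circle) : ℂ) * (c' : ℂ) = w := by
    rw [Complex.star_def, ← Circle.coe_inv_eq_conj, ← Circle.coe_mul, e2]
  ext1
  · simp only [star_zero, zero_mul, mul_zero, add_zero]
    rw [← hu, ← e1']; ring
  · simp only [zero_mul, mul_zero, add_zero, zero_add]
    rw [← hw, ← e2']; ring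

/-! ### The radius of a group element -/

/-- `2 sinh (d(g p, p) / 2)`; for unipotent elements this is the absolute value of the parameter, if
`p = i`. -/
def radius (p : UpperHalfPlane) (g : PSL2R) : ℝ := 2 * Real.sinh (dist (g • p) p / 2)

theorem radius_nonneg (p : UpperHalfPlane) (g : PSL2R) : 0 ≤ radius p g :=
  mul_nonneg two_pos.le (Real.sinh_nonneg_iff.2 (by positivity))

theorem radius_I_sq (A : SL(2, ℝ)) : radius UpperHalfPlane.I (QuotientGroup.mk A) ^ 2 =
    4 * Complex.normSq (toPair A).2 := by
  have hdet : A 0 0 * A 1 1 - A 0 1 * A 1 0 = 1 := by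
    have := A.det_coe
    rwa [Matrix.det_fin_two] at this
  have hcd : 0 < A 1 0 ^ 2 + A 1 1 ^ 2 := by
    by_contra hc
    have h0 : A 1 0 = 0 := by nlinarith [sq_nonneg (A 1 0), sq_nonneg (A 1 1)]
    have h1 : A 1 1 = 0 := by nlinarith [sq_nonneg (A 1 0), sq_nonneg (A 1 1)]
    rw [h0, h1] at hdet
    simp at hdet
  have hz : ((A • UpperHalfPlane.I : UpperHalfPlane) : ℂ) =
      ⟨(A 0 1 * A 1 1 + A 0 0 * A 1 0) / (A 1 0 ^ 2 + A 1 1 ^ 2), 1 / (A 1 0 ^ 2 + A 1 1 ^ 2)⟩ := by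
    rw [UpperHalfPlane.coe_specialLinearGroup_apply, div_eq_iff]
    · apply Complex.ext
      · simp; field_simp; linear_combination (-A 1 0) * hdet
      · simp; field_simp; linear_combination (A 1 1) * hdet
    · intro h
      have h0 := congrArg Complex.re h
      have h1 := congrArg Complex.im h
      simp at h0 h1
      rw [h0, h1] at hcd
      simp at hcd
  have hre : (A • UpperHalfPlane.I : UpperHalfPlane).re =
      (A 0 1 * A 1 1 + A 0 0 * A 1 0) / (A 1 0 ^ 2 + A 1 1 ^ 2) := congrArg Complex.re hz
  have him : (A • UpperHalfPlane.I : UpperHalfPlane).im = 1 / (A 1 0 ^ 2 + A 1 1 ^ 2) :=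
    congrArg Complex.im hz
  have hcosh : radius UpperHalfPlane.I (QuotientGroup.mk A) ^ 2 =
      2 * (Real.cosh (dist (A • UpperHalfPlane.I) UpperHalfPlane.I) - 1) := by
    rw [radius, mk_smul]
    have h1 := Real.cosh_two_mul (dist (A • UpperHalfPlane.I) UpperHalfPlane.I / 2)
    have h2 := Real.cosh_sq (dist (A • UpperHalfPlane.I) UpperHalfPlane.I / 2)
    rw [mul_div_cancel₀ _ two_ne_zero] at h1
    rw [h1, h2]; ring
  rw [hcosh, UpperHalfPlane.cosh_dist', hre, him]
  simp [toPair, Complex.normSq_apply]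
  field_simp
  linear_combination (-4 * (1 + (A 0 0 * A 1 1 - A 0 1 * A 1 0) -
    2 * (A 1 0 ^ 2 + A 1 1 ^ 2))) * hdet

/-! ### Haar measure on `PSL₂(ℝ)` and the law of the radius -/

/-- The matrices of determinant in `(0, 1]`, in complex coordinates: the cone over `SL₂(ℝ)`. -/
def cone : Set (ℂ × ℂ) := {v | quadForm v ∈ Ioc 0 1}

theorem continuous_quadForm : Continuous quadForm := by
  unfold quadForm
  exact (Complex.continuous_normSq.comp continuous_fst).sub
    (Complex.continuous_normSq.comp continuous_snd)

theorem measurableSet_cone : MeasurableSet cone :=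
  continuous_quadForm.measurable measurableSet_Ioc

/-- The matrix `realMat v` of positive determinant, rescaled to determinant `1`. -/
def unitMat (v : ℂ × ℂ) (h : 0 < quadForm v) : SL(2, ℝ) :=
  ⟨(√(quadForm v))⁻¹ • realMat v, by
    rw [Matrix.det_smul, det_realMat, Fintype.card_fin, inv_pow, Real.sq_sqrt h.le,
      inv_mul_cancel₀ h.ne']⟩

/-- The radial projection of the cone onto `SL₂(ℝ)`, extended by the identity. -/
def coneProj (v : ℂ × ℂ) : SL(2, ℝ) := if h : 0 < quadForm v then unitMat v h else 1

theorem coe_coneProj {v : ℂ × ℂ} (h : 0 < quadForm v) :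
    (coneProj v : Matrix (Fin 2) (Fin 2) ℝ) = (√(quadForm v))⁻¹ • realMat v := by
  rw [coneProj, dif_pos h]
  rfl

theorem coneProj_pairMul (A : SL(2, ℝ)) {v : ℂ × ℂ} (h : 0 < quadForm v) :
    coneProj (pairMul A v) = A * coneProj v := by
  apply Subtype.ext
  rw [coe_coneProj (by rwa [quadForm_pairMul]), quadForm_pairMul, realMat_pairMul,
    Matrix.SpecialLinearGroup.coe_mul, coe_coneProj h, Matrix.mul_smul]

theorem continuousOn_coneProj : ContinuousOn coneProj cone := by
  have hi : Topology.IsInducing (fun A : SL(2, ℝ) => (A : Matrix (Fin 2) (Fin 2) ℝ)) :=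
    Matrix.SpecialLinearGroup.isClosedEmbedding_val.isInducing
  rw [hi.continuousOn_iff]
  have h1 : ContinuousOn (fun v => (√(quadForm v))⁻¹ • realMat v) cone := by
    have h2 : ContinuousOn (fun v => √(quadForm v)) cone :=
      (Real.continuous_sqrt.comp continuous_quadForm).continuousOn
    have h3 : Continuous realMat := by
      refine continuous_matrix fun i j => ?_
      fin_cases i <;> fin_cases j <;> simp [realMat] <;> fun_prop
    exact (h2.inv₀ fun v hv => (Real.sqrt_pos.2 hv.1).ne').smul h3.continuousOn
  exact h1.congr fun v hv => coe_coneProj hv.1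

/-- The image of Lebesgue measure on the cone over `SL₂(ℝ)`; it is a Haar measure. -/
def coneMeasure : Measure PSL2R :=
  (volume.restrict cone).map fun v => (QuotientGroup.mk (coneProj v) : PSL2R)

theorem aemeasurable_coneProj :
    AEMeasurable (fun v => (QuotientGroup.mk (coneProj v) : PSL2R)) (volume.restrict cone) :=
  (continuous_mk.comp_continuousOn continuousOn_coneProj).aemeasurable measurableSet_cone

theorem measurePreserving_pairMul (A : SL(2, ℝ)) :
    MeasurePreserving (pairMul A) (volume : Measure (ℂ × ℂ)) volume := by
  have hdet : LinearMap.det ((pairMul A).restrictScalars ℝ) = 1 := by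
    rw [LinearMap.det_restrictScalars, det_pairMul, map_one]
  have hm : Measurable (pairMul A) :=
    ((pairMul A).restrictScalars ℝ).continuous_of_finiteDimensional.measurable
  refine ⟨hm, ?_⟩
  have hvol : (volume : Measure (ℂ × ℂ)).IsAddHaarMeasure := by
    rw [Measure.volume_eq_prod]; infer_instance
  have := Measure.map_linearMap_addHaar_eq_smul_addHaar (volume : Measure (ℂ × ℂ))
    (f := (pairMul A).restrictScalars ℝ) (by rw [hdet]; exact one_ne_zero)
  rw [hdet] at this
  simpa using this

instance : coneMeasure.IsMulLeftInvariant := by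
  refine ⟨fun g => ?_⟩
  obtain ⟨A, rfl⟩ := QuotientGroup.mk_surjective g
  have hpre : pairMul A ⁻¹' cone = cone := by
    ext v; simp [cone, quadForm_pairMul]
  have hmp : MeasurePreserving (pairMul A) (volume.restrict cone) (volume.restrict cone) := by
    have := (measurePreserving_pairMul A).restrict_preimage measurableSet_cone
    rwa [hpre] at this
  rw [coneMeasure, AEMeasurable.map_map_of_aemeasurable (measurable_const_mul _).aemeasurable
    aemeasurable_coneProj]
  have h1 : ((fun x : PSL2R => QuotientGroup.mk A * x) ∘
      fun v => (QuotientGroup.mk (coneProj v) : PSL2R)) =ᵐ[volume.restrict cone]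
      ((fun v => (QuotientGroup.mk (coneProj v) : PSL2R)) ∘ pairMul A) := by
    filter_upwards [ae_restrict_mem measurableSet_cone] with v hv
    simp only [Function.comp_apply]
    rw [coneProj_pairMul A hv.1, QuotientGroup.mk_mul]
  rw [Measure.map_congr h1, ← AEMeasurable.map_map_of_aemeasurable _ hmp.measurable.aemeasurable,
    hmp.map_eq]
  rw [hmp.map_eq]
  exact aemeasurable_coneProj

theorem radius_coneProj_le_iff {v : ℂ × ℂ} (h : 0 < quadForm v) {S : ℝ} (hS : 0 ≤ S) :
    radius UpperHalfPlane.I (QuotientGroup.mk (coneProj v)) ≤ S ↔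
      4 * Complex.normSq v.2 ≤ S ^ 2 * quadForm v := by
  have h1 : (toPair (coneProj v)).2 = ((√(quadForm v))⁻¹ : ℝ) * v.2 := by
    apply Complex.ext <;> simp [toPair, coe_coneProj h, realMat] <;> ring
  rw [← sq_le_sq₀ (radius_nonneg _ _) hS, radius_I_sq, h1, Complex.normSq_mul,
    Complex.normSq_ofReal, ← mul_inv, Real.mul_self_sqrt h.le]
  field_simp

theorem continuous_smul_mk (p : UpperHalfPlane) : Continuous fun g : PSL2R => g • p :=
  (QuotientGroup.isQuotientMap_mk _).continuous_iff.2
    (continuous_id.smul continuous_const : Continuous fun A : SL(2, ℝ) => A • p)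

theorem continuous_radius (p : UpperHalfPlane) : Continuous (radius p) := by
  unfold radius
  exact continuous_const.mul (Real.continuous_sinh.comp
    (((continuous_smul_mk p).dist continuous_const).div_const 2))

/-- The area of the annulus `q + 4 q / S² ≤ |z|² ≤ 1 + q` for `q = |w|²`, as a function of
`w / S`. -/
def annulusArea (w : ℂ) : ℝ≥0∞ := ENNReal.ofReal (1 - 4 * ‖w‖ ^ 2) * NNReal.pi

theorem volume_annulus {q t : ℝ} (hq : 0 ≤ q) (ht : 0 ≤ t) :
    volume {z : ℂ | q + t ≤ ‖z‖ ^ 2 ∧ ‖z‖ ^ 2 ≤ 1 + q} = ENNReal.ofReal (1 - t) * NNReal.pi := by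
  have e : {z : ℂ | q + t ≤ ‖z‖ ^ 2 ∧ ‖z‖ ^ 2 ≤ 1 + q} =
      Metric.closedBall 0 (√(1 + q)) \ Metric.ball 0 (√(q + t)) := by
    ext z
    simp only [mem_ofPred_eq, Set.mem_sdiff, mem_closedBall_zero_iff, mem_ball_zero_iff, not_lt]
    rw [Real.sqrt_le_left (norm_nonneg _), Real.le_sqrt (norm_nonneg _) (by linarith), and_comm]
  rw [e]
  rcases le_or_gt t 1 with h | h
  · rw [measure_sdiff (Metric.ball_subset_closedBall.trans
      (Metric.closedBall_subset_closedBall (Real.sqrt_le_sqrt (by linarith))))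
      Metric.isOpen_ball.measurableSet.nullMeasurableSet measure_ball_lt_top.ne,
      Complex.volume_closedBall, Complex.volume_ball, ← ENNReal.ofReal_pow (Real.sqrt_nonneg _),
      ← ENNReal.ofReal_pow (Real.sqrt_nonneg _), Real.sq_sqrt (by linarith),
      Real.sq_sqrt (by linarith), ← ENNReal.sub_mul (by simp),
      ← ENNReal.ofReal_sub _ (by linarith)]
    congr 2; ring
  · rw [ENNReal.ofReal_of_nonpos (by linarith), zero_mul, sdiff_eq_empty.2, measure_empty]
    intro z hz
    rw [mem_closedBall_zero_iff] at hz
    rw [mem_ball_zero_iff]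
    exact hz.trans_lt (Real.sqrt_lt_sqrt (by linarith) (by linarith))

/-- The normalizing constant of `coneMeasure`. -/
def coneConst : ℝ≥0∞ := ∫⁻ w, annulusArea w

theorem measurable_annulusArea : Measurable annulusArea := by
  unfold annulusArea; fun_prop

theorem coneConst_ne_zero : coneConst ≠ 0 := by
  rw [coneConst, ← pos_iff_ne_zero, lintegral_pos_iff_support measurable_annulusArea]
  refine lt_of_lt_of_le (Metric.measure_ball_pos volume (0 : ℂ) (r := 1 / 4) (by norm_num))
    (measure_mono fun w hw => ?_)
  rw [mem_ball_zero_iff] at hw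
  have : 0 < 1 - 4 * ‖w‖ ^ 2 := by nlinarith [norm_nonneg w]
  simp only [annulusArea, Function.mem_support, ne_eq, mul_eq_zero, ENNReal.ofReal_eq_zero, not_or,
    not_le]
  exact ⟨this, by simp [NNReal.pi_pos.ne']⟩

theorem coneConst_ne_top : coneConst ≠ ∞ := by
  refine ne_of_lt (lt_of_le_of_lt (b := ∫⁻ w : ℂ in Metric.closedBall 0 1, NNReal.pi) ?_ ?_)
  · rw [coneConst, ← lintegral_indicator Metric.isClosed_closedBall.measurableSet]
    refine lintegral_mono fun w => ?_
    by_cases hw : w ∈ Metric.closedBall (0 : ℂ) 1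
    · rw [Set.indicator_of_mem hw, annulusArea]
      refine mul_le_of_le_one_left zero_le (ENNReal.ofReal_le_one.2 ?_)
      nlinarith [norm_nonneg w]
    · rw [mem_closedBall_zero_iff, not_le] at hw
      rw [annulusArea, ENNReal.ofReal_of_nonpos (by nlinarith), zero_mul]
      exact zero_le
  · rw [setLIntegral_const]
    exact ENNReal.mul_lt_top (by simp) measure_closedBall_lt_top

theorem coneMeasure_radius_le {S : ℝ} (hS : 0 < S) :
    coneMeasure {g | radius UpperHalfPlane.I g ≤ S} = coneConst * ENNReal.ofReal (S ^ 2) := by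
  have hms : MeasurableSet {g : PSL2R | radius UpperHalfPlane.I g ≤ S} :=
    (continuous_radius _).measurable measurableSet_Iic
  rw [coneMeasure, Measure.map_apply_of_aemeasurable aemeasurable_coneProj hms,
    Measure.restrict_apply₀' measurableSet_cone.nullMeasurableSet]
  have e1 : (fun v => (QuotientGroup.mk (coneProj v) : PSL2R)) ⁻¹'
      {g | radius UpperHalfPlane.I g ≤ S} ∩ cone =
      {v | 0 < quadForm v ∧ quadForm v ≤ 1 ∧ 4 * Complex.normSq v.2 ≤ S ^ 2 * quadForm v} := by
    ext v
    simp only [mem_inter_iff, mem_preimage, mem_ofPred_eq, cone, mem_Ioc]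
    constructor
    · rintro ⟨h1, h2, h3⟩
      exact ⟨h2, h3, (radius_coneProj_le_iff h2 hS.le).1 h1⟩
    · rintro ⟨h1, h2, h3⟩
      exact ⟨(radius_coneProj_le_iff h1 hS.le).2 h3, h1, h2⟩
  have hme : MeasurableSet
      {v | 0 < quadForm v ∧ quadForm v ≤ 1 ∧ 4 * Complex.normSq v.2 ≤ S ^ 2 * quadForm v} := by
    have h1 := continuous_quadForm.measurable
    have h2 : Measurable fun v : ℂ × ℂ => Complex.normSq v.2 :=
      (Complex.continuous_normSq.comp continuous_snd).measurable
    exact (measurableSet_lt measurable_const h1).inter ((measurableSet_le h1 measurable_const).inter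
      (measurableSet_le (h2.const_mul 4) (h1.const_mul _)))
  rw [e1, Measure.volume_eq_prod, Measure.prod_apply_symm hme]
  have e2 : ∀ᵐ w : ℂ, volume ((fun z : ℂ => (z, w)) ⁻¹'
      {v | 0 < quadForm v ∧ quadForm v ≤ 1 ∧ 4 * Complex.normSq v.2 ≤ S ^ 2 * quadForm v}) =
      annulusArea (S⁻¹ • w) := by
    have h0 : ∀ᵐ w : ℂ, w ≠ 0 := by
      rw [ae_iff]
      simp
    filter_upwards [h0] with w hw
    have hq : 0 < ‖w‖ ^ 2 := by positivity
    have e3 : (fun z : ℂ => (z, w)) ⁻¹'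
        {v | 0 < quadForm v ∧ quadForm v ≤ 1 ∧ 4 * Complex.normSq v.2 ≤ S ^ 2 * quadForm v} =
        {z : ℂ | ‖w‖ ^ 2 + 4 * ‖w‖ ^ 2 / S ^ 2 ≤ ‖z‖ ^ 2 ∧ ‖z‖ ^ 2 ≤ 1 + ‖w‖ ^ 2} := by
      ext z
      simp only [mem_preimage, mem_ofPred_eq, quadForm, Complex.normSq_eq_norm_sq]
      have h4 : 0 < 4 * ‖w‖ ^ 2 / S ^ 2 := by positivity
      have h5 : 4 * ‖w‖ ^ 2 ≤ S ^ 2 * (‖z‖ ^ 2 - ‖w‖ ^ 2) ↔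
          4 * ‖w‖ ^ 2 / S ^ 2 ≤ ‖z‖ ^ 2 - ‖w‖ ^ 2 := by
        rw [div_le_iff₀ (by positivity), mul_comm (S ^ 2)]
      rw [h5]
      constructor
      · rintro ⟨h1, h2, h3⟩; constructor <;> linarith
      · rintro ⟨h1, h2⟩; refine ⟨?_, ?_, ?_⟩ <;> linarith
    rw [e3, volume_annulus hq.le (by positivity), annulusArea, norm_smul, norm_inv,
      Real.norm_of_nonneg hS.le]
    congr 3
    field_simp
  rw [lintegral_congr_ae e2, coneConst]
  have e4 := Measure.map_addHaar_smul (volume : Measure ℂ) (r := S⁻¹) (inv_ne_zero hS.ne')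
  rw [← lintegral_map measurable_annulusArea (measurable_const_smul S⁻¹), e4, 
    lintegral_smul_measure, Complex.finrank_real_complex, smul_eq_mul, mul_comm]
  congr 2
  rw [inv_pow, inv_inv, abs_of_pos (by positivity)]

/-- The measure on `ℝ` with density `2 s` on `[0, ∞)`; up to a constant, it is the law of the radius
under Haar measure. -/
def radialLaw : Measure ℝ := volume.withDensity fun s => ENNReal.ofReal (2 * s)

theorem radialLaw_Ioc {a b : ℝ} (ha : 0 ≤ a) (hab : a ≤ b) :
    radialLaw (Ioc a b) = ENNReal.ofReal (b ^ 2 - a ^ 2) := by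
  rw [radialLaw, withDensity_apply _ measurableSet_Ioc, ← ofReal_integral_eq_lintegral_ofReal,
    ← intervalIntegral.integral_of_le hab]
  · rw [intervalIntegral.integral_const_mul, integral_id]
    congr 1; ring
  · exact (Continuous.integrableOn_Icc (by fun_prop)).mono_set Ioc_subset_Icc_self
  · filter_upwards [ae_restrict_mem measurableSet_Ioc] with s hs
    have : 0 ≤ s := ha.trans hs.1.le
    simpa using this

theorem radialLaw_Iic (S : ℝ) : radialLaw (Iic S) = ENNReal.ofReal (max S 0 ^ 2) := by
  have h0 : radialLaw (Iic 0) = 0 := by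
    rw [radialLaw, withDensity_apply _ measurableSet_Iic, setLIntegral_congr_fun measurableSet_Iic
      (g := fun _ => 0)]
    · simp
    · intro s (hs : s ≤ 0)
      exact ENNReal.ofReal_of_nonpos (by linarith)
  rcases le_or_gt S 0 with hS | hS
  · rw [max_eq_right hS, measure_mono_null (Iic_subset_Iic.2 hS) h0]
    simp
  · rw [max_eq_left hS.le, ← Iic_union_Ioc_eq_Iic hS.le, measure_union _ measurableSet_Ioc, h0,
      radialLaw_Ioc le_rfl hS.le]
    · simp
    · rw [Set.disjoint_iff]
      rintro s ⟨h1, h2⟩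
      exact absurd h2.1 (not_lt.2 h1)

theorem map_radius_coneMeasure :
    coneMeasure.map (radius UpperHalfPlane.I) = coneConst • radialLaw := by
  have hr : Measurable (radius UpperHalfPlane.I) := (continuous_radius _).measurable
  have hIic (S : ℝ) : coneMeasure.map (radius UpperHalfPlane.I) (Iic S) =
      coneConst * radialLaw (Iic S) := by
    rw [Measure.map_apply hr measurableSet_Iic, radialLaw_Iic]
    rcases lt_or_ge 0 S with hS | hS
    · rw [max_eq_left hS.le]
      exact coneMeasure_radius_le hS
    · rw [max_eq_right hS]
      simp only [ne_eq, OfNat.ofNat_ne_zero, not_false_eq_true, zero_pow, ENNReal.ofReal_zero,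
        mul_zero]
      have hlim : Tendsto (fun t : ℝ => coneConst * ENNReal.ofReal (t ^ 2)) (𝓝[>] 0)
          (𝓝 (coneConst * ENNReal.ofReal (0 ^ 2))) := by
        refine ENNReal.Tendsto.const_mul ?_ (Or.inr coneConst_ne_top)
        exact (ENNReal.continuous_ofReal.comp (continuous_pow 2)).continuousAt.mono_left
          nhdsWithin_le_nhds
      simp only [ne_eq, OfNat.ofNat_ne_zero, not_false_eq_true, zero_pow, ENNReal.ofReal_zero,
        mul_zero] at hlim
      refine le_antisymm (ge_of_tendsto hlim ?_) zero_le
      filter_upwards [self_mem_nhdsWithin] with t (ht : 0 < t)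
      rw [← coneMeasure_radius_le ht]
      exact measure_mono fun g (hg : _ ≤ S) => hg.trans (hS.trans ht.le)
  have hfin (S : ℝ) : coneConst * radialLaw (Iic S) ≠ ∞ := by
    rw [radialLaw_Iic]
    exact ENNReal.mul_ne_top coneConst_ne_top (by simp)
  have hloc : IsLocallyFiniteMeasure (coneMeasure.map (radius UpperHalfPlane.I)) := by
    refine ⟨fun x => ⟨Iic (x + 1), Iic_mem_nhds (by linarith), ?_⟩⟩
    rw [hIic]
    exact (hfin _).lt_top
  refine Measure.ext_of_Ioc _ _ fun {a b} hab => ?_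
  rw [← Iic_sdiff_Iic, measure_sdiff (Iic_subset_Iic.2 hab.le) measurableSet_Iic.nullMeasurableSet
    (by rw [hIic]; exact hfin _), measure_sdiff (Iic_subset_Iic.2 hab.le)
    measurableSet_Iic.nullMeasurableSet (by exact hfin _), hIic, hIic]
  rfl

theorem radius_le_lt_top (S : ℝ) : coneMeasure {g | radius UpperHalfPlane.I g ≤ S} < ∞ := by
  have h := congrArg (fun ν : Measure ℝ => ν (Iic S)) map_radius_coneMeasure
  rw [Measure.map_apply (continuous_radius _).measurable measurableSet_Iic] at h
  change coneMeasure (radius UpperHalfPlane.I ⁻¹' Iic S) < ∞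
  rw [h, Measure.smul_apply, radialLaw_Iic, smul_eq_mul]
  exact ENNReal.mul_lt_top coneConst_ne_top.lt_top (by simp)

instance : IsFiniteMeasureOnCompacts coneMeasure := by
  refine ⟨fun K hK => ?_⟩
  obtain ⟨S, hS⟩ := (hK.image (continuous_radius UpperHalfPlane.I)).bddAbove
  refine lt_of_le_of_lt (measure_mono fun g hg => ?_) (radius_le_lt_top S)
  exact hS (mem_image_of_mem _ hg)

theorem exists_haar_eq_smul (ν : Measure PSL2R) [ν.IsHaarMeasure] :
    ∃ c : ℝ≥0, c ≠ 0 ∧ ν = c • (Measure.haar : Measure PSL2R) :=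
  ⟨_, (Measure.haarScalarFactor_pos_of_isHaarMeasure ν Measure.haar).ne',
    Measure.isMulLeftInvariant_eq_smul ν Measure.haar⟩

/-- The law of the radius under Haar measure has density proportional to the radius. -/
theorem exists_map_radius_I_haar : ∃ c : ℝ≥0∞, c ≠ 0 ∧ c ≠ ∞ ∧
    (Measure.haar : Measure PSL2R).map (radius UpperHalfPlane.I) = c • radialLaw := by
  have h := Measure.isMulLeftInvariant_eq_smul coneMeasure (Measure.haar : Measure PSL2R)
  set k : ℝ≥0 := Measure.haarScalarFactor coneMeasure (Measure.haar : Measure PSL2R) with hk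
  have hlaw := map_radius_coneMeasure
  have hk0 : k ≠ 0 := by
    intro h0
    rw [h, h0, zero_smul, Measure.map_zero] at hlaw
    have h1 := congrArg (fun ν : Measure ℝ => ν (Iic 1)) hlaw
    simp [radialLaw_Iic] at h1
    exact coneConst_ne_zero h1.symm
  have hk0' : (k : ℝ≥0∞) ≠ 0 := by exact_mod_cast hk0
  refine ⟨(k : ℝ≥0∞)⁻¹ * coneConst, mul_ne_zero (by simp) coneConst_ne_zero,
    ENNReal.mul_ne_top (by simpa using hk0) coneConst_ne_top, ?_⟩
  rw [mul_smul, ← hlaw, h]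
  change _ = (k : ℝ≥0∞)⁻¹ • ((k : ℝ≥0∞) • Measure.haar).map _
  rw [Measure.map_smul, smul_smul,
    ENNReal.inv_mul_cancel hk0' (by simp), one_smul]

/-! ### Bi-invariance and the polar decomposition of shell averages -/

theorem dist_smul_smul (g : PSL2R) (z w : UpperHalfPlane) : dist (g • z) (g • w) = dist z w := by
  obtain ⟨A, rfl⟩ := QuotientGroup.mk_surjective g
  exact dist_smul A z w

/-- Haar measure on `PSL₂(ℝ)`, restricted to the set of elements with radius in `[a, b]` and
normalized. -/
def shell (p : UpperHalfPlane) (a b : ℝ) : Measure PSL2R :=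
  ProbabilityTheory.cond Measure.haar (radius p ⁻¹' Icc a b)

/-- The conjugate of the rotation group that fixes `p`. -/
def stabRot (p : UpperHalfPlane) (c : Circle) : PSL2R :=
  QuotientGroup.mk (p.toSL2R * rot c * p.toSL2R⁻¹)

/-- The unipotent subgroup conjugated so that its elements have radius the absolute value of the
parameter at `p`. -/
def unipAt (p : UpperHalfPlane) (x : ℝ) : PSL2R := unip p.toSL2R x

theorem stabRot_mul (p : UpperHalfPlane) (c d : Circle) :
    stabRot p (c * d) = stabRot p c * stabRot p d := by
  rw [stabRot, stabRot, stabRot, ← QuotientGroup.mk_mul, map_mul]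
  congr 1
  group

theorem continuous_stabRot (p : UpperHalfPlane) : Continuous (stabRot p) :=
  continuous_mk.comp ((continuous_const.mul continuous_rot).mul continuous_const)

theorem radius_mk_conj (p : UpperHalfPlane) (A : SL(2, ℝ)) :
    radius p (QuotientGroup.mk (p.toSL2R * A * p.toSL2R⁻¹)) =
      radius UpperHalfPlane.I (QuotientGroup.mk A) := by
  have h : p.toSL2R⁻¹ • p = UpperHalfPlane.I := by
    rw [inv_smul_eq_iff, UpperHalfPlane.toSL2R_smul_I]
  have e : (p.toSL2R * A * p.toSL2R⁻¹) • p = p.toSL2R • (A • UpperHalfPlane.I) := by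
    rw [mul_smul, mul_smul, h]
  rw [radius, radius, mk_smul, mk_smul, e]
  conv_lhs => rw [← UpperHalfPlane.toSL2R_smul_I p]
  rw [UpperHalfPlane.toSL2R_smul_I, ← dist_smul p.toSL2R (A • UpperHalfPlane.I),
    UpperHalfPlane.toSL2R_smul_I]

theorem stabRot_smul (p : UpperHalfPlane) (c : Circle) : stabRot p c • p = p := by
  have h : radius p (stabRot p c) = 0 := by
    rw [← sq_eq_zero_iff, stabRot, radius_mk_conj, radius_I_sq, toPair_rot]
    simp
  rw [radius, mul_eq_zero, Real.sinh_eq_zero] at h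
  refine dist_eq_zero.1 ?_
  rcases h with h | h
  · norm_num at h
  · linarith

theorem radius_stabRot_mul (p : UpperHalfPlane) (c : Circle) (g : PSL2R) :
    radius p (stabRot p c * g) = radius p g := by
  rw [radius, radius, mul_smul]
  conv_lhs => rw [← stabRot_smul p c]
  rw [stabRot_smul]
  conv_lhs => enter [2, 1, 1, 2]; rw [← stabRot_smul p c]
  rw [dist_smul_smul]

theorem radius_mul_stabRot (p : UpperHalfPlane) (c : Circle) (g : PSL2R) :
    radius p (g * stabRot p c) = radius p g := by
  rw [radius, radius, mul_smul, stabRot_smul]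

/-- The polar decomposition: every element is a unipotent element up to rotations about `p`. -/
theorem exists_eq_stabRot_mul_unipAt_mul (p : UpperHalfPlane) (g : PSL2R) :
    ∃ c c' : Circle, g = stabRot p c * unipAt p (radius p g) * stabRot p c' := by
  obtain ⟨A, rfl⟩ := QuotientGroup.mk_surjective g
  obtain ⟨B, rfl⟩ : ∃ B, A = p.toSL2R * B * p.toSL2R⁻¹ := ⟨p.toSL2R⁻¹ * A * p.toSL2R, by group⟩
  have hB := radius_I_sq B
  rw [radius_mk_conj]
  set s := radius UpperHalfPlane.I (QuotientGroup.mk B) with hs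
  obtain ⟨c, c', h⟩ := exists_rot_mul_mul_rot (A := B) (B := upperUnip s) (by
    have : Complex.normSq (toPair (upperUnip s)).2 = s ^ 2 / 4 := by
      simp [toPair, Complex.normSq_apply]; ring
    rw [this, hB]; ring)
  refine ⟨c, c', ?_⟩
  rw [stabRot, stabRot, unipAt, unip, ← QuotientGroup.mk_mul, ← QuotientGroup.mk_mul]
  congr 1
  conv_lhs => rw [h]
  group

theorem cond_smul_measure {Ω : Type*} [MeasurableSpace Ω] (μ : Measure Ω) {c : ℝ≥0∞} (hc : c ≠ 0)
    (hc' : c ≠ ∞) (s : Set Ω) : ProbabilityTheory.cond (c • μ) s = ProbabilityTheory.cond μ s := by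
  rw [ProbabilityTheory.cond, ProbabilityTheory.cond, Measure.restrict_smul, smul_smul,
    Measure.smul_apply, smul_eq_mul, ENNReal.mul_inv (Or.inl hc) (Or.inl hc'), mul_assoc,
    mul_comm _ c, ← mul_assoc, ENNReal.inv_mul_cancel hc hc', one_mul]

theorem map_cond {Ω Ω' : Type*} [MeasurableSpace Ω] [MeasurableSpace Ω'] (μ : Measure Ω)
    {f : Ω → Ω'} (hf : Measurable f) {s : Set Ω'} (hs : MeasurableSet s) :
    (ProbabilityTheory.cond μ (f ⁻¹' s)).map f = ProbabilityTheory.cond (μ.map f) s := by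
  rw [ProbabilityTheory.cond, ProbabilityTheory.cond, Measure.map_smul, Measure.map_apply hf hs,
    Measure.restrict_map hf hs]

/-- Conjugation by an element that moves `i` to `p` takes Haar measure to a multiple of itself, so
the law of the radius at `p` is that of the radius at `i`. -/
theorem exists_map_radius_haar (p : UpperHalfPlane) : ∃ c : ℝ≥0∞, c ≠ 0 ∧ c ≠ ∞ ∧
    (Measure.haar : Measure PSL2R).map (radius p) = c • radialLaw := by
  set h : PSL2R := QuotientGroup.mk p.toSL2R with hh
  have hconj : Continuous (MulAut.conj h⁻¹ : PSL2R ≃* PSL2R) := by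
    exact (continuous_const.mul continuous_id).mul continuous_const
  have hconj' : Continuous (MulAut.conj h⁻¹ : PSL2R ≃* PSL2R).symm := by
    exact (continuous_const.mul continuous_id).mul continuous_const
  have hHaar := MulEquiv.isHaarMeasure_map (Measure.haar : Measure PSL2R)
    (MulAut.conj h⁻¹ : PSL2R ≃* PSL2R) hconj hconj'
  obtain ⟨k, hk, hk'⟩ := exists_haar_eq_smul
    ((Measure.haar : Measure PSL2R).map (MulAut.conj h⁻¹ : PSL2R ≃* PSL2R))
  obtain ⟨c, hc, hc', hlaw⟩ := exists_map_radius_I_haar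
  have e : radius p = radius UpperHalfPlane.I ∘ (MulAut.conj h⁻¹ : PSL2R ≃* PSL2R) := by
    funext g
    obtain ⟨A, rfl⟩ := QuotientGroup.mk_surjective g
    obtain ⟨B, rfl⟩ : ∃ B, A = p.toSL2R * B * p.toSL2R⁻¹ := ⟨p.toSL2R⁻¹ * A * p.toSL2R, by group⟩
    rw [radius_mk_conj, Function.comp_apply, MulAut.conj_apply, inv_inv, hh, ← QuotientGroup.mk_inv,
      ← QuotientGroup.mk_mul, ← QuotientGroup.mk_mul]
    congr 2
    group
  refine ⟨k * c, mul_ne_zero (by exact_mod_cast hk) hc, ENNReal.mul_ne_top (by simp) hc', ?_⟩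
  rw [e, ← Measure.map_map (continuous_radius _).measurable hconj.measurable, hk']
  change ((k : ℝ≥0∞) • (Measure.haar : Measure PSL2R)).map _ = _
  rw [Measure.map_smul, hlaw, smul_smul]

theorem cond_radialLaw {a b : ℝ} (ha : 0 ≤ a) (hab : a < b) :
    ProbabilityTheory.cond radialLaw (Icc a b) = linearWeight a b := by
  have h1 : 0 < b ^ 2 - a ^ 2 := by nlinarith
  have hac : radialLaw ≪ volume := withDensity_absolutelyContinuous _ _
  have hae : Icc a b =ᵐ[radialLaw] Ioc a b := hac.ae_le Ioc_ae_eq_Icc.symm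
  rw [ProbabilityTheory.cond, measure_congr hae, Measure.restrict_congr_set hae,
    radialLaw_Ioc ha hab.le, radialLaw, restrict_withDensity measurableSet_Ioc, linearWeight,
    ← withDensity_smul _ (by fun_prop)]
  congr 1
  funext s
  rw [Pi.smul_apply, smul_eq_mul, ← ENNReal.ofReal_inv_of_pos h1,
    ← ENNReal.ofReal_mul (inv_nonneg.2 h1.le)]
  congr 1
  ring

theorem map_radius_shell (p : UpperHalfPlane) {a b : ℝ} (ha : 0 ≤ a) (hab : a < b) :
    (shell p a b).map (radius p) = linearWeight a b := by
  obtain ⟨c, hc, hc', h⟩ := exists_map_radius_haar p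
  rw [shell, map_cond _ (continuous_radius p).measurable measurableSet_Icc, h,
    cond_smul_measure _ hc hc', cond_radialLaw ha hab]

theorem isProbabilityMeasure_shell (p : UpperHalfPlane) {a b : ℝ} (ha : 0 ≤ a) (hab : a < b) :
    IsProbabilityMeasure (shell p a b) := by
  refine ⟨?_⟩
  have h := congrArg (fun ν : Measure ℝ => ν univ) (map_radius_shell p ha hab)
  simpa [Measure.map_apply (continuous_radius p).measurable, linearWeight_univ ha hab] using h

theorem shell_map_mul_left (p : UpperHalfPlane) (a b : ℝ) (c : Circle) :
    (shell p a b).map (fun g => stabRot p c * g) = shell p a b := by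
  have hm : Measurable fun g : PSL2R => stabRot p c * g := measurable_const_mul _
  have e : radius p ⁻¹' Icc a b = (fun g => stabRot p c * g) ⁻¹' (radius p ⁻¹' Icc a b) := by
    ext g; simp only [mem_preimage, radius_stabRot_mul]
  conv_lhs => rw [shell, e]
  rw [map_cond _ hm ((continuous_radius p).measurable measurableSet_Icc), map_mul_left_eq_self,
    shell]

/-- A right translate of the left Haar measure is a multiple of it, and normalization removes the
factor. -/
theorem shell_map_mul_right (p : UpperHalfPlane) (a b : ℝ) (c : Circle) :
    (shell p a b).map (fun g => g * stabRot p c) = shell p a b := by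
  have hm : Measurable fun g : PSL2R => g * stabRot p c := measurable_mul_const _
  have e : radius p ⁻¹' Icc a b = (fun g => g * stabRot p c) ⁻¹' (radius p ⁻¹' Icc a b) := by
    ext g; simp only [mem_preimage, radius_mul_stabRot]
  have hHaar : ((Measure.haar : Measure PSL2R).map fun g => g * stabRot p c).IsHaarMeasure :=
    inferInstance
  obtain ⟨k, hk, hk'⟩ := exists_haar_eq_smul
    ((Measure.haar : Measure PSL2R).map fun g => g * stabRot p c)
  conv_lhs => rw [shell, e]
  rw [map_cond _ hm ((continuous_radius p).measurable measurableSet_Icc), hk']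
  exact cond_smul_measure _ (c := (k : ℝ≥0∞)) (by exact_mod_cast hk) (by simp) _

instance : MeasurableSpace Circle := borel Circle

instance : BorelSpace Circle := ⟨rfl⟩

/-- Normalized Haar measure on the circle. -/
def circleHaar : Measure Circle := Measure.haarMeasure ⊤

instance : circleHaar.IsHaarMeasure := by unfold circleHaar; infer_instance

instance : IsProbabilityMeasure circleHaar := ⟨by
  have := Measure.haarMeasure_self (K₀ := (⊤ : TopologicalSpace.PositiveCompacts Circle))
  simpa [circleHaar] using this⟩

theorem measurable_stabRot_mul_unipAt_mul (p : UpperHalfPlane) :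
    Measurable fun q : Circle × ℝ × Circle =>
      stabRot p q.1 * unipAt p q.2.1 * stabRot p q.2.2 := by
  have h1 := continuous_stabRot p
  have h2 : Continuous (unipAt p) := continuous_unip _
  exact (((h1.comp continuous_fst).mul (h2.comp continuous_snd.fst)).mul
    (h1.comp continuous_snd.snd)).measurable

/-- The shell measure in polar coordinates: a unipotent element with linearly distributed parameter
between two independent uniformly distributed rotations. -/
theorem shell_eq_map (p : UpperHalfPlane) {a b : ℝ} (ha : 0 ≤ a) (hab : a < b) :
    shell p a b = (circleHaar.prod ((linearWeight a b).prod circleHaar)).map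
      fun q => stabRot p q.1 * unipAt p q.2.1 * stabRot p q.2.2 := by
  have hprob := isProbabilityMeasure_shell p ha hab
  have hprob' := isProbabilityMeasure_linearWeight ha hab
  have hk : Measurable (stabRot p) := (continuous_stabRot p).measurable
  have hn : Measurable (unipAt p) := (continuous_unip _).measurable
  refine Measure.ext_of_lintegral _ fun F hF => ?_
  rw [lintegral_map hF (measurable_stabRot_mul_unipAt_mul p)]
  have hm0 : Measurable fun q : Circle × ℝ × Circle =>
      F (stabRot p q.1 * unipAt p q.2.1 * stabRot p q.2.2) :=
    hF.comp (measurable_stabRot_mul_unipAt_mul p)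
  -- the bi-invariant mean of `F`
  set FK : PSL2R → ℝ≥0∞ := fun g =>
    ∫⁻ c, ∫⁻ d, F (stabRot p c * g * stabRot p d) ∂circleHaar ∂circleHaar with hFK
  have hm1 : Measurable fun q : (PSL2R × Circle) × Circle =>
      F (stabRot p q.1.2 * q.1.1 * stabRot p q.2) :=
    hF.comp (((hk.comp measurable_fst.snd).mul measurable_fst.fst).mul (hk.comp measurable_snd))
  have hm2 : Measurable fun q : PSL2R × Circle =>
      ∫⁻ d, F (stabRot p q.2 * q.1 * stabRot p d) ∂circleHaar := hm1.lintegral_prod_right'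
  have hFKm : Measurable FK := hm2.lintegral_prod_right'
  have hbi (c d : Circle) (g : PSL2R) : FK (stabRot p c * g * stabRot p d) = FK g := by
    have h1 (c' : Circle) : ∫⁻ d', F (stabRot p c' * (stabRot p c * g * stabRot p d) *
        stabRot p d') ∂circleHaar =
        ∫⁻ d', F (stabRot p (c' * c) * g * stabRot p d') ∂circleHaar := by
      conv_rhs => rw [← lintegral_mul_left_eq_self _ d]
      simp_rw [stabRot_mul, mul_assoc]
    simp only [hFK, h1]
    exact lintegral_mul_right_eq_self
      (fun c' => ∫⁻ d', F (stabRot p c' * g * stabRot p d') ∂circleHaar) c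
  have hpolar (g : PSL2R) : FK g = FK (unipAt p (radius p g)) := by
    obtain ⟨c, c', h⟩ := exists_eq_stabRot_mul_unipAt_mul p g
    conv_lhs => rw [h]
    exact hbi c c' _
  have htrans (c d : Circle) : ∫⁻ g, F (stabRot p c * g * stabRot p d) ∂(shell p a b) =
      ∫⁻ g, F g ∂(shell p a b) := by
    conv_rhs => rw [← shell_map_mul_right p a b d, ← shell_map_mul_left p a b c]
    rw [Measure.map_map (measurable_mul_const _) (measurable_const_mul _),
      lintegral_map hF ((measurable_mul_const _).comp (measurable_const_mul _))]
    rfl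
  have hstart : ∫⁻ g, F g ∂(shell p a b) = ∫⁻ g, FK g ∂(shell p a b) := by
    rw [hFK, lintegral_lintegral_swap hm2.aemeasurable]
    have h1 (c : Circle) : ∫⁻ g, ∫⁻ d, F (stabRot p c * g * stabRot p d) ∂circleHaar
        ∂(shell p a b) = ∫⁻ g, F g ∂(shell p a b) := by
      rw [lintegral_lintegral_swap]
      · simp [htrans]
      · exact (hF.comp ((measurable_fst.const_mul _).mul (hk.comp measurable_snd))).aemeasurable
    simp [h1]
  rw [hstart]
  have hlaw : ∫⁻ g, FK g ∂(shell p a b) = ∫⁻ s, FK (unipAt p s) ∂(linearWeight a b) := by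
    have hm3 : Measurable fun s => FK (unipAt p s) := hFKm.comp hn
    rw [← map_radius_shell p ha hab, lintegral_map hm3 (continuous_radius p).measurable]
    exact lintegral_congr hpolar
  rw [hlaw, lintegral_prod _ hm0.aemeasurable]
  have h2 (c : Circle) : ∫⁻ q : ℝ × Circle, F (stabRot p c * unipAt p q.1 * stabRot p q.2)
      ∂((linearWeight a b).prod circleHaar) =
      ∫⁻ s, ∫⁻ d, F (stabRot p c * unipAt p s * stabRot p d) ∂circleHaar ∂(linearWeight a b) :=
    lintegral_prod _ (hm0.comp measurable_prodMk_left).aemeasurable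
  simp only [h2, hFK]
  rw [lintegral_lintegral_swap]
  exact (hm2.comp ((hn.comp measurable_fst).prodMk measurable_snd)).aemeasurable

/-! ### Averaging over a fixed probability measure -/

section Mean

variable {G : Type*} [Group G] [MeasurableSpace G] [MeasurableInv G]
  {X : Type*} [MeasurableSpace X] [MulAction G X] [MeasurableSMul₂ G X]

/-- The averaging operator of a measure on functions with values in `[0, ∞]`. -/
def lmean (κ : Measure G) (h : X → ℝ≥0∞) (x : X) : ℝ≥0∞ := ∫⁻ g, h (g⁻¹ • x) ∂κ

theorem measurable_inv_smul {E : Type*} [MeasurableSpace E] {h : X → E} (hh : Measurable h) :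
    Measurable fun q : X × G => h (q.2⁻¹ • q.1) :=
  hh.comp (measurable_snd.inv.smul measurable_fst)

theorem measurable_inv_smul_const {E : Type*} [MeasurableSpace E] {h : X → E} (hh : Measurable h)
    (x : X) : Measurable fun g : G => h (g⁻¹ • x) :=
  (measurable_inv_smul hh).comp measurable_prodMk_left

theorem measurable_lmean (κ : Measure G) [SFinite κ] {h : X → ℝ≥0∞} (hh : Measurable h) :
    Measurable (lmean κ h) :=
  (measurable_inv_smul hh).lintegral_prod_right'

variable {μ : Measure X} [SFinite μ] [SMulInvariantMeasure G X μ]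

theorem lintegral_lmean (κ : Measure G) [IsProbabilityMeasure κ] {h : X → ℝ≥0∞}
    (hh : Measurable h) : ∫⁻ x, lmean κ h x ∂μ = ∫⁻ x, h x ∂μ := by
  unfold lmean
  rw [lintegral_lintegral_swap (measurable_inv_smul hh).aemeasurable]
  have h1 (g : G) : ∫⁻ x, h (g⁻¹ • x) ∂μ = ∫⁻ x, h x ∂μ :=
    (measurePreserving_smul g⁻¹ μ).lintegral_comp hh
  simp [h1]

theorem lintegral_rpow_le_of_isProbabilityMeasure {Ω : Type*} [MeasurableSpace Ω] (κ : Measure Ω)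
    [IsProbabilityMeasure κ] {u : Ω → ℝ≥0∞} (hu : Measurable u) {p : ℝ} (hp : 1 ≤ p) :
    (∫⁻ ω, u ω ∂κ) ^ p ≤ ∫⁻ ω, u ω ^ p ∂κ := by
  have h1 := eLpNorm'_le_eLpNorm'_of_exponent_le zero_lt_one hp κ hu.aestronglyMeasurable
  simp only [eLpNorm', enorm_eq_self, ENNReal.rpow_one, div_one] at h1
  refine (ENNReal.rpow_le_rpow h1 (zero_le_one.trans hp)).trans_eq ?_
  rw [one_div, ENNReal.rpow_inv_rpow (by linarith)]

theorem lmean_rpow_le (κ : Measure G) [IsProbabilityMeasure κ] {h : X → ℝ≥0∞}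
    (hh : Measurable h) {p : ℝ} (hp : 1 ≤ p) (x : X) :
    lmean κ h x ^ p ≤ lmean κ (fun y => h y ^ p) x :=
  lintegral_rpow_le_of_isProbabilityMeasure κ (measurable_inv_smul_const hh x) hp

theorem lintegral_lmean_rpow_le (κ : Measure G) [IsProbabilityMeasure κ] {h : X → ℝ≥0∞}
    (hh : Measurable h) {p : ℝ} (hp : 1 ≤ p) :
    ∫⁻ x, lmean κ h x ^ p ∂μ ≤ ∫⁻ x, h x ^ p ∂μ :=
  (lintegral_mono fun x => lmean_rpow_le κ hh hp x).trans_eq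
    (lintegral_lmean κ (hh.pow_const p))

/-- The maximal function of a flow, applied to an average of `h`, is of weak type in terms of the
large values of `h` itself: the part of `h` below `t` contributes at most `t`. -/
theorem weakMaximal_flowMax_lmean [IsFiniteMeasure μ] {T : ℝ → X → X} (hT : IsFlow T μ)
    (κ : Measure G) [IsProbabilityMeasure κ] {h : X → ℝ≥0∞} (hh : Measurable h) :
    WeakMaximal μ 1 h (flowMax T (lmean κ h)) := by
  intro t _
  have hS : MeasurableSet {x | (t : ℝ≥0∞) < h x} := measurableSet_lt measurable_const hh
  set h1 : X → ℝ≥0∞ := {x | (t : ℝ≥0∞) < h x}.indicator h with hh1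
  have hm1 : Measurable h1 := hh.indicator hS
  have hle (x : X) : h x ≤ h1 x + t := by
    by_cases hx : (t : ℝ≥0∞) < h x
    · simp [hh1, hx]
    · exact (not_lt.1 hx).trans le_add_self
  have hle' (x : X) : lmean κ h x ≤ lmean κ h1 x + t := by
    refine (lintegral_mono fun g => hle (g⁻¹ • x)).trans_eq ?_
    rw [lintegral_add_right _ measurable_const]
    simp [lmean]
  have hsub : {x | 2 * (t : ℝ≥0∞) < flowMax T (lmean κ h) x} ⊆
      {x | (t : ℝ≥0∞) < flowMax T (lmean κ h1) x} := by
    intro x hx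
    have h2 := (mem_ofPred_eq ▸ hx : 2 * (t : ℝ≥0∞) < _).trans_le (flowMax_le_add hle' x)
    rw [two_mul] at h2
    exact lt_of_add_lt_add_right h2
  calc _ ≤ t * μ {x | (t : ℝ≥0∞) < flowMax T (lmean κ h1) x} := by gcongr
    _ ≤ ∫⁻ x, lmean κ h1 x ∂μ := hT.weak_type (measurable_lmean κ hm1) t
    _ = _ := by rw [lintegral_lmean κ hm1, hh1, lintegral_indicator hS, ENNReal.coe_one, one_mul]

end Mean

/-! ### Families of averages in polar coordinates -/

/-- Integration against `linearWeight` is lower semicontinuous in the endpoints. -/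
theorem lintegral_linearWeight_le_liminf {ι : Type*} {l : Filter ι} [l.IsCountablyGenerated]
    [l.NeBot] {a b : ι → ℝ} {a₀ b₀ : ℝ} (ha : Tendsto a l (𝓝 a₀)) (hb : Tendsto b l (𝓝 b₀))
    (ha₀ : 0 ≤ a₀) (hab : a₀ < b₀) {Φ : ℝ → ℝ≥0∞} (hΦ : Measurable Φ) :
    ∫⁻ s, Φ s ∂(linearWeight a₀ b₀) ≤
      liminf (fun i => ∫⁻ s, Φ s ∂(linearWeight (a i) (b i))) l := by
  have h0 : 0 < b₀ ^ 2 - a₀ ^ 2 := by nlinarith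
  have e (a b : ℝ) : ∫⁻ s, Φ s ∂(linearWeight a b) =
      ∫⁻ s, (Ioc a b).indicator (fun s => ENNReal.ofReal (2 * s / (b ^ 2 - a ^ 2)) * Φ s) s := by
    rw [linearWeight, lintegral_withDensity_eq_lintegral_mul _ (by fun_prop) hΦ,
      lintegral_indicator measurableSet_Ioc]
    rfl
  simp only [e]
  refine le_trans (lintegral_mono_ae ?_) (lintegral_liminf_le fun i =>
    Measurable.indicator (by fun_prop) measurableSet_Ioc)
  have hne : ∀ᵐ s : ℝ, s ≠ b₀ := by simp [ae_iff, measure_singleton]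
  filter_upwards [hne] with s hs
  by_cases hmem : s ∈ Ioc a₀ b₀
  · have hs0 : 0 < s := ha₀.trans_lt hmem.1
    rw [indicator_of_mem hmem]
    have hev : ∀ᶠ i in l, s ∈ Ioc (a i) (b i) := by
      filter_upwards [ha.eventually_lt_const hmem.1,
        hb.eventually_const_lt (lt_of_le_of_ne hmem.2 hs)] with i h1 h2
      exact ⟨h1, h2.le⟩
    have hlim : Tendsto (fun i => ENNReal.ofReal (2 * s / (b i ^ 2 - a i ^ 2)) * Φ s) l
        (𝓝 (ENNReal.ofReal (2 * s / (b₀ ^ 2 - a₀ ^ 2)) * Φ s)) := by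
      refine ENNReal.Tendsto.mul_const (ENNReal.tendsto_ofReal ?_) (Or.inl ?_)
      · exact tendsto_const_nhds.div ((hb.pow 2).sub (ha.pow 2)) h0.ne'
      · simp only [ne_eq, ENNReal.ofReal_eq_zero, not_le]; positivity
    refine le_of_eq (Tendsto.liminf_eq (hlim.congr' ?_)).symm
    filter_upwards [hev] with i hi
    rw [indicator_of_mem hi]
  · rw [indicator_of_notMem hmem]
    exact zero_le

/-- A family whose member `ν r` is the law of `k * n s * k'`, where `n` is a one-parameter subgroup
and `k`, `s`, `k'` are independent of laws `κ`, `linearWeight (a r) (b r)`, `κ`. -/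
structure IsPolarFamily {G : Type*} [Group G] [MeasurableSpace G] (κ : Measure G) (n : ℝ → G)
    (a b : ℝ → ℝ) (C : ℝ) (ν : ℝ → Measure G) : Prop where
  spreading : IsSpreading a b C
  continuousAt_left : ∀ r, 0 < r → ContinuousAt a r
  continuousAt_right : ∀ r, 0 < r → ContinuousAt b r
  measurable : Measurable n
  add : ∀ s t, n (s + t) = n s * n t
  eq_map : ∀ r, 0 < r → ν r = (κ.prod ((linearWeight (a r) (b r)).prod κ)).map
    fun q => q.1 * n q.2.1 * q.2.2

namespace IsPolarFamily

variable {G : Type*} [Group G] [MeasurableSpace G]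
  {κ : Measure G} {n : ℝ → G} {a b : ℝ → ℝ} {C : ℝ} {ν : ℝ → Measure G}
  {X : Type*} [MeasurableSpace X] [MulAction G X] [MeasurableSMul₂ G X]

theorem isProbabilityMeasure_linearWeight (H : IsPolarFamily κ n a b C ν) {r : ℝ} (hr : 0 < r) :
    IsProbabilityMeasure (linearWeight (a r) (b r)) :=
  ErgodicAverages.isProbabilityMeasure_linearWeight (H.spreading.nonneg r hr) (H.spreading.lt r hr)

theorem measurable_mul [MeasurableMul₂ G] (H : IsPolarFamily κ n a b C ν) :
    Measurable fun q : G × ℝ × G => q.1 * n q.2.1 * q.2.2 :=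
  (measurable_fst.mul (H.measurable.comp measurable_snd.fst)).mul measurable_snd.snd

theorem measurable_slice [MeasurableInv G] (H : IsPolarFamily κ n a b C ν)
    {E : Type*} [MeasurableSpace E] {h : X → E} (hh : Measurable h) :
    Measurable fun q : X × ℝ => h ((n q.2)⁻¹ • q.1) :=
  hh.comp ((H.measurable.comp measurable_snd).inv.smul measurable_fst)

variable [MeasurableMul₂ G] [IsProbabilityMeasure κ]

theorem isProbabilityMeasure (H : IsPolarFamily κ n a b C ν) {r : ℝ} (hr : 0 < r) :
    IsProbabilityMeasure (ν r) := by
  have := H.isProbabilityMeasure_linearWeight hr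
  rw [H.eq_map r hr]
  exact Measure.isProbabilityMeasure_map H.measurable_mul.aemeasurable

variable [MeasurableInv G]

theorem lintegral_eq (H : IsPolarFamily κ n a b C ν) {r : ℝ} (hr : 0 < r) {h : X → ℝ≥0∞}
    (hh : Measurable h) (x : X) :
    ∫⁻ g, h (g⁻¹ • x) ∂(ν r) =
      lmean κ (fun y => ∫⁻ s, lmean κ h ((n s)⁻¹ • y) ∂(linearWeight (a r) (b r))) x := by
  have := H.isProbabilityMeasure_linearWeight hr
  have hm0 := measurable_inv_smul_const (G := G) hh x
  have hm : Measurable fun q : G × ℝ × G => h ((q.1 * n q.2.1 * q.2.2)⁻¹ • x) :=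
    hm0.comp H.measurable_mul
  rw [H.eq_map r hr, lintegral_map hm0 H.measurable_mul, lintegral_prod _ hm.aemeasurable]
  refine lintegral_congr fun k => ?_
  have hk : Measurable fun q : ℝ × G => h ((k * n q.1 * q.2)⁻¹ • x) :=
    hm.comp measurable_prodMk_left
  rw [lintegral_prod _ hk.aemeasurable]
  simp only [lmean, mul_inv_rev, mul_smul]

theorem lintegral_eq_lintegral_linearWeight (H : IsPolarFamily κ n a b C ν) {r : ℝ} (hr : 0 < r)
    {h : X → ℝ≥0∞} (hh : Measurable h) (x : X) :
    ∫⁻ g, h (g⁻¹ • x) ∂(ν r) =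
      ∫⁻ s, ∫⁻ k, lmean κ h ((n s)⁻¹ • k⁻¹ • x) ∂κ ∂(linearWeight (a r) (b r)) := by
  have := H.isProbabilityMeasure_linearWeight hr
  rw [H.lintegral_eq hr hh, lmean, lintegral_lintegral_swap]
  exact ((H.measurable_slice (measurable_lmean κ hh)).comp
    ((measurable_inv_smul_const measurable_id x).prodMap measurable_id)).aemeasurable

theorem maximalFunction_le (H : IsPolarFamily κ n a b C ν) {f : X → ℂ} (hf : Measurable f) (x : X) :
    maximalFunction ν f x ≤ ENNReal.ofReal (4 * C) *
      lmean κ (flowMax (fun s (y : X) => (n s)⁻¹ • y) (lmean κ fun y => ‖f y‖ₑ)) x := by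
  refine iSup₂_le fun r hr => ?_
  have hm := measurable_lmean κ hf.enorm
  rw [H.lintegral_eq hr hf.enorm, lmean, lmean, ← lintegral_const_mul' _ _ ENNReal.ofReal_ne_top]
  exact lintegral_mono fun k => lintegral_linearWeight_le_flowMax (fun s (y : X) => (n s)⁻¹ • y)
    (H.spreading.nonneg r hr) (H.spreading.lt r hr) (H.spreading.le r hr) _ _
    ((H.measurable_slice hm).comp measurable_prodMk_left)

/-- By lower semicontinuity in the parameter, the supremum may be taken over rational parameters. -/
theorem measurable_maximalFunction (H : IsPolarFamily κ n a b C ν) {f : X → ℂ} (hf : Measurable f) :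
    Measurable (maximalFunction ν f) := by
  have hm := measurable_lmean κ hf.enorm
  have e : maximalFunction ν f = fun x => ⨆ q : {q : ℚ // 0 < q},
      ∫⁻ g, ‖f (g⁻¹ • x)‖ₑ ∂(ν (q.1 : ℝ)) := by
    funext x
    refine le_antisymm (iSup₂_le fun r hr => ?_) (iSup_le fun q => ?_)
    · set Φ : ℝ → ℝ≥0∞ := fun s => ∫⁻ k, lmean κ (fun y => ‖f y‖ₑ) ((n s)⁻¹ • k⁻¹ • x) ∂κ
      have hΦ : Measurable Φ := by
        have h1 : Measurable fun q : ℝ × G =>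
            lmean κ (fun y => ‖f y‖ₑ) ((n q.1)⁻¹ • q.2⁻¹ • x) :=
          (H.measurable_slice hm).comp
            (((measurable_inv_smul_const measurable_id x).comp measurable_snd).prodMk
              measurable_fst)
        exact h1.lintegral_prod_right'
      set l : Filter ℚ := comap (fun q : ℚ => (q : ℝ)) (𝓝 r)
      have hl : l.NeBot := Rat.isDenseEmbedding_coe_real.toIsDenseInducing.comap_nhds_neBot r
      have hlt : Tendsto (fun q : ℚ => (q : ℝ)) l (𝓝 r) := tendsto_comap
      rw [H.lintegral_eq_lintegral_linearWeight hr hf.enorm]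
      refine (lintegral_linearWeight_le_liminf ((H.continuousAt_left r hr).tendsto.comp hlt)
        ((H.continuousAt_right r hr).tendsto.comp hlt) (H.spreading.nonneg r hr)
        (H.spreading.lt r hr) hΦ).trans ?_
      refine (liminf_le_limsup (f := l)).trans (limsup_le_of_le (by isBoundedDefault) ?_)
      filter_upwards [hlt.eventually_const_lt hr] with q hq
      have hq' : (0 : ℚ) < q := by exact_mod_cast hq
      refine le_trans ?_ (le_iSup _ (⟨q, hq'⟩ : {q : ℚ // 0 < q}))
      exact (H.lintegral_eq_lintegral_linearWeight hq hf.enorm x).ge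
    · have hq : (0 : ℝ) < q.1 := by exact_mod_cast q.2
      exact le_iSup₂ (f := fun (r : ℝ) (_ : 0 < r) => ∫⁻ g, ‖f (g⁻¹ • x)‖ₑ ∂(ν r)) (q.1 : ℝ) hq
  rw [e]
  refine .iSup fun q => ?_
  have := H.isProbabilityMeasure (r := (q.1 : ℝ)) (by exact_mod_cast q.2)
  exact measurable_lmean _ hf.enorm

end IsPolarFamily

/-! ### Maximal inequalities -/

section Null

variable {G : Type*} [Group G] [MeasurableSpace G]
  {X : Type*} [MeasurableSpace X] [MulAction G X] [MeasurableSMul₂ G X]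
  {μ : Measure X} [SFinite μ] [SMulInvariantMeasure G X μ]

/-- A property that holds almost everywhere holds at almost every point of almost every orbit. -/
theorem ae_ae_smul {Ω : Type*} [MeasurableSpace Ω] (η : Measure Ω) [SFinite η] {θ : Ω → G}
    (hθ : Measurable θ) {Q : X → Prop} (hQ : ∀ᵐ y ∂μ, Q y) :
    ∀ᵐ x ∂μ, ∀ᵐ ω ∂η, Q (θ ω • x) := by
  obtain ⟨S, hS, hSm, hS0⟩ := exists_measurable_superset_of_null (ae_iff.1 hQ)
  have hm : MeasurableSet {q : Ω × X | θ q.1 • q.2 ∉ S} :=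
    ((hθ.comp measurable_fst).smul measurable_snd) hSm.compl
  have h1 : ∀ᵐ ω ∂η, ∀ᵐ x ∂μ, θ ω • x ∉ S := ae_of_all _ fun ω =>
    (measurePreserving_smul (θ ω) μ).quasiMeasurePreserving.ae (measure_eq_zero_iff_ae_notMem.1 hS0)
  filter_upwards [(Measure.ae_ae_comm hm).1 h1] with x hx
  filter_upwards [hx] with ω hω
  by_contra hc
  exact hω (hS hc)

theorem linearWeight_absolutelyContinuous (a b : ℝ) : linearWeight a b ≪ volume :=
  (withDensity_absolutelyContinuous _ _).trans Measure.restrict_le_self.absolutelyContinuous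

end Null

theorem lLogL_congr {X : Type*} [MeasurableSpace X] {μ : Measure X} {f f' : X → ℂ}
    (hf : f =ᵐ[μ] f') : lLogL f μ = lLogL f' μ :=
  lintegral_congr_ae (hf.fun_comp fun z : ℂ => ENNReal.ofReal (‖z‖ * Real.log (max ‖z‖ 1)))

namespace IsPolarFamily

variable {G : Type*} [Group G] [MeasurableSpace G] [MeasurableInv G]
  {κ : Measure G} {n : ℝ → G} {a b : ℝ → ℝ} {C : ℝ} {ν : ℝ → Measure G}
  {X : Type*} [MeasurableSpace X] [MulAction G X] [MeasurableSMul₂ G X]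
  {μ : Measure X} [SMulInvariantMeasure G X μ]

theorem isFlow (H : IsPolarFamily κ n a b C ν) : IsFlow (fun s (x : X) => (n s)⁻¹ • x) μ :=
  isFlow_inv_smul n H.measurable H.add

variable [IsProbabilityMeasure κ] [IsProbabilityMeasure μ]

/-- The maximal function of the flow is integrable after averaging if `f` is in `L log L`. -/
theorem lintegral_flowMax_le (H : IsPolarFamily κ n a b C ν) {f : X → ℂ} (hf : Integrable f μ)
    (hfm : Measurable f) :
    ∫⁻ x, flowMax (fun s (y : X) => (n s)⁻¹ • y) (lmean κ fun y => ‖f y‖ₑ) x ∂μ ≤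
      2 * (1 + lLogL f μ) := by
  have hM := H.isFlow.measurable_flowMax (μ := μ) (measurable_lmean κ hfm.enorm)
  have hw := (weakMaximal_flowMax_lmean (H.isFlow (μ := μ)) κ hfm.enorm).lintegral_le_log
    hfm.enorm hM hf.2.ne
  simpa [lLogL] using hw

variable [MeasurableMul₂ G]

/-- Functions that agree almost everywhere have, at almost every point, the same averages for all
parameters at once, since all members of the family are absolutely continuous with respect to one
measure. -/
theorem ae_ae_eq (H : IsPolarFamily κ n a b C ν) {f f' : X → ℂ} (hf : f =ᵐ[μ] f') :
    ∀ᵐ x ∂μ, ∀ r, 0 < r → (fun g => f (g⁻¹ • x)) =ᵐ[ν r] fun g => f' (g⁻¹ • x) := by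
  obtain ⟨S, hS, hSm, hS0⟩ := exists_measurable_superset_of_null (ae_iff.1 hf)
  filter_upwards [ae_ae_smul (κ.prod ((volume : Measure ℝ).prod κ)) H.measurable_mul.inv
    (measure_eq_zero_iff_ae_notMem.1 hS0)] with x hx r hr
  have := H.isProbabilityMeasure_linearWeight hr
  have hac : κ.prod ((linearWeight (a r) (b r)).prod κ) ≪ κ.prod ((volume : Measure ℝ).prod κ) :=
    .prod .rfl (.prod (linearWeight_absolutelyContinuous _ _) .rfl)
  have h1 : ∀ᵐ g ∂(ν r), g⁻¹ • x ∉ S := by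
    have hSx : MeasurableSet {g : G | g⁻¹ • x ∉ S} :=
      measurable_inv_smul_const measurable_id x hSm.compl
    rw [H.eq_map r hr, ae_map_iff H.measurable_mul.aemeasurable hSx]
    exact hac.ae_le hx
  filter_upwards [h1] with g hg
  by_contra hc
  exact hg (hS hc)

theorem maximalFunction_ae_eq (H : IsPolarFamily κ n a b C ν) {f f' : X → ℂ} (hf : f =ᵐ[μ] f') :
    maximalFunction ν f =ᵐ[μ] maximalFunction ν f' := by
  filter_upwards [H.ae_ae_eq hf] with x hx
  refine iSup_congr fun r => iSup_congr fun hr => lintegral_congr_ae ?_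
  filter_upwards [hx r hr] with g hg
  rw [hg]

theorem aemeasurable_maximalFunction (H : IsPolarFamily κ n a b C ν) {f : X → ℂ}
    (hf : AEMeasurable f μ) : AEMeasurable (maximalFunction ν f) μ :=
  ⟨_, H.measurable_maximalFunction hf.measurable_mk, H.maximalFunction_ae_eq hf.ae_eq_mk⟩

theorem lintegral_maximalFunction_rpow_le (H : IsPolarFamily κ n a b C ν) {f : X → ℂ}
    (hf : Integrable f μ) {p : ℝ} (hp : 1 < p) :
    ∫⁻ x, maximalFunction ν f x ^ p ∂μ ≤
      ENNReal.ofReal (4 * C) ^ p * (2 ^ p * ENNReal.ofReal (p / (p - 1))) *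
        ∫⁻ x, ‖f x‖ₑ ^ p ∂μ := by
  wlog hfm : Measurable f generalizing f
  · obtain ⟨f', hf', hff'⟩ := hf.aemeasurable
    have h1 := this (hf.congr hff') hf'
    have e1 : ∫⁻ x, maximalFunction ν f x ^ p ∂μ = ∫⁻ x, maximalFunction ν f' x ^ p ∂μ :=
      lintegral_congr_ae ((H.maximalFunction_ae_eq hff').fun_comp (· ^ p))
    have e2 : ∫⁻ x, ‖f x‖ₑ ^ p ∂μ = ∫⁻ x, ‖f' x‖ₑ ^ p ∂μ :=
      lintegral_congr_ae (hff'.fun_comp fun z => ‖z‖ₑ ^ p)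
    rwa [e1, e2]
  have hp0 : 0 ≤ p := by linarith
  have hm := measurable_lmean κ hfm.enorm
  have hM := H.isFlow.measurable_flowMax (μ := μ) hm
  have hw := (weakMaximal_flowMax_lmean (H.isFlow (μ := μ)) κ hfm.enorm).lintegral_rpow_le
    hfm.enorm hM hf.2.ne hp
  calc _ ≤ ∫⁻ x, ENNReal.ofReal (4 * C) ^ p *
        lmean κ (flowMax (fun s (y : X) => (n s)⁻¹ • y) (lmean κ fun y => ‖f y‖ₑ)) x ^ p ∂μ := by
        refine lintegral_mono fun x => ?_
        rw [← ENNReal.mul_rpow_of_nonneg _ _ hp0]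
        exact ENNReal.rpow_le_rpow (H.maximalFunction_le hfm x) hp0
    _ = ENNReal.ofReal (4 * C) ^ p * ∫⁻ x, lmean κ (flowMax (fun s (y : X) => (n s)⁻¹ • y)
        (lmean κ fun y => ‖f y‖ₑ)) x ^ p ∂μ :=
        lintegral_const_mul _ ((measurable_lmean κ hM).pow_const p)
    _ ≤ ENNReal.ofReal (4 * C) ^ p * (2 ^ p * (ENNReal.ofReal (p / (p - 1)) *
        ((1 : ℝ≥0) * ∫⁻ x, ‖f x‖ₑ ^ p ∂μ))) := by
        gcongr
        exact (lintegral_lmean_rpow_le κ hM hp.le).trans hw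
    _ = _ := by rw [ENNReal.coe_one, one_mul]; ring

theorem lintegral_maximalFunction_le (H : IsPolarFamily κ n a b C ν) {f : X → ℂ}
    (hf : Integrable f μ) :
    ∫⁻ x, maximalFunction ν f x ∂μ ≤ ENNReal.ofReal (4 * C) * (2 * (1 + lLogL f μ)) := by
  wlog hfm : Measurable f generalizing f
  · obtain ⟨f', hf', hff'⟩ := hf.aemeasurable
    have h1 := this (hf.congr hff') hf'
    rwa [lintegral_congr_ae (H.maximalFunction_ae_eq hff'), lLogL_congr hff']
  have hM := H.isFlow.measurable_flowMax (μ := μ) (measurable_lmean κ hfm.enorm)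
  refine (lintegral_mono (H.maximalFunction_le hfm)).trans ?_
  rw [lintegral_const_mul _ (measurable_lmean κ hM), lintegral_lmean κ hM]
  gcongr
  exact H.lintegral_flowMax_le hf hfm

theorem strongTypeWith (H : IsPolarFamily κ n a b C ν) {p : ℝ≥0∞} (hp : 1 < p) (hp' : p < ∞) :
    StrongTypeWith ν p ((ENNReal.ofReal (4 * C) ^ p.toReal *
      (2 ^ p.toReal * ENNReal.ofReal (p.toReal / (p.toReal - 1)))) ^ p.toReal⁻¹).toNNReal μ := by
  intro f hf
  have hfI := hf.integrable hp.le
  have hp1 : 1 < p.toReal := by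
    rw [← ENNReal.toReal_one]; exact (ENNReal.toReal_lt_toReal (by simp) hp'.ne).2 hp
  have hp0 : 0 ≤ p.toReal⁻¹ := by positivity
  refine ⟨H.aemeasurable_maximalFunction hfI.aemeasurable, ?_⟩
  have hp2 : p ≠ 0 := (zero_lt_one.trans hp).ne'
  rw [eLpNorm_eq_lintegral_rpow_enorm_toReal hp2 hp'.ne,
    eLpNorm_eq_lintegral_rpow_enorm_toReal hp2 hp'.ne, ENNReal.coe_toNNReal, one_div,
    ← ENNReal.mul_rpow_of_nonneg _ _ hp0]
  · exact ENNReal.rpow_le_rpow (H.lintegral_maximalFunction_rpow_le hfI hp1) hp0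
  · refine ENNReal.rpow_ne_top_of_nonneg hp0 (ENNReal.mul_ne_top ?_ (ENNReal.mul_ne_top ?_ ?_))
    · exact ENNReal.rpow_ne_top_of_nonneg ENNReal.toReal_nonneg ENNReal.ofReal_ne_top
    · exact ENNReal.rpow_ne_top_of_nonneg ENNReal.toReal_nonneg (by simp)
    · exact ENNReal.ofReal_ne_top

theorem lLogLTypeWith (H : IsPolarFamily κ n a b C ν) :
    LLogLTypeWith ν (8 * C).toNNReal μ := by
  intro f hf
  refine ⟨H.aemeasurable_maximalFunction hf.1.aemeasurable,
    (H.lintegral_maximalFunction_le hf.1).trans_eq ?_⟩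
  have e : ((8 * C).toNNReal : ℝ≥0∞) = ENNReal.ofReal (4 * C) * 2 := by
    rw [← ENNReal.ofReal_ofNat 2, ← ENNReal.ofReal_mul' (by norm_num), ENNReal.ofReal]
    congr 2
    norm_num
    ring
  rw [e, mul_assoc]

end IsPolarFamily

theorem memLLogL_of_memLp {X : Type*} [MeasurableSpace X] {μ : Measure X} [IsFiniteMeasure μ]
    {p : ℝ≥0∞} (hp : 1 < p) (hp' : p < ∞) {f : X → ℂ} (hf : MemLp f p μ) : MemLLogL f μ := by
  refine ⟨hf.integrable hp.le, ?_⟩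
  have hp1 : 0 < p.toReal - 1 := by
    have : 1 < p.toReal := by
      rw [← ENNReal.toReal_one]; exact (ENNReal.toReal_lt_toReal (by simp) hp'.ne).2 hp
    linarith
  have hI := (hf.integrable_norm_rpow (zero_lt_one.trans hp).ne' hp'.ne).div_const (p.toReal - 1)
  refine lt_of_le_of_lt (lintegral_mono fun x => ENNReal.ofReal_le_ofReal ?_)
    (hI.lintegral_lt_top)
  rcases le_total ‖f x‖ 1 with h | h
  · rw [max_eq_right h, Real.log_one, mul_zero]; positivity
  · rw [max_eq_left h]
    have h0 : 0 < ‖f x‖ := by linarith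
    calc ‖f x‖ * Real.log ‖f x‖ ≤ ‖f x‖ * (‖f x‖ ^ (p.toReal - 1) / (p.toReal - 1)) := by
          gcongr; exact Real.log_le_rpow_div h0.le hp1
      _ = _ := by rw [Real.rpow_sub_one h0.ne']; field_simp

/-! ### Pointwise and mean convergence -/

theorem enorm_average_le {G X : Type*} [Group G] [MeasurableSpace G] [MulAction G X]
    (κ : Measure G) (f : X → ℂ) (x : X) : ‖average κ f x‖ₑ ≤ ∫⁻ g, ‖f (g⁻¹ • x)‖ₑ ∂κ :=
  enorm_integral_le_lintegral_enorm _

section CondExp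

variable {G : Type*} [Group G] [MeasurableSpace G] [MeasurableInv G]
  {X : Type*} [MeasurableSpace X] [MulAction G X] [MeasurableSMul₂ G X]
  {κ : Measure G} [IsProbabilityMeasure κ]

theorem measurable_average {f : X → ℂ} (hf : Measurable f) : Measurable (average κ f) :=
  (measurable_inv_smul hf).stronglyMeasurable.integral_prod_right'.measurable

theorem integrable_of_maximalFunction_lt_top {ν : ℝ → Measure G} {f : X → ℂ} (hf : Measurable f)
    {x : X} (hx : maximalFunction ν f x < ∞) {r : ℝ} (hr : 0 < r) :
    Integrable (fun g => f (g⁻¹ • x)) (ν r) :=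
  ⟨(measurable_inv_smul_const hf x).aestronglyMeasurable,
    (le_iSup₂ (f := fun (r : ℝ) (_ : 0 < r) => ∫⁻ g, ‖f (g⁻¹ • x)‖ₑ ∂(ν r)) r hr).trans_lt hx⟩

variable {μ : Measure X} [IsProbabilityMeasure μ] [SMulInvariantMeasure G X μ]

theorem integrable_average {f : X → ℂ} (hf : Measurable f) (hI : Integrable f μ) :
    Integrable (average κ f) μ := by
  refine ⟨(measurable_average hf).aestronglyMeasurable, ?_⟩
  refine (lintegral_mono (enorm_average_le κ f)).trans_lt ?_
  exact (lintegral_lmean κ hf.enorm).trans_lt hI.2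

/-- Averaging over the group does not change the conditional expectation on the invariant sets. -/
theorem condExp_average_ae_eq {f : X → ℂ} (hf : Measurable f) (hI : Integrable f μ) :
    μ[average κ f | invariantSigmaAlgebra G X] =ᵐ[μ] μ[f | invariantSigmaAlgebra G X] := by
  refine ae_eq_condExp_of_forall_setIntegral_eq invariantSigmaAlgebra_le hI
    (fun s _ _ => integrable_condExp.integrableOn) (fun s hs _ => ?_)
    stronglyMeasurable_condExp.aestronglyMeasurable
  rw [setIntegral_condExp invariantSigmaAlgebra_le (integrable_average hf hI) hs]
  have hint : Integrable (fun q : X × G => f (q.2⁻¹ • q.1)) ((μ.restrict s).prod κ) := by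
    refine ⟨(measurable_inv_smul hf).aestronglyMeasurable, ?_⟩
    rw [HasFiniteIntegral, lintegral_prod _ (measurable_inv_smul hf).enorm.aemeasurable]
    exact (setLIntegral_le_lintegral s _).trans_lt
      ((lintegral_lmean κ hf.enorm).trans_lt hI.2)
  unfold average
  rw [integral_integral_swap hint]
  rw [measurableSet_invariantSigmaAlgebra] at hs
  have h1 (g : G) : ∫ x in s, f (g⁻¹ • x) ∂μ = ∫ x in s, f x ∂μ := by
    have := (measurePreserving_smul g⁻¹ μ).setIntegral_preimage_emb
      (measurableEmbedding_const_smul g⁻¹) f s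
    rwa [hs.2 g⁻¹] at this
  simp [h1]

end CondExp

namespace IsPolarFamily

variable {G : Type*} [Group G] [MeasurableSpace G] [MeasurableInv G] [MeasurableMul₂ G]
  {κ : Measure G} [IsProbabilityMeasure κ] {n : ℝ → G} {a b : ℝ → ℝ} {C : ℝ} {ν : ℝ → Measure G}
  {X : Type*} [MeasurableSpace X] [MulAction G X] [MeasurableSMul₂ G X]
  {μ : Measure X}

theorem average_eq (H : IsPolarFamily κ n a b C ν) {r : ℝ} (hr : 0 < r) {f : X → ℂ}
    (hf : Measurable f) {x : X} (hx : Integrable (fun g => f (g⁻¹ • x)) (ν r)) :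
    average (ν r) f x =
      ∫ k, ∫ s, average κ f ((n s)⁻¹ • k⁻¹ • x) ∂(linearWeight (a r) (b r)) ∂κ := by
  have := H.isProbabilityMeasure_linearWeight hr
  have hm := measurable_inv_smul_const (G := G) hf x
  rw [H.eq_map r hr] at hx
  have hI := hx.comp_measurable H.measurable_mul
  rw [average, H.eq_map r hr, integral_map H.measurable_mul.aemeasurable hm.aestronglyMeasurable]
  refine (integral_prod _ hI).trans (integral_congr_ae ?_)
  filter_upwards [hI.prod_right_ae] with k hk
  refine (integral_prod _ hk).trans ?_
  simp only [average, Function.comp_apply, mul_inv_rev, mul_smul]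

/-- Mean convergence follows from pointwise convergence when the maximal function is in `L^p`. -/
theorem meanErgodicFor_of_measurable (H : IsPolarFamily κ n a b C ν) {p : ℝ≥0∞} (hp : p ≠ 0)
    (hp' : p ≠ ∞) {f : X → ℂ} (hf : Measurable f) (hP : PointwiseErgodicFor ν μ f)
    (hM : ∫⁻ x, maximalFunction ν f x ^ p.toReal ∂μ ≠ ∞) : MeanErgodicFor ν p μ f := by
  have hp0 : 0 < p.toReal := ENNReal.toReal_pos hp hp'
  have hle {r : ℝ} (hr : 0 < r) (x : X) : ‖average (ν r) f x‖ₑ ≤ maximalFunction ν f x :=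
    (enorm_average_le _ f x).trans
      (le_iSup₂ (f := fun (r : ℝ) (_ : 0 < r) => ∫⁻ g, ‖f (g⁻¹ • x)‖ₑ ∂(ν r)) r hr)
  have hm {r : ℝ} (hr : 0 < r) : Measurable (average (ν r) f) := by
    have := H.isProbabilityMeasure hr
    exact measurable_average hf
  refine ⟨fun r hr => ⟨(hm hr).aestronglyMeasurable, ?_⟩, ?_⟩
  · rw [eLpNorm_lt_top_iff_lintegral_rpow_enorm_lt_top hp hp']
    exact (lintegral_mono fun x => ENNReal.rpow_le_rpow (hle hr x) hp0.le).trans_lt hM.lt_top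
  set E : X → ℂ := μ[f | invariantSigmaAlgebra G X] with hE
  have hEle : ∀ᵐ x ∂μ, ‖E x‖ₑ ≤ maximalFunction ν f x := by
    filter_upwards [hP] with x hx
    refine le_of_tendsto hx.2.enorm ?_
    filter_upwards [eventually_gt_atTop 0] with r hr using hle hr x
  have hEm : AEMeasurable E μ := integrable_condExp.aemeasurable
  have hlim : Tendsto (fun r => ∫⁻ x, ‖(average (ν r) f - E) x‖ₑ ^ p.toReal ∂μ) atTop
      (𝓝 (∫⁻ _, 0 ∂μ)) := by
    refine tendsto_lintegral_filter_of_dominated_convergence'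
      (fun x => (2 * maximalFunction ν f x) ^ p.toReal) ?_ ?_ ?_ ?_
    · filter_upwards [eventually_gt_atTop 0] with r hr
      exact ((hm hr).aemeasurable.sub hEm).enorm.pow_const _
    · filter_upwards [eventually_gt_atTop 0] with r hr
      filter_upwards [hEle] with x hx
      refine ENNReal.rpow_le_rpow ?_ hp0.le
      rw [two_mul]
      exact enorm_sub_le.trans (add_le_add (hle hr x) hx)
    · simp_rw [ENNReal.mul_rpow_of_nonneg _ _ hp0.le]
      rw [lintegral_const_mul' _ _ (ENNReal.rpow_ne_top_of_nonneg hp0.le (by simp))]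
      exact ENNReal.mul_ne_top (ENNReal.rpow_ne_top_of_nonneg hp0.le (by simp)) hM
    · filter_upwards [hP] with x hx
      have h1 : Tendsto (fun r => ‖average (ν r) f x - E x‖ₑ) atTop (𝓝 0) := by
        have h2 : Tendsto (fun r => average (ν r) f x) atTop (𝓝 (E x)) := hx.2
        simpa using (h2.sub_const (E x)).enorm
      simpa [hp0] using h1.ennrpow_const p.toReal
  simp only [eLpNorm_eq_lintegral_rpow_enorm_toReal hp hp']
  rw [lintegral_zero] at hlim
  simpa [hp0] using hlim.ennrpow_const (1 / p.toReal)

variable [IsProbabilityMeasure μ] [SMulInvariantMeasure G X μ]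

/-- Pointwise convergence for measurable functions in `L log L`: the flow averages of `average κ f`
converge at almost every point of almost every orbit, the limit is constant on orbits, and the
maximal function of the flow allows for dominated convergence in the outer average. -/
theorem pointwiseErgodicFor_of_measurable [TopologicalSpace G] [IsTopologicalGroup G]
    [LocallyCompactSpace G] [SecondCountableTopology G] [BorelSpace G]
    (H : IsPolarFamily κ n a b C ν) (hM : HasMautner n X μ) {f : X → ℂ} (hf : Measurable f)
    (hL : MemLLogL f μ) : PointwiseErgodicFor ν μ f := by
  set T : ℝ → X → X := fun s x => (n s)⁻¹ • x with hT
  set M : X → ℝ≥0∞ := flowMax T (lmean κ fun y => ‖f y‖ₑ) with hMdef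
  set h : X → ℂ := average κ f with hh
  set E : X → ℂ := μ[f | invariantSigmaAlgebra G X] with hE
  have hhm : Measurable h := measurable_average hf
  have hMm : Measurable M := H.isFlow.measurable_flowMax (μ := μ) (measurable_lmean κ hf.enorm)
  have hMI : ∫⁻ x, lmean κ M x ∂μ ≠ ∞ := by
    rw [lintegral_lmean κ hMm]
    refine ((H.lintegral_flowMax_le hL.1 hf).trans_lt ?_).ne
    exact ENNReal.mul_lt_top (by simp) (ENNReal.add_lt_top.2 ⟨by simp, hL.2⟩)
  have hconv : ∀ᵐ y ∂μ, Tendsto (fun r => ∫ s, h (T s y) ∂(linearWeight (a r) (b r))) atTop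
      (𝓝 (E y)) := by
    filter_upwards [(flowConverges_of_integrable H.measurable H.add hM H.spreading hhm
      (integrable_average hf hL.1)).tendsto, condExp_average_ae_eq (κ := κ) hf hL.1] with y h1 h2
    rwa [h2] at h1
  filter_upwards [ae_lt_top (measurable_lmean κ hMm) hMI,
    ae_ae_smul κ measurable_inv hconv] with x hx1 hx2
  have hmax : maximalFunction ν f x < ∞ :=
    (H.maximalFunction_le hf x).trans_lt (ENNReal.mul_lt_top ENNReal.ofReal_lt_top hx1)
  refine ⟨fun r hr => integrable_of_maximalFunction_lt_top hf hmax hr, ?_⟩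
  have hMx : Measurable fun k : G => M (k⁻¹ • x) := measurable_inv_smul_const hMm x
  have hlim : Tendsto (fun r => ∫ k, ∫ s, h (T s (k⁻¹ • x)) ∂(linearWeight (a r) (b r)) ∂κ) atTop
      (𝓝 (∫ _ : G, E x ∂κ)) := by
    refine tendsto_integral_filter_of_dominated_convergence
      (fun k => (ENNReal.ofReal (4 * C) * M (k⁻¹ • x)).toReal) ?_ ?_ ?_ ?_
    · filter_upwards [eventually_gt_atTop 0] with r hr
      have := H.isProbabilityMeasure_linearWeight hr
      exact ((H.measurable_slice hhm).stronglyMeasurable.integral_prod_right'.measurable.comp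
        (measurable_inv_smul_const measurable_id x)).aestronglyMeasurable
    · filter_upwards [eventually_gt_atTop 0] with r hr
      filter_upwards [ae_lt_top hMx hx1.ne] with k hk
      rw [← toReal_enorm]
      refine ENNReal.toReal_mono (ENNReal.mul_lt_top ENNReal.ofReal_lt_top hk).ne ?_
      refine (enorm_integral_le_lintegral_enorm _).trans
        ((lintegral_mono fun s => enorm_average_le κ f _).trans ?_)
      exact lintegral_linearWeight_le_flowMax T (H.spreading.nonneg r hr) (H.spreading.lt r hr)
        (H.spreading.le r hr) (lmean κ fun y => ‖f y‖ₑ) _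
        ((H.measurable_slice (measurable_lmean κ hf.enorm)).comp measurable_prodMk_left)
    · refine integrable_toReal_of_lintegral_ne_top (hMx.const_mul _).aemeasurable ?_
      rw [lintegral_const_mul _ hMx]
      exact ENNReal.mul_ne_top ENNReal.ofReal_ne_top hx1.ne
    · filter_upwards [hx2] with k hk
      have hEk : E (k⁻¹ • x) = E x :=
        apply_smul_of_measurable_invariant stronglyMeasurable_condExp.measurable _ _
      rwa [hEk] at hk
  rw [integral_const, probReal_univ, one_smul] at hlim
  refine hlim.congr' ?_
  filter_upwards [eventually_gt_atTop 0] with r hr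
  exact (H.average_eq hr hf (integrable_of_maximalFunction_lt_top hf hmax hr)).symm

theorem meanErgodicFor_congr (H : IsPolarFamily κ n a b C ν) {p : ℝ≥0∞} {f f' : X → ℂ}
    (hff' : f =ᵐ[μ] f') (h : MeanErgodicFor ν p μ f') : MeanErgodicFor ν p μ f := by
  have h1 {r : ℝ} (hr : 0 < r) : average (ν r) f =ᵐ[μ] average (ν r) f' := by
    filter_upwards [H.ae_ae_eq hff'] with x hx using integral_congr_ae (hx r hr)
  refine ⟨fun r hr => (memLp_congr_ae (h1 hr)).2 (h.1 r hr), h.2.congr' ?_⟩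
  filter_upwards [eventually_gt_atTop 0] with r hr
  exact (eLpNorm_congr_ae ((h1 hr).sub (condExp_congr_ae hff'))).symm

theorem pointwiseErgodicFor_congr (H : IsPolarFamily κ n a b C ν) {f f' : X → ℂ}
    (hff' : f =ᵐ[μ] f') (h : PointwiseErgodicFor ν μ f') : PointwiseErgodicFor ν μ f := by
  filter_upwards [h, H.ae_ae_eq hff',
    condExp_congr_ae (m := invariantSigmaAlgebra G X) hff'] with x h1 h2 h3
  refine ⟨fun r hr => (h1.1 r hr).congr (h2 r hr).symm, ?_⟩
  rw [h3]
  refine h1.2.congr' ?_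
  filter_upwards [eventually_gt_atTop 0] with r hr
  exact (integral_congr_ae (h2 r hr)).symm

theorem ergodicFor (H : IsPolarFamily κ n a b C ν) [TopologicalSpace G] [IsTopologicalGroup G]
    [LocallyCompactSpace G] [SecondCountableTopology G] [BorelSpace G] (hM : HasMautner n X μ)
    {p : ℝ≥0∞} (hp : p ≠ 0) (hp' : p ≠ ∞) {f : X → ℂ} (hL : MemLLogL f μ)
    (hI : ∫⁻ x, maximalFunction ν f x ^ p.toReal ∂μ ≠ ∞) :
    MeanErgodicFor ν p μ f ∧ PointwiseErgodicFor ν μ f := by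
  obtain ⟨f', hf', hff'⟩ := hL.1.aemeasurable
  have hL' : MemLLogL f' μ := ⟨hL.1.congr hff', lLogL_congr hff' ▸ hL.2⟩
  have hP := H.pointwiseErgodicFor_of_measurable hM hf' hL'
  have e : ∫⁻ x, maximalFunction ν f x ^ p.toReal ∂μ =
      ∫⁻ x, maximalFunction ν f' x ^ p.toReal ∂μ :=
    lintegral_congr_ae ((H.maximalFunction_ae_eq hff').fun_comp (· ^ p.toReal))
  exact ⟨H.meanErgodicFor_congr hff' (H.meanErgodicFor_of_measurable hp hp' hf' hP (e ▸ hI)),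
    H.pointwiseErgodicFor_congr hff' hP⟩

/-- A polar family along a one-parameter subgroup with the Mautner property is good. -/
theorem isGoodAveragingFamily (H : IsPolarFamily κ n a b C ν) [TopologicalSpace G]
    [IsTopologicalGroup G] [LocallyCompactSpace G] [SecondCountableTopology G] [BorelSpace G]
    (hν : IsAveragingFamily ν)
    (hM : ∀ (X : Type u) [MeasurableSpace X] [StandardBorelSpace X] [MulAction G X]
      [MeasurableSMul₂ G X] (μ : Measure X) [IsProbabilityMeasure μ] [SMulInvariantMeasure G X μ],
      HasMautner n X μ) :
    IsGoodAveragingFamily.{u} ν := by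
  refine ⟨hν, fun p hp hp' => ⟨_, fun X _ _ _ _ μ _ _ => ⟨H.strongTypeWith hp hp',
    fun f hf => ?_⟩⟩, ⟨_, fun X _ _ _ _ μ _ _ => ⟨H.lLogLTypeWith, fun f hf => ?_⟩⟩⟩
  · have hp0 : p ≠ 0 := (zero_lt_one.trans hp).ne'
    refine H.ergodicFor (hM X μ) hp0 hp'.ne (memLLogL_of_memLp hp hp' hf) ?_
    have h1 := (H.strongTypeWith hp hp' f hf).2.trans_lt (ENNReal.mul_lt_top (by simp) hf.2)
    rw [eLpNorm_lt_top_iff_lintegral_rpow_enorm_lt_top hp0 hp'.ne] at h1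
    exact h1.ne
  · refine H.ergodicFor (hM X μ) one_ne_zero ENNReal.one_ne_top hf ?_
    simp only [ENNReal.toReal_one, ENNReal.rpow_one]
    refine ((H.lLogLTypeWith f hf).2.trans_lt (ENNReal.mul_lt_top (by simp) ?_)).ne
    exact ENNReal.add_lt_top.2 ⟨by simp, hf.2⟩

end IsPolarFamily

/-! ### Balls and shells -/

theorem isCompact_radius_le (p : UpperHalfPlane) (R : ℝ) : IsCompact {g | radius p g ≤ R} := by
  have hproper : IsProperMap fun A : SL(2, ℝ) => A • p := by
    have h := UpperHalfPlane.isProperMap_smul_I.comp (Homeomorph.mulRight p.toSL2R).isProperMap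
    convert h using 2 with A
    simp [mul_smul]
  have hS : IsCompact ((fun A : SL(2, ℝ) => (QuotientGroup.mk A : PSL2R)) ''
      ((fun A : SL(2, ℝ) => A • p) ⁻¹' Metric.closedBall p (2 * Real.arsinh (R / 2)))) :=
    (hproper.isCompact_preimage (isCompact_closedBall _ _)).image continuous_mk
  refine hS.of_isClosed_subset (isClosed_le (continuous_radius p) continuous_const) fun g hg => ?_
  obtain ⟨A, rfl⟩ := QuotientGroup.mk_surjective g
  refine ⟨A, ?_, rfl⟩
  have h1 : Real.sinh (dist (A • p) p / 2) ≤ R / 2 := by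
    have : 2 * Real.sinh (dist (A • p) p / 2) ≤ R := hg
    linarith
  rw [mem_preimage, Metric.mem_closedBall]
  have h2 := Real.arsinh_le_arsinh.2 h1
  rw [Real.arsinh_sinh] at h2
  linarith

theorem shell_compl_eq_zero (p : UpperHalfPlane) (a b : ℝ) :
    shell p a b {g | radius p g ≤ b}ᶜ = 0 := by
  have hm : MeasurableSet (radius p ⁻¹' Icc a b) :=
    (continuous_radius p).measurable measurableSet_Icc
  rw [shell, ProbabilityTheory.cond_apply hm]
  have : radius p ⁻¹' Icc a b ∩ {g | radius p g ≤ b}ᶜ = ∅ := by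
    ext g
    simp only [mem_inter_iff, mem_preimage, mem_Icc, mem_compl_iff, mem_ofPred_eq,
      mem_empty_iff_false, iff_false, not_and, not_not]
    exact fun h => h.2
  rw [this, measure_empty, mul_zero]

/-- The integral of a function on the group over two independent rotations on both sides of a
unipotent element. -/
def biMean (p : UpperHalfPlane) (F : PSL2R → ℝ) (s : ℝ) : ℝ :=
  ∫ d, ∫ c, F (stabRot p c * unipAt p s * stabRot p d) ∂circleHaar ∂circleHaar

theorem continuous_biMean (p : UpperHalfPlane) {F : PSL2R → ℝ} (hF : Continuous F) :
    Continuous (biMean p F) := by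
  have hk := continuous_stabRot p
  have hn : Continuous (unipAt p) := continuous_unip _
  have h1 : Continuous fun q : ℝ × Circle =>
      ∫ c, F (stabRot p c * unipAt p q.1 * stabRot p q.2) ∂circleHaar := by
    have hc : Continuous (Function.uncurry fun (q : ℝ × Circle) (c : Circle) =>
        F (stabRot p c * unipAt p q.1 * stabRot p q.2)) :=
      hF.comp (((hk.comp continuous_snd).mul (hn.comp continuous_fst.fst)).mul
        (hk.comp continuous_fst.snd))
    simpa using continuous_parametric_integral_of_continuous (μ := circleHaar) hc isCompact_univ
  have h2 : Continuous (Function.uncurry fun (s : ℝ) (d : Circle) =>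
      ∫ c, F (stabRot p c * unipAt p s * stabRot p d) ∂circleHaar) := h1
  have h3 := continuous_parametric_integral_of_continuous (μ := circleHaar) h2 isCompact_univ
  rw [Measure.restrict_univ] at h3
  exact h3

theorem integral_shell (p : UpperHalfPlane) {a b : ℝ} (ha : 0 ≤ a) (hab : a < b) {F : PSL2R → ℝ}
    (hF : Continuous F) :
    ∫ g, F g ∂(shell p a b) = (2 / (b ^ 2 - a ^ 2)) • ∫ s in a..b, s • biMean p F s := by
  have := isProbabilityMeasure_shell p ha hab
  have := isProbabilityMeasure_linearWeight ha hab
  have hint : Integrable F (shell p a b) := by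
    have h1 := hF.continuousOn.integrableOn_compact (μ := shell p a b) (isCompact_radius_le p b)
    rwa [IntegrableOn, Measure.restrict_eq_self_of_ae_mem] at h1
    exact measure_eq_zero_iff_ae_notMem.1 (shell_compl_eq_zero p a b) |>.mono fun g hg => by
      simpa using hg
  have hm := measurable_stabRot_mul_unipAt_mul p
  rw [shell_eq_map p ha hab] at hint ⊢
  have hI := hint.comp_measurable hm
  rw [integral_map hm.aemeasurable hF.measurable.aestronglyMeasurable,
    ← integral_linearWeight ha hab]
  refine (integral_prod_symm _ hI).trans ((integral_prod _ hI.integral_prod_right).trans ?_)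
  rfl

/-- A family of shells whose radii vary continuously and spread out is a good averaging family. -/
theorem isGoodAveragingFamily_shell (p : UpperHalfPlane) {a b : ℝ → ℝ} {C : ℝ}
    (hab : IsSpreading a b C) (ha : Continuous a) (hb : Continuous b) {ν : ℝ → Measure PSL2R}
    (hν : ∀ r, 0 < r → ν r = shell p (a r) (b r)) : IsGoodAveragingFamily.{u} ν := by
  have hk : Measurable (stabRot p) := (continuous_stabRot p).measurable
  have hn : Measurable (unipAt p) := (continuous_unip _).measurable
  have := Measure.isProbabilityMeasure_map (μ := circleHaar) hk.aemeasurable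
  have H : IsPolarFamily (circleHaar.map (stabRot p)) (unipAt p) a b C ν :=
    { spreading := hab
      continuousAt_left := fun r _ => ha.continuousAt
      continuousAt_right := fun r _ => hb.continuousAt
      measurable := hn
      add := fun s t => unip_add _ _ _
      eq_map := fun r hr => by
        have := isProbabilityMeasure_linearWeight (hab.nonneg r hr) (hab.lt r hr)
        have h1 : (linearWeight (a r) (b r)).prod (circleHaar.map (stabRot p)) =
            ((linearWeight (a r) (b r)).prod circleHaar).map (Prod.map id (stabRot p)) := by
          rw [← Measure.map_prod_map _ _ measurable_id hk, Measure.map_id]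
        rw [hν r hr, shell_eq_map p (hab.nonneg r hr) (hab.lt r hr), h1,
          Measure.map_prod_map _ _ hk (measurable_id.prodMap hk), Measure.map_map]
        · rfl
        · exact (measurable_fst.mul (hn.comp measurable_snd.fst)).mul measurable_snd.snd
        · exact hk.prodMap (measurable_id.prodMap hk) }
  refine H.isGoodAveragingFamily ⟨fun r hr => H.isProbabilityMeasure hr, fun r hr => ?_,
    fun F => ?_⟩ fun X _ _ _ _ μ _ _ => hasMautner_unip _ μ
  · exact ⟨_, isCompact_radius_le p (b r), by rw [hν r hr, shell_compl_eq_zero]⟩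
  · have hc : Continuous fun s => s • biMean p F s :=
      continuous_id.smul (continuous_biMean p F.continuous)
    have hi (u v : ℝ) : IntervalIntegrable (fun s => s • biMean p F s) volume u v :=
      hc.intervalIntegrable u v
    have hprim := intervalIntegral.continuous_primitive hi 0
    have e : EqOn (fun r => ∫ g, F g ∂(ν r)) (fun r => (2 / (b r ^ 2 - a r ^ 2)) •
        ((∫ s in (0 : ℝ)..b r, s • biMean p F s) - ∫ s in (0 : ℝ)..a r, s • biMean p F s))
        (Ioi 0) := by
      intro r hr
      simp only
      rw [hν r hr, integral_shell p (hab.nonneg r hr) (hab.lt r hr) F.continuous,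
        intervalIntegral.integral_interval_sub_left (hi _ _) (hi _ _)]
    refine ContinuousOn.congr ?_ e
    refine ContinuousOn.smul (continuousOn_const.div
      ((hb.pow 2).sub (ha.pow 2)).continuousOn fun r hr => ?_)
      ((hprim.comp hb).sub (hprim.comp ha)).continuousOn
    have h0 := hab.nonneg r hr
    have h1 := hab.lt r hr
    have h2 : 0 < b r ^ 2 - a r ^ 2 := by nlinarith
    exact h2.ne'

theorem tendsto_two_mul_sinh {u : ℝ → ℝ} (hu : Tendsto u atTop atTop) :
    Tendsto (fun r => 2 * Real.sinh (u r)) atTop atTop := by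
  refine Tendsto.const_mul_atTop two_pos (tendsto_atTop_mono' _ ?_ hu)
  filter_upwards [hu.eventually_ge_atTop 0] with r hr using Real.self_le_sinh_iff.2 hr

/-- The inner radius of a shell of width `δ` is at most `exp (-δ)` times the outer radius. -/
theorem exp_mul_sinh_le {x δ : ℝ} (hδ : 0 ≤ δ) :
    Real.exp δ * Real.sinh x ≤ Real.sinh (x + δ) := by
  rw [Real.sinh_eq, Real.sinh_eq, neg_add, Real.exp_add, Real.exp_add]
  have h1 : Real.exp (-δ) ≤ Real.exp δ := Real.exp_le_exp.2 (by linarith)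
  nlinarith [Real.exp_pos (-x)]

theorem hypDist_le_iff {κ : ℝ} (hκ : 0 < κ) (p : UpperHalfPlane) (g : PSL2R) (r : ℝ) :
    hypDist κ (g • p) p ≤ r ↔ radius p g ≤ 2 * Real.sinh (Real.sqrt κ * r / 2) := by
  have h := Real.sqrt_pos.2 hκ
  rw [hypDist, radius, div_le_iff₀ h, mul_le_mul_iff_right₀ two_pos, Real.sinh_le_sinh,
    div_le_div_iff_of_pos_right two_pos, mul_comm]

theorem le_hypDist_iff {κ : ℝ} (hκ : 0 < κ) (p : UpperHalfPlane) (g : PSL2R) (r : ℝ) :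
    r ≤ hypDist κ (g • p) p ↔ 2 * Real.sinh (Real.sqrt κ * r / 2) ≤ radius p g := by
  have h := Real.sqrt_pos.2 hκ
  rw [hypDist, radius, le_div_iff₀ h, mul_le_mul_iff_right₀ two_pos, Real.sinh_le_sinh,
    div_le_div_iff_of_pos_right two_pos, mul_comm]

theorem ballAverage_eq_shell {κ : ℝ} (hκ : 0 < κ) (p : UpperHalfPlane) (r : ℝ) :
    ballAverage κ p r = shell p 0 (2 * Real.sinh (Real.sqrt κ * r / 2)) := by
  rw [ballAverage, shell]
  congr 1
  ext g
  simp [hypDist_le_iff hκ, radius_nonneg]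

theorem shellAverage_eq_shell {κ : ℝ} (hκ : 0 < κ) (p : UpperHalfPlane) (ε r : ℝ) :
    shellAverage κ p ε r = shell p (2 * Real.sinh (Real.sqrt κ * r / 2))
      (2 * Real.sinh (Real.sqrt κ * (r + ε) / 2)) := by
  rw [shellAverage, shell]
  congr 1
  ext g
  simp [hypDist_le_iff hκ, le_hypDist_iff hκ]

theorem isSpreading_ball {κ : ℝ} (hκ : 0 < κ) :
    IsSpreading (fun _ => 0) (fun r => 2 * Real.sinh (Real.sqrt κ * r / 2)) 1 := by
  have h := Real.sqrt_pos.2 hκ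
  refine ⟨fun r _ => le_rfl, fun r hr => ?_, fun r _ => by simp, tendsto_two_mul_sinh ?_⟩
  · have : 0 < Real.sinh (Real.sqrt κ * r / 2) := Real.sinh_pos_iff.2 (by positivity)
    positivity
  · exact (tendsto_id.const_mul_atTop h).atTop_div_const two_pos

theorem isSpreading_shell {κ ε : ℝ} (hκ : 0 < κ) (hε : 0 < ε) :
    IsSpreading (fun r => 2 * Real.sinh (Real.sqrt κ * r / 2))
      (fun r => 2 * Real.sinh (Real.sqrt κ * (r + ε) / 2))
      (1 - Real.exp (-(Real.sqrt κ * ε / 2)))⁻¹ := by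
  have h := Real.sqrt_pos.2 hκ
  refine ⟨fun r hr => ?_, fun r _ => ?_, fun r _ => ?_, tendsto_two_mul_sinh ?_⟩
  · have : 0 < Real.sinh (Real.sqrt κ * r / 2) := Real.sinh_pos_iff.2 (by positivity)
    positivity
  · have : Real.sinh (Real.sqrt κ * r / 2) < Real.sinh (Real.sqrt κ * (r + ε) / 2) := by
      rw [Real.sinh_lt_sinh]
      gcongr
      linarith
    linarith
  · set δ := Real.sqrt κ * ε / 2
    have hδ : 0 < δ := by positivity
    have h1 := exp_mul_sinh_le (x := Real.sqrt κ * r / 2) hδ.le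
    rw [show Real.sqrt κ * r / 2 + δ = Real.sqrt κ * (r + ε) / 2 by simp only [δ]; ring] at h1
    have h2 : Real.exp (-δ) < 1 := Real.exp_lt_one_iff.2 (by linarith)
    have h3 := mul_le_mul_of_nonneg_left h1 (Real.exp_pos (-δ)).le
    rw [← mul_assoc, ← Real.exp_add, neg_add_cancel, Real.exp_zero, one_mul] at h3
    rw [inv_mul_eq_div, le_div_iff₀ (by linarith)]
    linarith
  · exact ((tendsto_atTop_add_const_right _ ε tendsto_id).const_mul_atTop h).atTop_div_const two_pos

end ErgodicAverages

end

theorem mainTheorem6 (κ : ℝ) (hκ : 0 < κ) (p₀ : UpperHalfPlane) :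
    ErgodicAverages.IsGoodAveragingFamily.{u} (ErgodicAverages.ballAverage κ p₀) ∧
      ∀ ε : ℝ, 0 < ε →
        ErgodicAverages.IsGoodAveragingFamily.{u} (ErgodicAverages.shellAverage κ p₀ ε) :=
  ⟨ErgodicAverages.isGoodAveragingFamily_shell p₀ (ErgodicAverages.isSpreading_ball hκ)
      (by fun_prop) (by fun_prop) fun r _ => ErgodicAverages.ballAverage_eq_shell hκ p₀ r,
    fun ε hε => ErgodicAverages.isGoodAveragingFamily_shell p₀
      (ErgodicAverages.isSpreading_shell hκ hε) (by fun_prop) (by fun_prop)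
      fun r _ => ErgodicAverages.shellAverage_eq_shell hκ p₀ ε r⟩
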